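/- Let $I=[0,1]$, let $\mathbb S=\mathbb R/2\pi\mathbb Z$ carry its arc-length distance and Lebesgue measure $du$, and fix $T>0$. Let $W:I^2\to[-1,1]$ be symmetric and measurable with $$\lim_{\delta\to0}\int_I|W(x+\delta,y)-W(x,y)|\,dy=0\qquad\text{for every }x\in I$$ (with $\delta$ restricted to $x+\delta\in I$), and let $D:\mathbb S\to[-1,1]$ be Lipschitz with constant at most $1$. For $N\ge1$ and $1\le i,j\le N$ put $I_{N,i}=[\tfrac{i-1}N,\tfrac iN)$ and $W_{N,ij}=N^2\int_{I_{N,i}\times I_{N,j}}W(x,y)\,dx\,dy$. The Kuramoto-type system on the weighted graph $G(W,X_N)$, $X_N=\{\tfrac1N,\dots,\tfrac NN\}$, is $$\dot u_{N,i}(t)=\frac1N\sum_{j=1}^N W_{N,ij}\,D\big(u_{N,j}(t)-u_{N,i}(t)\big),\qquad u_{N,i}(0)=u^0_{N,i}\ (\mathrm{mod}\ 2\pi),\qquad t\in[0,T].$$ Let $\rho^0:\mathbb S\times I\to[0,\infty)$ be measurable with $\int_{\mathbb S}\rho^0(u,x)\,du=1$ for every $x\in I$, and such that $x\mapsto\int_{\mathbb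 S}f(u)\rho^0(u,x)\,du$ is Riemann integrable on $I$ for every $f\in C(\mathbb S)$. For each $N$ let the initial phases $u^0_{N,1},\dots,u^0_{N,N}$ be independent $\mathbb S$-valued random variables, $u^0_{N,i}$ having density $\rho^0(\cdot,i/N)$; all of them are defined on one probability space, and nothing is assumed about their joint law for different $N$. Let $\rho:[0,T]\times\mathbb S\times I\to\mathbb R$ be a weak solution of $$\partial_t\rho+\partial_u(V\rho)=0,\quad V(t,u,x)=\int_I\int_{\mathbb S}W(x,y)D(v-u)\rho(t,v,y)\,dv\,dy,\quad \rho(0,\cdot,\cdot)=\rho^0,$$ that is, $\rho$ is measurable and integrable and, for a.e. $x\in I$: $\rho(t,\cdot,x)$ is integrable for every $t\in[0,T]$; $t\mapsto\int_{\mathbb S}\rho(t,u,x)f(u)\,du$ is continuous on $[0,T]$ for every $f\in C(\mathbb S)$; and $$\int_0^T\!\int_{\mathbb S}\rho(t,u,x)\big(\partial_tw(t,u)+V(t,u,x)\,\partial_uw(t,u)\big)\,du\,dt+\int_{\mathbb S}w(0,u)\rho^0(u,x)\,du=0$$ for every $w\in C^1([0,T]\times\mathbb S)$ with support in $[0,T)\times\mathbb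 S$. For measures $\mu,\eta$ on $\mathbb S$ let $d(\mu,\eta)=\sup_f\left|\int f\,d\mu-\int f\,d\eta\right|$, the supremum over all $f:\mathbb S\to\mathbb R$ with Lipschitz constant at most $1$, and for families $\bar\mu=(\mu^x)_{x\in I}$, $\bar\eta=(\eta^x)_{x\in I}$ let $\bar d(\bar\mu,\bar\eta)=\int_I d(\mu^x,\eta^x)\,dx$. For $n,m\ge1$ and $N=nm$ put $$\nu^x_{n,m,t}=\frac1m\sum_{j=1}^m\delta_{u_{N,(i-1)m+j}(t)}\quad(x\in I_{n,i}),\qquad \nu^x_t(A)=\int_A\rho(t,u,x)\,du .$$ Then for every $\varepsilon>0$ there is a (deterministic) $n_1\in\mathbb N$ such that almost surely there is a (random) $m_1\in\mathbb N$ with $$\sup_{t\in[0,T]}\bar d(\bar\nu_{n,m,t},\bar\nu_t)<\varepsilon\qquad\text{for all }n\ge n_1,\ m\ge m_1 .$$ -/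

import Mathlib

open MeasureTheory ProbabilityTheory Filter Topology
open scoped ENNReal unitInterval

namespace KuramotoGraphon

noncomputable section

instance instFactTwoPiPos : Fact (0 < 2 * Real.pi) := ⟨Real.two_pi_pos⟩

/-- The circle `𝕊 = ℝ / 2πℤ` with its arc-length distance and Lebesgue measure (total mass `2π`). -/
abbrev Phase : Type := AddCircle (2 * Real.pi)

/-- The interval `I_{n,i} = [(i-1)/n, i/n)`, where the index `i` is shifted to start from `0`. -/
def block (n : ℕ) (i : Fin n) : Set I :=
  {x | (i : ℝ) / n ≤ (x : ℝ) ∧ (x : ℝ) < ((i : ℝ) + 1) / n}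

/-- The node `x_{N,i} = i/N` for `i = 1, …, N`, where the index `i` is shifted to start from `0`. -/
def node (N : ℕ) (i : Fin N) : I :=
  ⟨((i : ℝ) + 1) / N, by
    have hi : ((i : ℕ) : ℝ) + 1 ≤ N := by exact_mod_cast i.isLt
    exact ⟨by positivity, div_le_one_of_le₀ hi (by positivity)⟩⟩

/-- A graphon: a symmetric measurable function on the unit square, normalised by `|W| ≤ 1`, with
`∫ |W(x + δ, y) - W(x, y)| dy → 0` as `δ → 0`, for every `x` (with `x + δ` ranging in `[0,1]`). -/
structure IsGraphon (W : I → I → ℝ) : Prop where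
  measurable : Measurable (Function.uncurry W)
  symm : ∀ x y, W x y = W y x
  abs_le_one : ∀ x y, |W x y| ≤ 1
  continuous_L1 : ∀ x, Tendsto (fun x' : I => ∫ y : I, |W x' y - W x y|) (𝓝 x) (𝓝 0)

/-- A coupling function: Lipschitz on the circle with constant `1` and bounded by `1`. -/
structure IsCoupling (D : Phase → ℝ) : Prop where
  lipschitz : LipschitzWith 1 D
  abs_le_one : ∀ u, |D u| ≤ 1

/-- The edge weights of the graph `G(W, X_N)`: averages of `W` over the cells
`I_{N,i} × I_{N,j}`. -/
def weight (W : I → I → ℝ) (N : ℕ) (i j : Fin N) : ℝ :=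
  (N : ℝ) ^ 2 * ∫ p in block N i ×ˢ block N j, W p.1 p.2

/-- `u` solves, on `[0,T]`, the Kuramoto model on the graph `G(W, X_N)` with initial phases `u₀`.
The phases are real functions of time, and their values on the circle start from `u₀`. -/
structure IsKMSolution (T : ℝ) (W : I → I → ℝ) (D : Phase → ℝ) (N : ℕ) (u₀ : Fin N → Phase)
    (u : ℝ → Fin N → ℝ) : Prop where
  deriv : ∀ t ∈ Set.Icc 0 T, ∀ i, HasDerivWithinAt (fun s => u s i)
    ((N : ℝ)⁻¹ * ∑ j, weight W N i j * D ((u t j - u t i : ℝ) : Phase)) (Set.Icc 0 T) t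
  init : ∀ i, ((u 0 i : ℝ) : Phase) = u₀ i

/-- Riemann integrability on `[0,1]` (Darboux's form): for every `ε > 0` some partition
`0 = p₀ ≤ … ≤ p_k = 1` has upper and lower sums that differ by less than `ε`. The numbers `b i` and
`a i` are upper and lower bounds of `f` on the `i`-th interval, so `f` is bounded. -/
def RiemannIntegrable (f : I → ℝ) : Prop :=
  ∀ ε : ℝ, 0 < ε → ∃ (k : ℕ) (p : Fin (k + 1) → I) (a b : Fin k → ℝ),
    Monotone p ∧ p 0 = 0 ∧ p (Fin.last k) = 1 ∧
    (∀ i : Fin k, ∀ x ∈ Set.Icc (p i.castSucc) (p i.succ), a i ≤ f x ∧ f x ≤ b i) ∧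
    ∑ i : Fin k, (b i - a i) * ((p i.succ : ℝ) - (p i.castSucc : ℝ)) < ε

/-- An initial density `ρ⁰(u, x)`: a probability density in `u` for every `x`, such that
`x ↦ ∫ f(u) ρ⁰(u, x) du` is Riemann integrable for every continuous `f` on the circle. -/
structure IsInitialDensity (ρ₀ : Phase → I → ℝ) : Prop where
  measurable : Measurable (Function.uncurry ρ₀)
  nonneg : ∀ u x, 0 ≤ ρ₀ u x
  integrable : ∀ x, Integrable (fun u => ρ₀ u x)
  integral_eq_one : ∀ x, ∫ u : Phase, ρ₀ u x = 1
  riemann : ∀ f : C(Phase, ℝ), RiemannIntegrable (fun x => ∫ u : Phase, f u * ρ₀ u x)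

/-- The velocity field `V(t,u,x) = ∫_I ∫_𝕊 W(x,y) D(v-u) ρ(t,v,y) dv dy`. -/
def velocity (W : I → I → ℝ) (D : Phase → ℝ) (ρ : ℝ → Phase → I → ℝ)
    (t : ℝ) (u : Phase) (x : I) : ℝ :=
  ∫ y : I, ∫ v : Phase, W x y * D (v - u) * ρ t v y

/-- Test functions: `C¹` functions of time and phase with support in `[0,T) × 𝕊`.
A `C¹` function on `[0,T] × 𝕊` with this support extends to all times. -/
structure IsTestFunction (T : ℝ) (w : ℝ → Phase → ℝ) : Prop where
  contDiff : ContDiff ℝ 1 (fun p : ℝ × ℝ => w p.1 (p.2 : Phase))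
  support : ∃ T' < T, ∀ t, T' ≤ t → ∀ u, w t u = 0

/-- The partial derivative `∂w/∂t`. -/
def timeDeriv (w : ℝ → Phase → ℝ) (t : ℝ) (u : Phase) : ℝ :=
  deriv (fun s : ℝ => w s u) t

/-- The partial derivative `∂w/∂u` along the circle. -/
def phaseDeriv (w : ℝ → Phase → ℝ) (t : ℝ) (u : Phase) : ℝ :=
  deriv (fun s : ℝ => w t (u + (s : Phase))) 0

/-- `ρ` is a weak solution, on `[0,T]`, of the mean-field equation
`∂ρ/∂t + ∂(V ρ)/∂u = 0` with `ρ(0, ·, ·) = ρ₀`. The two integrability conditions say that the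
integrals in the definition of the velocity and in the weak formulation make sense. -/
structure IsWeakSolution (T : ℝ) (W : I → I → ℝ) (D : Phase → ℝ) (ρ₀ : Phase → I → ℝ)
    (ρ : ℝ → Phase → I → ℝ) : Prop where
  measurable : Measurable (fun p : ℝ × Phase × I => ρ p.1 p.2.1 p.2.2)
  integrable : IntegrableOn (fun p : ℝ × Phase × I => ρ p.1 p.2.1 p.2.2)
    (Set.Icc 0 T ×ˢ Set.univ)
  integrable_section : ∀ᵐ x : I, ∀ t ∈ Set.Icc 0 T, Integrable (fun u => ρ t u x)
  weaklyContinuous : ∀ᵐ x : I, ∀ f : C(Phase, ℝ),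
    ContinuousOn (fun t => ∫ u : Phase, ρ t u x * f u) (Set.Icc 0 T)
  weak_eq : ∀ᵐ x : I, ∀ w : ℝ → Phase → ℝ, IsTestFunction T w →
    (∫ t in Set.Icc 0 T, ∫ u : Phase, ρ t u x *
        (timeDeriv w t u + velocity W D ρ t u x * phaseDeriv w t u))
      + ∫ u : Phase, w 0 u * ρ₀ u x = 0

/-- The bounded Lipschitz distance: supremum over `f` with Lipschitz constant at most `1`. -/
def dBL (μ η : Measure Phase) : ℝ≥0∞ :=
  ⨆ (f : Phase → ℝ) (_ : LipschitzWith 1 f), ENNReal.ofReal |(∫ v, f v ∂μ) - ∫ v, f v ∂η|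

/-- The distance `∫_I d(μ^x, η^x) dx` between families of measures indexed by `x ∈ I`. -/
def dBar (μ η : I → Measure Phase) : ℝ≥0∞ :=
  ∫⁻ x : I, dBL (μ x) (η x)

/-- The block empirical measure of the phases `u` of `n * m` oscillators: for `x ∈ I_{n,i}` it is
the average of the Dirac masses at the phases with (one-based) indices `(i-1)m+1, …, (i-1)m+m`.
The point `x = 1`, of measure zero, lies in no block and gets the zero measure. -/
def blockEmpirical (n m : ℕ) (u : Fin (n * m) → ℝ) (x : I) : Measure Phase :=
  ∑ i : Fin n, (block n i).indicator (fun _ => (m : ℝ≥0∞)⁻¹ •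
    ∑ j : Fin m, Measure.dirac ((u (finProdFinEquiv (i, j)) : ℝ) : Phase)) x

/-- The measure on the circle with density `ρ(t, ·, x)`. -/
def densityMeasure (ρ : ℝ → Phase → I → ℝ) (t : ℝ) (x : I) : Measure Phase :=
  (volume : Measure Phase).withDensity (fun u => ENNReal.ofReal (ρ t u x))

end

end KuramotoGraphon

namespace KuramotoGraphon

noncomputable section

/-! ### Smooth and Lipschitz functions on the circle -/

/-! The proof is a Dobrushin-type stability estimate in the bounded Lipschitz distance, followed by
a law of large numbers at time zero.

Once ρ is fixed, the equation at a label x is a linear transport equation with field V(t,·,x). The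
slice ρ(t,·,x) follows this field, and so does the empirical measure of the particles in the block
of x, up to an error r(t). The two are compared by duality, without constructing a flow of V, which
is controlled only integrably in time. On a short interval [a,b] a test function g is carried
backwards to g(u+(b-a)β(u)), where β is a C¹ mollification of the time average of V. `StepBound`
measures the cost of such an Euler step. It holds for weak solutions
(`IsLinearSolution.exists_stepBound`) and for particles (`stepBound_particle`), and passes to
averages and differences. When the steps are iterated (`dual_scheme`), the Lipschitz constant grows
at most by the factor exp ∫M, the discretisation error vanishes with the mesh, and only ∫r is left.

A weak solution is not assumed to be nonnegative or of mass one. The scheme turns f into f∘φ, so it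
preserves sign and constants, and this yields both properties
(`IsLinearSolution.isProbabilityDensity`). Then V is bounded by 1 and 1-Lipschitz.

The error r(t) is at most the averaged distance at time t plus a kernel error
(`abs_velocity_sub_le`). Integration over x and a Grönwall argument bound the distance at all times
by the initial distance and the mean kernel error (`dBar_le`). The latter is small for large n,
uniformly in m, by L¹ approximation of W by continuous functions
(`exists_integral_blockKernelError_le`).

At time zero a finite net of Lipschitz functions leaves finitely many f to treat. Riemann
integrability brings the node averages of x ↦ ∫ f ρ⁰(·,x) close to this function for large n,
uniformly in m (`RiemannIntegrable.exists_average_le`), which produces the deterministic n₁. The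
random fluctuations exceed a threshold with probability at most 2^n exp(-κnm), by Hoeffding's
inequality and a union over sign patterns. This is summable over all pairs (n,m) with m large, so
Borel–Cantelli gives a single m₁ for all n, whatever the joint law for different N. -/

/-- A function on the circle whose lift to the line is continuously differentiable. -/
def IsC1 (g : Phase → ℝ) : Prop := ContDiff ℝ 1 (fun s : ℝ => g (s : Phase))

/-- A Lipschitz bound with a real constant. -/
def LipBound (G : ℝ) (g : Phase → ℝ) : Prop := ∀ u v, |g u - g v| ≤ G * dist u v

/-- The displacement of `g` along the vector field `c • β`. -/
def displace (g β : Phase → ℝ) (c : ℝ) (u : Phase) : ℝ := g (u + ((c * β u : ℝ) : Phase))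

/-- The running average of `f` over arcs of length `h`. -/
def steklov (h : ℝ) (f : Phase → ℝ) (u : Phase) : ℝ := h⁻¹ * ∫ s in (0 : ℝ)..h, f (u + (s : Phase))

theorem Phase.dist_coe_le (x y : ℝ) : dist (x : Phase) (y : Phase) ≤ |x - y| := by
  rw [dist_eq_norm, ← AddCircle.coe_sub]
  exact QuotientAddGroup.norm_mk_le_norm

theorem Phase.continuous_coe : Continuous (fun s : ℝ => (s : Phase)) :=
  AddCircle.continuous_mk' _

theorem Phase.dist_le (u v : Phase) : dist u v ≤ Real.pi := by
  rw [dist_eq_norm]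
  have := AddCircle.norm_le_half_period (2 * Real.pi) (x := u - v) Real.two_pi_pos.ne'
  rw [abs_of_pos Real.two_pi_pos] at this
  linarith

theorem LipBound.continuous {G : ℝ} {g : Phase → ℝ} (hg : LipBound G g) : Continuous g :=
  (LipschitzWith.of_dist_le' (K := G) (fun u v => by rw [Real.dist_eq]; exact hg u v)).continuous

theorem LipschitzWith.lipBound {g : Phase → ℝ} (hg : LipschitzWith 1 g) : LipBound 1 g :=
  fun u v => by simpa [Real.dist_eq] using hg.dist_le_mul u v

theorem LipBound.lipschitzWith {g : Phase → ℝ} (hg : LipBound 1 g) : LipschitzWith 1 g := by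
  simpa using LipschitzWith.of_dist_le' (K := 1) (fun u v => by rw [Real.dist_eq]; exact hg u v)

theorem LipBound.mono {G G' : ℝ} {g : Phase → ℝ} (hg : LipBound G g) (h : G ≤ G') :
    LipBound G' g :=
  fun u v => (hg u v).trans (mul_le_mul_of_nonneg_right h dist_nonneg)

theorem LipBound.displace {G B : ℝ} {g β : Phase → ℝ} (hG : 0 ≤ G) (hg : LipBound G g)
    (hβ : LipBound B β) {c : ℝ} (hc : 0 ≤ c) : LipBound (G * (1 + c * B)) (displace g β c) := by
  intro u v
  refine (hg _ _).trans ?_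
  rw [mul_assoc]
  refine mul_le_mul_of_nonneg_left ?_ hG
  refine (dist_add_add_le _ _ _ _).trans ?_
  have h1 := Phase.dist_coe_le (c * β u) (c * β v)
  have h2 := mul_le_mul_of_nonneg_left (hβ u v) hc
  rw [← mul_sub, abs_mul, abs_of_nonneg hc] at h1
  linarith

theorem IsC1.continuous {g : Phase → ℝ} (hg : IsC1 g) : Continuous g := by
  have h := ContDiff.continuous hg
  exact (QuotientAddGroup.isQuotientMap_mk (N := AddSubgroup.zmultiples (2 * Real.pi))).continuous_iff.2 h

theorem IsC1.displace {g β : Phase → ℝ} (hg : IsC1 g) (hβ : IsC1 β) (c : ℝ) :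
    IsC1 (displace g β c) := by
  have : ContDiff ℝ 1 (fun s : ℝ => s + c * β (s : Phase)) :=
    contDiff_id.add (contDiff_const.mul hβ)
  simpa [IsC1, KuramotoGraphon.displace, Function.comp_def] using ContDiff.comp hg this

theorem steklov_coe (h : ℝ) (f : Phase → ℝ) (s : ℝ) :
    steklov h f (s : Phase) = h⁻¹ * ∫ r in s..(s + h), f (r : Phase) := by
  unfold steklov
  congr 1
  have := intervalIntegral.integral_comp_add_left (a := 0) (b := h)
    (fun r : ℝ => f (r : Phase)) s
  simpa using this

/-- By the fundamental theorem of calculus the lift has derivative (f(s+h)-f(s))/h, which is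
continuous because f is. -/
theorem isC1_steklov (h : ℝ) {f : Phase → ℝ} (hf : Continuous f) : IsC1 (steklov h f) := by
  have hc : Continuous (fun r : ℝ => f (r : Phase)) := hf.comp Phase.continuous_coe
  have hd : ∀ s : ℝ, HasDerivAt (fun s : ℝ => steklov h f (s : Phase))
      (h⁻¹ * (f ((s + h : ℝ) : Phase) - f (s : Phase))) s := by
    intro s
    simp_rw [steklov_coe]
    refine HasDerivAt.const_mul _ ?_
    have e : ∀ s : ℝ, ∫ r in s..(s + h), f (r : Phase)
        = (∫ r in (0 : ℝ)..(s + h), f (r : Phase)) - ∫ r in (0 : ℝ)..s, f (r : Phase) := by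
      intro s
      rw [intervalIntegral.integral_interval_sub_left] <;> exact hc.intervalIntegrable _ _
    simp_rw [e]
    refine HasDerivAt.sub ?_ (intervalIntegral.integral_hasDerivAt_right
      (hc.intervalIntegrable _ _) (hc.stronglyMeasurableAtFilter _ _) hc.continuousAt)
    have h1 := intervalIntegral.integral_hasDerivAt_right (a := 0) (b := s + h)
      (hc.intervalIntegrable _ _) (hc.stronglyMeasurableAtFilter _ _) hc.continuousAt
    simpa using h1.comp_add_const s h
  unfold IsC1
  rw [contDiff_one_iff_deriv]
  refine ⟨fun s => (hd s).differentiableAt, ?_⟩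
  rw [show deriv _ = _ from funext fun s => (hd s).deriv]
  have : Continuous (fun s : ℝ => f ((s + h : ℝ) : Phase)) :=
    hc.comp (continuous_id.add continuous_const)
  exact continuous_const.mul (this.sub hc)

theorem continuous_translate {f : Phase → ℝ} (hf : Continuous f) (u : Phase) :
    Continuous (fun s : ℝ => f (u + (s : Phase))) :=
  hf.comp (continuous_const.add Phase.continuous_coe)

/-- An average of translates loses nothing in the Lipschitz constant. This matters because the
constants are multiplied along the scheme. -/
theorem LipBound.steklov {G h : ℝ} (hh : 0 < h) {f : Phase → ℝ} (hf : LipBound G f) :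
    LipBound G (steklov h f) := by
  intro u v
  have hc := hf.continuous
  unfold KuramotoGraphon.steklov
  rw [← mul_sub, ← intervalIntegral.integral_sub
    ((continuous_translate hc u).intervalIntegrable _ _)
    ((continuous_translate hc v).intervalIntegrable _ _), abs_mul, abs_of_pos (inv_pos.2 hh)]
  have := intervalIntegral.norm_integral_le_of_norm_le_const (a := 0) (b := h)
    (C := G * dist u v) (f := fun s : ℝ => f (u + (s : Phase)) - f (v + (s : Phase)))
    (fun s _ => by simpa using hf (u + (s : Phase)) (v + (s : Phase)))
  rw [Real.norm_eq_abs, sub_zero, abs_of_pos hh] at this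
  calc _ ≤ h⁻¹ * (G * dist u v * h) := mul_le_mul_of_nonneg_left this (inv_pos.2 hh).le
    _ = _ := by field_simp

theorem abs_steklov_sub_le {G h : ℝ} (hh : 0 < h) (hG : 0 ≤ G) {f : Phase → ℝ}
    (hf : LipBound G f) (u : Phase) : |steklov h f u - f u| ≤ G * h := by
  have hc := hf.continuous
  have e : steklov h f u - f u = h⁻¹ * ∫ s in (0 : ℝ)..h, (f (u + (s : Phase)) - f u) := by
    unfold KuramotoGraphon.steklov
    rw [intervalIntegral.integral_sub ((continuous_translate hc u).intervalIntegrable _ _)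
      (by simp)]
    simp [mul_sub, hh.ne']
  rw [e, abs_mul, abs_of_pos (inv_pos.2 hh)]
  have := intervalIntegral.norm_integral_le_of_norm_le_const (a := 0) (b := h)
    (C := G * h) (f := fun s : ℝ => f (u + (s : Phase)) - f u)
    (fun s hs => by
      rw [Set.uIoc_of_le hh.le] at hs
      refine (hf _ _).trans (mul_le_mul_of_nonneg_left ?_ hG)
      have h1 := Phase.dist_coe_le s 0
      rw [sub_zero, abs_of_pos hs.1] at h1
      have h2 : dist (u + (s : Phase)) u = dist (s : Phase) ((0 : ℝ) : Phase) := by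
        simp [dist_eq_norm]
      rw [h2]
      exact h1.trans hs.2)
  rw [Real.norm_eq_abs, sub_zero, abs_of_pos hh] at this
  calc _ ≤ h⁻¹ * (G * h * h) := mul_le_mul_of_nonneg_left this (inv_pos.2 hh).le
    _ = _ := by field_simp

/-! ### A backward Euler scheme for the dual transport equation -/

/-- The functionals `Λ t` on functions on the circle follow the transport by `V` up to an error
`r`: displacing a test function backwards along a field `β` close to `V` changes the value of the
functional by a controlled amount. -/
def StepBound (T C : ℝ) (V : ℝ → Phase → ℝ) (M r : ℝ → ℝ) (Λ : ℝ → (Phase → ℝ) → ℝ) : Prop :=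
  ∀ (a b : ℝ), 0 ≤ a → a ≤ b → b ≤ T → ∀ (g β : Phase → ℝ) (G B : ℝ) (q : ℝ → ℝ),
    0 ≤ G → 0 ≤ B → IsC1 g → LipBound G g → IsC1 β → LipBound B β →
    IntervalIntegrable q volume a b → (∀ᵐ t, t ∈ Set.Ioc a b → ∀ u, |V t u - β u| ≤ q t) →
    |Λ b g - Λ a (displace g β (b - a))| ≤
      G * ∫ t in a..b, (C * (q t + M t * ((b - a) * B)) + r t * (1 + (b - a) * B))

/-- Time-integrable bounds on a velocity field on the circle and on its Lipschitz constant. -/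
structure VelocityBound (T : ℝ) (V : ℝ → Phase → ℝ) (M : ℝ → ℝ) : Prop where
  nonneg : ∀ t, 0 ≤ M t
  integrable : IntervalIntegrable M volume 0 T
  measurable : ∀ u, Measurable (fun t => V t u)
  bound : ∀ᵐ t, t ∈ Set.Ioc 0 T → ∀ u, |V t u| ≤ M t
  lip : ∀ᵐ t, t ∈ Set.Ioc 0 T → LipBound (M t) (V t)

/-- A velocity field is approximated in `L¹` in time, uniformly in space, by fields that are
uniformly continuous in time. -/
def TimeRegular (T : ℝ) (V : ℝ → Phase → ℝ) : Prop :=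
  ∀ η > 0, ∃ (V' : ℝ → Phase → ℝ) (m : ℝ → ℝ), ∃ δ > 0, (∀ t, 0 ≤ m t) ∧
    IntervalIntegrable m volume 0 T ∧ ∫ t in 0..T, m t ≤ η ∧
    (∀ᵐ t, t ∈ Set.Ioc 0 T → ∀ u, |V t u - V' t u| ≤ m t) ∧
    ∀ t s u, |t - s| ≤ δ → |V' t u - V' s u| ≤ η

theorem intervalIntegrable_sub {m : ℝ → ℝ} {T a b : ℝ} (hm : IntervalIntegrable m volume 0 T)
    (ha : 0 ≤ a) (hab : a ≤ b) (hb : b ≤ T) : IntervalIntegrable m volume a b :=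
  hm.mono_set (by
    rw [Set.uIcc_of_le hab, Set.uIcc_of_le (ha.trans (hab.trans hb))]
    exact Set.Icc_subset_Icc ha hb)

/-- One backward step with β the mollified time average of V. The form g = f ∘ φ is recorded because
sign and constants are later read off from it. -/
theorem dual_step {T C : ℝ} {V : ℝ → Phase → ℝ} {M r : ℝ → ℝ} {Λ : ℝ → (Phase → ℝ) → ℝ}
    (hC : 0 ≤ C) (hV : VelocityBound T V M) (hΛ : StepBound T C V M r Λ)
    (hr : IntervalIntegrable r volume 0 T) (hr0 : ∀ t, 0 ≤ r t)
    {η δ : ℝ} (hη : 0 < η) {V' : ℝ → Phase → ℝ} {m : ℝ → ℝ} (hm0 : ∀ t, 0 ≤ m t)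
    (hm : IntervalIntegrable m volume 0 T)
    (hVV' : ∀ᵐ t, t ∈ Set.Ioc 0 T → ∀ u, |V t u - V' t u| ≤ m t)
    (hV' : ∀ t s u, |t - s| ≤ δ → |V' t u - V' s u| ≤ η)
    {a b : ℝ} (ha : 0 ≤ a) (hab : a < b) (hb : b ≤ T) (hδ : b - a ≤ δ)
    (hM : ∫ t in a..b, M t ≤ η)
    {f : Phase → ℝ} {G : ℝ} (hG : 0 ≤ G) (hf : IsC1 f) (hfG : LipBound G f) :
    ∃ g φ, IsC1 g ∧ LipBound (G * Real.exp (∫ t in a..b, M t)) g ∧ g = f ∘ φ ∧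
      |Λ b f - Λ a g| ≤ G * Real.exp (∫ t in a..b, M t) *
        ∫ t in a..b, (C * (2 * m t + η + 2 * η * M t) + r t) := by
  set μ := ∫ t in a..b, M t with hμ
  have hMi := intervalIntegrable_sub hV.integrable ha hab.le hb
  have hmi := intervalIntegrable_sub hm ha hab.le hb
  have hri := intervalIntegrable_sub hr ha hab.le hb
  have hμ0 : 0 ≤ μ := intervalIntegral.integral_nonneg hab.le fun t _ => hV.nonneg t
  have hd : 0 < b - a := sub_pos.2 hab
  have hsub : ∀ t, t ∈ Set.Ioc a b → t ∈ Set.Ioc 0 T :=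
    fun t ht => ⟨ha.trans_lt ht.1, ht.2.trans hb⟩
  have hVi : ∀ u, IntervalIntegrable (fun t => V t u) volume a b := by
    intro u
    refine hMi.mono_fun (hV.measurable u).aestronglyMeasurable ?_
    rw [Set.uIoc_of_le hab.le]
    refine (ae_restrict_iff' measurableSet_Ioc).2 ?_
    filter_upwards [hV.bound] with t ht hta
    simpa [abs_of_nonneg (hV.nonneg t)] using ht (hsub t hta) u
  set βh : Phase → ℝ := fun u => (b - a)⁻¹ * ∫ t in a..b, V t u with hβh
  have hβhL : LipBound (μ / (b - a)) βh := by
    intro u v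
    simp only [hβh]
    rw [← mul_sub, ← intervalIntegral.integral_sub (hVi u) (hVi v), abs_mul,
      abs_of_pos (inv_pos.2 hd)]
    have := intervalIntegral.norm_integral_le_of_norm_le (f := fun t => V t u - V t v) hab.le
      (g := fun t => M t * dist u v)
      (by filter_upwards [hV.lip] with t ht hta using ht (hsub t hta) u v) (hMi.mul_const _)
    rw [intervalIntegral.integral_mul_const, ← hμ, Real.norm_eq_abs] at this
    calc _ ≤ (b - a)⁻¹ * (μ * dist u v) := mul_le_mul_of_nonneg_left this (inv_pos.2 hd).le
      _ = _ := by field_simp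
  have hB0 : 0 ≤ μ / (b - a) := by positivity
  -- The time average is only Lipschitz, while `StepBound` asks for a C¹ field.
  set β := steklov η βh
  have hβL : LipBound (μ / (b - a)) β := hβhL.steklov hη
  have hβ : IsC1 β := isC1_steklov η hβhL.continuous
  -- The first three terms bound V(t) minus its time average: m(t)+m(s)+η, averaged over s. The last
  -- is the mollification error, the Lipschitz constant of the average times η.
  set q : ℝ → ℝ := fun t => m t + ((b - a)⁻¹ * ∫ t in a..b, m t) + η + η * (μ / (b - a)) with hq
  have hqi : IntervalIntegrable q volume a b :=
    ((hmi.add intervalIntegrable_const).add intervalIntegrable_const).add intervalIntegrable_const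
  have hVq : ∀ᵐ t, t ∈ Set.Ioc a b → ∀ u, |V t u - β u| ≤ q t := by
    filter_upwards [hVV'] with t ht hta u
    have h1 := abs_steklov_sub_le hη hB0 hβhL u
    have h2 : |V t u - βh u| ≤ m t + ((b - a)⁻¹ * ∫ t in a..b, m t) + η := by
      have e : V t u - βh u = (b - a)⁻¹ * ∫ s in a..b, (V t u - V s u) := by
        rw [intervalIntegral.integral_sub intervalIntegrable_const (hVi u)]
        simp only [hβh, intervalIntegral.integral_const, smul_eq_mul]
        field_simp
      have h3 := intervalIntegral.norm_integral_le_of_norm_le (f := fun s => V t u - V s u) hab.le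
        (g := fun s => m t + m s + η) (by
          filter_upwards [hVV'] with s hs hsa
          have e1 := ht (hsub t hta) u
          have e2 := hs (hsub s hsa) u
          have e3 := hV' t s u (by
            rw [abs_le]; constructor <;> linarith [hta.1, hta.2, hsa.1, hsa.2])
          rw [Real.norm_eq_abs]
          rw [abs_le] at *
          constructor <;> linarith [e1.1, e1.2, e2.1, e2.2, e3.1, e3.2])
        ((intervalIntegrable_const.add hmi).add intervalIntegrable_const)
      rw [intervalIntegral.integral_add (intervalIntegrable_const.add hmi)
        intervalIntegrable_const, intervalIntegral.integral_add intervalIntegrable_const hmi] at h3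
      simp only [intervalIntegral.integral_const, smul_eq_mul, Real.norm_eq_abs] at h3
      rw [e, abs_mul, abs_of_pos (inv_pos.2 hd)]
      calc _ ≤ (b - a)⁻¹ * ((b - a) * m t + (∫ t in a..b, m t) + (b - a) * η) :=
            mul_le_mul_of_nonneg_left h3 (inv_pos.2 hd).le
        _ = _ := by field_simp
    have : |V t u - β u| ≤ |V t u - βh u| + |β u - βh u| := by
      rw [abs_sub_comm (β u)]; exact abs_sub_le _ _ _
    simp only [hq]
    linarith
  have key := hΛ a b ha hab.le hb f β G (μ / (b - a)) q hG hB0 hf hfG hβ hβL hqi hVq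
  have hmul : (b - a) * (μ / (b - a)) = μ := by field_simp
  have hexp : 1 + μ ≤ Real.exp μ := by linarith [Real.add_one_le_exp μ]
  refine ⟨displace f β (b - a), fun u => u + (((b - a) * β u : ℝ) : Phase), hf.displace hβ _,
    ?_, rfl, key.trans ?_⟩
  · refine (hfG.displace hG hβL hd.le).mono ?_
    rw [hmul]
    exact mul_le_mul_of_nonneg_left hexp hG
  · rw [hmul, mul_assoc]
    refine mul_le_mul_of_nonneg_left ?_ hG
    have i1 : ∫ t in a..b, q t = 2 * (∫ t in a..b, m t) + η * (b - a) + η * μ := by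
      simp only [hq]
      rw [intervalIntegral.integral_add ((hmi.add intervalIntegrable_const).add
        intervalIntegrable_const) intervalIntegrable_const, intervalIntegral.integral_add
        (hmi.add intervalIntegrable_const) intervalIntegrable_const,
        intervalIntegral.integral_add hmi intervalIntegrable_const]
      simp only [intervalIntegral.integral_const, smul_eq_mul]
      field_simp
      ring
    have i2 : ∫ t in a..b, (C * (q t + M t * μ) + r t * (1 + μ))
        = C * (2 * (∫ t in a..b, m t) + η * (b - a) + η * μ + μ * μ)
          + (∫ t in a..b, r t) * (1 + μ) := by
      rw [intervalIntegral.integral_add ((hqi.add (hMi.mul_const _)).const_mul _)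
        (hri.mul_const _), intervalIntegral.integral_const_mul,
        intervalIntegral.integral_add hqi (hMi.mul_const _), intervalIntegral.integral_mul_const,
        intervalIntegral.integral_mul_const, i1]
    have i3 : ∫ t in a..b, (C * (2 * m t + η + 2 * η * M t) + r t)
        = C * (2 * (∫ t in a..b, m t) + η * (b - a) + 2 * η * μ) + (∫ t in a..b, r t) := by
      rw [intervalIntegral.integral_add (((((hmi.const_mul _).add intervalIntegrable_const)).add
        (hMi.const_mul _)).const_mul _) hri, intervalIntegral.integral_const_mul,
        intervalIntegral.integral_add ((hmi.const_mul _).add intervalIntegrable_const)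
        (hMi.const_mul _), intervalIntegral.integral_add (hmi.const_mul _)
        intervalIntegrable_const]
      simp only [intervalIntegral.integral_const_mul, intervalIntegral.integral_const, smul_eq_mul]
      ring
    rw [i2, i3]
    have hR0 : 0 ≤ ∫ t in a..b, r t := intervalIntegral.integral_nonneg hab.le fun t _ => hr0 t
    have hm00 : 0 ≤ ∫ t in a..b, m t := intervalIntegral.integral_nonneg hab.le fun t _ => hm0 t
    set X := 2 * (∫ t in a..b, m t) + η * (b - a) + 2 * η * μ with hX
    have hX0 : 0 ≤ X := by positivity
    -- The quadratic term μ² is at most ημ because the mesh makes μ ≤ η.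
    have hX1 : 2 * (∫ t in a..b, m t) + η * (b - a) + η * μ + μ * μ ≤ X := by
      have := mul_le_mul_of_nonneg_right hM hμ0
      simp only [hX]; linarith
    have hCX : 0 ≤ C * X := by positivity
    have hE : 1 ≤ Real.exp μ := by linarith
    have := mul_le_mul_of_nonneg_left hX1 hC
    have := mul_le_mul_of_nonneg_right hE hCX
    have := mul_le_mul_of_nonneg_left hexp hR0
    linarith

/-- The primitive of M is uniformly continuous on the compact interval [0,T]. -/
theorem exists_mesh {M : ℝ → ℝ} {T : ℝ} (hT : 0 ≤ T) (hM : IntervalIntegrable M volume 0 T)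
    {η : ℝ} (hη : 0 < η) :
    ∃ δ > 0, ∀ a b, 0 ≤ a → a ≤ b → b ≤ T → b - a ≤ δ → ∫ t in a..b, M t ≤ η := by
  have hc : ContinuousOn (fun t => ∫ s in (0 : ℝ)..t, M s) (Set.Icc 0 T) := by
    have := intervalIntegral.continuousOn_primitive_interval (μ := volume) (f := M)
      (a := 0) (b := T) (by
        rw [Set.uIcc_of_le hT]; exact (intervalIntegrable_iff_integrableOn_Icc_of_le hT).1 hM)
    rwa [Set.uIcc_of_le hT] at this
  have hu := isCompact_Icc.uniformContinuousOn_of_continuous hc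
  obtain ⟨δ, hδ, h⟩ := Metric.uniformContinuousOn_iff.1 hu η hη
  refine ⟨δ / 2, by positivity, fun a b ha hab hb hd => ?_⟩
  have h1 := h b ⟨ha.trans hab, hb⟩ a ⟨ha, hab.trans hb⟩ (by
    rw [Real.dist_eq, abs_of_nonneg (by linarith)]; linarith)
  rw [Real.dist_eq, intervalIntegral.integral_interval_sub_left
    (intervalIntegrable_sub hM le_rfl (ha.trans hab) hb)
    (intervalIntegrable_sub hM le_rfl ha (hab.trans hb))] at h1
  exact (le_abs_self _).trans h1.le

/-- The factors exp ∫M of the single steps multiply to the exponential of the whole integral. The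
consistency errors add up to O(η), so the constant C does not appear in the conclusion. -/
theorem dual_scheme {T C : ℝ} {V : ℝ → Phase → ℝ} {M r : ℝ → ℝ} {Λ : ℝ → (Phase → ℝ) → ℝ}
    (hC : 0 ≤ C) (hV : VelocityBound T V M) (hreg : TimeRegular T V)
    (hΛ : StepBound T C V M r Λ) (hr : IntervalIntegrable r volume 0 T) (hr0 : ∀ t, 0 ≤ r t)
    {s : ℝ} (hs : s ∈ Set.Icc 0 T) {f : Phase → ℝ} {G : ℝ} (hG : 0 ≤ G) (hf : IsC1 f)
    (hfG : LipBound G f) {ε : ℝ} (hε : 0 < ε) :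
    ∃ g φ, IsC1 g ∧ LipBound (G * Real.exp (∫ t in 0..s, M t)) g ∧ g = f ∘ φ ∧
      |Λ s f - Λ 0 g| ≤ G * Real.exp (∫ t in 0..s, M t) * ((∫ t in 0..s, r t) + ε) := by
  have hT : 0 ≤ T := hs.1.trans hs.2
  have hMT : 0 ≤ ∫ t in 0..T, M t := intervalIntegral.integral_nonneg hT fun t _ => hV.nonneg t
  -- Over all steps the consistency error is at most ηC(2+T+2∫M) ≤ ηA = ε. The summand 1 keeps A
  -- positive when C = 0.
  set A := C * (2 + T + 2 * ∫ t in 0..T, M t) + 1 with hA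
  have hA0 : 0 < A := by positivity
  set η := ε / A with hηd
  have hη : 0 < η := by positivity
  obtain ⟨V', m, δ, hδ, hm0, hm, hmη, hVV', hV'⟩ := hreg η hη
  obtain ⟨δ', hδ', hmesh⟩ := exists_mesh hT hV.integrable hη
  obtain ⟨K, hK⟩ := exists_nat_gt (s / min δ δ')
  have hmin : 0 < min δ δ' := lt_min hδ hδ'
  have hK0 : (0 : ℝ) < K := lt_of_le_of_lt (div_nonneg hs.1 hmin.le) hK
  set κ : ℝ → ℝ := fun t => C * (2 * m t + η + 2 * η * M t) + r t with hκ
  have hκi : IntervalIntegrable κ volume 0 T :=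
    ((((hm.const_mul _).add intervalIntegrable_const).add
      (hV.integrable.const_mul _)).const_mul _).add hr
  have hκ0 : ∀ t, 0 ≤ κ t := by
    intro t
    have := hm0 t; have := hV.nonneg t; have := hr0 t
    positivity
  -- For s = 0 the step length would be zero, and `dual_step` needs a < b.
  rcases hs.1.eq_or_lt with h0 | hspos
  · subst h0
    refine ⟨f, id, hf, by simpa using hfG, rfl, ?_⟩
    simp; positivity
  set Δ := s / K with hΔ
  have hΔ0 : 0 < Δ := by positivity
  have hΔm : Δ ≤ min δ δ' := by
    rw [hΔ, div_le_iff₀ hK0]; rw [div_lt_iff₀ hmin] at hK; linarith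
  have hKΔ : K * Δ = s := by rw [hΔ]; field_simp
  -- The induction goes backwards from s; k counts the steps already undone.
  have main : ∀ k : ℕ, k ≤ K → ∃ g φ, IsC1 g ∧
      LipBound (G * Real.exp (∫ t in (s - k * Δ)..s, M t)) g ∧ g = f ∘ φ ∧
      |Λ s f - Λ (s - k * Δ) g| ≤ G * Real.exp (∫ t in (s - k * Δ)..s, M t) *
        ∫ t in (s - k * Δ)..s, κ t := by
    intro k
    induction k with
    | zero => exact fun _ => ⟨f, id, hf, by simpa using hfG, rfl, by simp⟩
    | succ k ih =>
      intro hk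
      obtain ⟨g, φ, hg, hgL, hgφ, hgΛ⟩ := ih (by omega)
      set b := s - k * Δ with hb
      set a := s - (k + 1 : ℕ) * Δ with ha
      have hab : b - a = Δ := by rw [hb, ha]; push_cast; ring
      have hk' : ((k + 1 : ℕ) : ℝ) ≤ K := by exact_mod_cast hk
      have ha0 : 0 ≤ a := by
        have := mul_le_mul_of_nonneg_right hk' hΔ0.le
        rw [ha]; linarith
      have hbs : b ≤ s := by
        have : 0 ≤ (k : ℝ) * Δ := by positivity
        rw [hb]; linarith
      have hbT := hbs.trans hs.2
      obtain ⟨g', φ', hg', hgL', hgφ', hgΛ'⟩ := dual_step hC hV hΛ hr hr0 hη hm0 hm hVV' hV' ha0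
        (by linarith) hbT (hab.le.trans (hΔm.trans (min_le_left _ _)))
        (hmesh a b ha0 (by linarith) hbT (hab.le.trans (hΔm.trans (min_le_right _ _))))
        (by positivity) hg hgL
      have hadd : ∀ F : ℝ → ℝ, IntervalIntegrable F volume 0 T →
          ∫ t in a..s, F t = (∫ t in a..b, F t) + ∫ t in b..s, F t := fun F hF =>
        (intervalIntegral.integral_add_adjacent_intervals
          (intervalIntegrable_sub hF ha0 (by linarith) hbT)
          (intervalIntegrable_sub hF (by linarith) hbs hs.2)).symm
      have hE : Real.exp (∫ t in a..s, M t)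
          = Real.exp (∫ t in b..s, M t) * Real.exp (∫ t in a..b, M t) := by
        rw [hadd M hV.integrable, add_comm, Real.exp_add]
      refine ⟨g', φ ∘ φ', hg', by rw [hE, ← mul_assoc]; exact hgL', by
        rw [hgφ', hgφ, Function.comp_assoc], ?_⟩
      refine (abs_sub_le _ (Λ b g) _).trans ((add_le_add hgΛ hgΛ').trans ?_)
      rw [hadd κ hκi, hE, mul_add, ← mul_assoc, add_comm]
      refine add_le_add le_rfl (mul_le_mul_of_nonneg_right ?_ ?_)
      · have h1 : 1 ≤ Real.exp (∫ t in a..b, M t) := Real.one_le_exp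
          (intervalIntegral.integral_nonneg (by linarith) fun t _ => hV.nonneg t)
        exact le_mul_of_one_le_right (by positivity) h1
      · exact intervalIntegral.integral_nonneg hbs fun t _ => hκ0 t
  obtain ⟨g, φ, hg, hgL, hgφ, hgΛ⟩ := main K le_rfl
  rw [hKΔ, sub_self] at hgL hgΛ
  refine ⟨g, φ, hg, hgL, hgφ, hgΛ.trans (mul_le_mul_of_nonneg_left ?_ (by positivity))⟩
  have hms := intervalIntegrable_sub hm le_rfl hs.1 hs.2
  have hMs := intervalIntegrable_sub hV.integrable le_rfl hs.1 hs.2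
  have hrs := intervalIntegrable_sub hr le_rfl hs.1 hs.2
  have i3 : ∫ t in 0..s, κ t
      = C * (2 * (∫ t in 0..s, m t) + η * s + 2 * η * ∫ t in 0..s, M t)
        + (∫ t in 0..s, r t) := by
    simp only [hκ]
    rw [intervalIntegral.integral_add (((((hms.const_mul _).add intervalIntegrable_const)).add
      (hMs.const_mul _)).const_mul _) hrs, intervalIntegral.integral_const_mul,
      intervalIntegral.integral_add ((hms.const_mul _).add intervalIntegrable_const)
      (hMs.const_mul _), intervalIntegral.integral_add (hms.const_mul _)
      intervalIntegrable_const]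
    simp only [intervalIntegral.integral_const_mul, intervalIntegral.integral_const, smul_eq_mul]
    ring
  have mono : ∀ F : ℝ → ℝ, (∀ t, 0 ≤ F t) → IntervalIntegrable F volume 0 T →
      ∫ t in 0..s, F t ≤ ∫ t in 0..T, F t := fun F hF hFi =>
    intervalIntegral.integral_mono_interval le_rfl hs.1 hs.2 (ae_of_all _ hF) hFi
  have e1 := (mono m hm0 hm).trans hmη
  have e2 := mul_le_mul_of_nonneg_left (mono M hV.nonneg hV.integrable) hη.le
  have e3 := mul_le_mul_of_nonneg_left hs.2 hη.le
  have e4 : 2 * (∫ t in 0..s, m t) + η * s + 2 * η * (∫ t in 0..s, M t)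
      ≤ η * (2 + T + 2 * ∫ t in 0..T, M t) := by linarith
  have e5 := mul_le_mul_of_nonneg_left e4 hC
  have e6 : η * A = ε := by rw [hηd]; field_simp
  have e7 : C * (η * (2 + T + 2 * ∫ t in 0..T, M t)) ≤ ε := by
    rw [← e6, hA]; nlinarith
  rw [i3]
  linarith

/-! ### The weak formulation for a single `x` -/

/-- A du Bois-Reymond argument: the continuous function A₀ + ∫B - A integrates to zero against every
smooth φ with compact support in (0,T). The initial value comes out without an undetermined constant
because the tests need not vanish at 0. -/
theorem eq_add_integral_of_weak_deriv {T : ℝ} (hT : 0 < T) {A B : ℝ → ℝ} {A₀ : ℝ}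
    (hA : ContinuousOn A (Set.Icc 0 T)) (hB : IntervalIntegrable B volume 0 T)
    (h : ∀ θ : ℝ → ℝ, ContDiff ℝ 1 θ → (∃ T' < T, ∀ t, T' ≤ t → θ t = 0) →
      (∫ t in 0..T, (deriv θ t * A t + θ t * B t)) + θ 0 * A₀ = 0) :
    ∀ t ∈ Set.Icc 0 T, A t = A₀ + ∫ s in 0..t, B s := by
  set 𝔅 : ℝ → ℝ := fun t => ∫ s in 0..t, B s with h𝔅
  have h𝔅ac : AbsolutelyContinuousOnInterval 𝔅 0 T :=
    hB.absolutelyContinuousOnInterval_intervalIntegral (by simp [Set.left_mem_uIcc])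
  have h𝔅c : ContinuousOn 𝔅 (Set.Icc 0 T) := by
    simpa [Set.uIcc_of_le hT.le] using h𝔅ac.continuousOn
  set F : ℝ → ℝ := fun t => A₀ + 𝔅 t - A t with hF
  have hFc : ContinuousOn F (Set.Icc 0 T) := (continuousOn_const.add h𝔅c).sub hA
  have hae : ∀ᵐ t, t ∈ Set.Ioo 0 T → F t = 0 := by
    refine isOpen_Ioo.ae_eq_zero_of_integral_contDiff_smul_eq_zero
      ((hFc.mono Set.Ioo_subset_Icc_self).locallyIntegrableOn measurableSet_Ioo) ?_
    intro φ hφ hφc hφs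
    have hφcont : Continuous φ := hφ.continuous
    obtain ⟨T', hT'0, hT'T, hT'⟩ : ∃ T', 0 ≤ T' ∧ T' < T ∧ ∀ t, T' < t → φ t = 0 := by
      rcases (tsupport φ).eq_empty_or_nonempty with he | hne
      · exact ⟨0, le_rfl, hT, fun t _ => image_eq_zero_of_notMem_tsupport (by simp [he])⟩
      · obtain ⟨c, hc, hcm⟩ := IsCompact.exists_isMaxOn hφc hne continuousOn_id
        refine ⟨c, (hφs hc).1.le, (hφs hc).2, fun t ht =>
          image_eq_zero_of_notMem_tsupport fun h' => ?_⟩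
        exact absurd (hcm h') (not_le.2 ht)
    have hφ0 : ∀ t, t ∉ Set.Ioo 0 T → φ t = 0 := fun t ht =>
      image_eq_zero_of_notMem_tsupport fun h' => ht (hφs h')
    -- This antiderivative of -φ vanishes near T, hence is admissible, and has θ(0) = ∫φ, which
    -- brings in A₀.
    set θ : ℝ → ℝ := fun t => ∫ s in t..T, φ s with hθ
    have hθd : ∀ t, HasDerivAt θ (-φ t) t := fun t =>
      intervalIntegral.integral_hasDerivAt_left (hφcont.intervalIntegrable _ _)
        (hφcont.stronglyMeasurableAtFilter _ _) hφcont.continuousAt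
    have hθderiv : deriv θ = fun t => -φ t := funext fun t => (hθd t).deriv
    have hθC : ContDiff ℝ 1 θ := by
      rw [contDiff_one_iff_deriv, hθderiv]
      exact ⟨fun t => (hθd t).differentiableAt, hφcont.neg⟩
    have hθT' : ∀ t, T' ≤ t → θ t = 0 := by
      intro t ht
      refine intervalIntegral.integral_zero_ae (ae_of_all _ fun s hs => hT' s ?_)
      rcases le_total t T with h1 | h1
      · rw [Set.uIoc_of_le h1] at hs; exact ht.trans_lt hs.1
      · rw [Set.uIoc_of_ge h1] at hs; exact hT'T.trans hs.1
    have hw := h θ hθC ⟨T', hT'T, hθT'⟩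
    have hparts := AbsolutelyContinuousOnInterval.integral_mul_deriv_eq_deriv_mul (a := 0) (b := T)
      (ContDiffOn.absolutelyContinuousOnInterval (f := θ) hθC.contDiffOn) h𝔅ac
    rw [hθT' T hT'T.le, hθderiv, show 𝔅 0 = 0 by simp [h𝔅]] at hparts
    have hder : ∫ t in 0..T, θ t * deriv 𝔅 t = ∫ t in 0..T, θ t * B t := by
      refine intervalIntegral.integral_congr_ae ?_
      filter_upwards [hB.ae_hasDerivAt_integral] with t ht hta
      rw [(ht (Set.uIoc_subset_uIcc hta) 0 (by simp [Set.left_mem_uIcc])).deriv]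
    rw [hder] at hparts
    have hAi : IntervalIntegrable A volume 0 T := hA.intervalIntegrable_of_Icc hT.le
    have h𝔅i : IntervalIntegrable 𝔅 volume 0 T := h𝔅c.intervalIntegrable_of_Icc hT.le
    have hφA : IntervalIntegrable (fun t => φ t * A t) volume 0 T :=
      hAi.continuousOn_mul hφcont.continuousOn
    have hφ𝔅 : IntervalIntegrable (fun t => φ t * 𝔅 t) volume 0 T :=
      h𝔅i.continuousOn_mul hφcont.continuousOn
    have hθB : IntervalIntegrable (fun t => θ t * B t) volume 0 T :=
      hB.continuousOn_mul hθC.continuous.continuousOn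
    have hres : ∫ t, φ t • F t = ∫ t in 0..T, φ t * F t := by
      rw [intervalIntegral.integral_of_le hT.le]
      refine (setIntegral_eq_integral_of_forall_compl_eq_zero fun t ht => ?_).symm
      rw [hφ0 t fun h' => ht (Set.Ioo_subset_Ioc_self h'), zero_smul]
    have hsplit : ∫ t in 0..T, φ t * F t
        = (∫ t in 0..T, φ t) * A₀ + (∫ t in 0..T, φ t * 𝔅 t) - ∫ t in 0..T, φ t * A t := by
      rw [← intervalIntegral.integral_mul_const, ← intervalIntegral.integral_add
        ((hφcont.intervalIntegrable _ _).mul_const _) hφ𝔅,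
        ← intervalIntegral.integral_sub (((hφcont.intervalIntegrable _ _).mul_const _).add hφ𝔅) hφA]
      refine intervalIntegral.integral_congr fun t _ => ?_
      simp only [hF]
      ring
    rw [hres, hsplit]
    simp only [hθderiv] at hw
    rw [intervalIntegral.integral_add (by simp only [neg_mul]; exact hφA.neg) hθB] at hw
    simp only [neg_mul, intervalIntegral.integral_neg] at hw hparts
    simp only [hθ] at hw hparts
    linarith
  have heq : Set.EqOn F (fun _ => 0) (Set.Icc 0 T) := by
    refine Measure.eqOn_Icc_of_ae_eq volume hT.ne ?_ hFc continuousOn_const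
    rw [← Measure.restrict_congr_set (Ioo_ae_eq_Icc (μ := volume))]
    exact (ae_restrict_iff' measurableSet_Ioo).2 hae
  intro t ht
  have := heq ht
  simp only [hF] at this
  linarith

/-- A weakly continuous solution with integrable densities of the continuity equation on the
circle, with velocity field `V` and initial density `γ₀`. -/
structure IsLinearSolution (T : ℝ) (V : ℝ → Phase → ℝ) (M : ℝ → ℝ) (γ₀ : Phase → ℝ)
    (γ : ℝ → Phase → ℝ) : Prop where
  velocity : VelocityBound T V M
  velocity_measurable : Measurable (Function.uncurry V)
  measurable : Measurable (Function.uncurry γ)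
  integrable : ∀ t ∈ Set.Icc 0 T, Integrable (γ t)
  weaklyContinuous : ∀ f : C(Phase, ℝ),
    ContinuousOn (fun t => ∫ u : Phase, γ t u * f u) (Set.Icc 0 T)
  weak_eq : ∀ w : ℝ → Phase → ℝ, IsTestFunction T w →
    (∫ t in Set.Icc 0 T, ∫ u : Phase, γ t u * (timeDeriv w t u + V t u * phaseDeriv w t u))
      + ∫ u : Phase, w 0 u * γ₀ u = 0

theorem integrable_mul_continuous {f g : Phase → ℝ} (hf : Integrable f) (hg : Continuous g) :
    Integrable (fun u => f u * g u) := by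
  obtain ⟨K, hK⟩ := isCompact_univ.exists_bound_of_continuousOn hg.continuousOn
  exact hf.mul_bdd (c := K) hg.aestronglyMeasurable (ae_of_all _ fun u => hK u (Set.mem_univ u))

/-- Weak continuity bounds each pairing on the compact time interval, and Banach–Steinhaus makes the
bound uniform over test functions. Positivity is not yet known, so total mass cannot serve for this
purpose. -/
theorem IsLinearSolution.exists_uniform_bound {T : ℝ} {V : ℝ → Phase → ℝ} {M : ℝ → ℝ}
    {γ₀ : Phase → ℝ} {γ : ℝ → Phase → ℝ} (h : IsLinearSolution T V M γ₀ γ) :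
    ∃ C, 0 ≤ C ∧ ∀ t ∈ Set.Icc 0 T, ∀ (f : Phase → ℝ) (K : ℝ), Continuous f → (∀ u, |f u| ≤ K) →
      |∫ u, γ t u * f u| ≤ C * K := by
  let Φ : Set.Icc 0 T → C(Phase, ℝ) →L[ℝ] ℝ := fun t =>
    LinearMap.mkContinuous
      { toFun := fun f => ∫ u, γ t u * f u
        map_add' := fun f g => by
          rw [← integral_add (integrable_mul_continuous (h.integrable t t.2) f.continuous)
            (integrable_mul_continuous (h.integrable t t.2) g.continuous)]
          simp [mul_add]
        map_smul' := fun c f => by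
          simp only [ContinuousMap.coe_smul, Pi.smul_apply, smul_eq_mul, RingHom.id_apply]
          rw [← integral_const_mul]
          congr 1; ext u; ring } (∫ u, |γ t u|) (fun f => by
          simp only [LinearMap.coe_mk, AddHom.coe_mk]
          rw [← integral_mul_const]
          refine norm_integral_le_of_norm_le ((h.integrable t t.2).abs.mul_const _)
            (ae_of_all _ fun u => ?_)
          rw [norm_mul, Real.norm_eq_abs]
          exact mul_le_mul_of_nonneg_left (f.norm_coe_le_norm u) (abs_nonneg _))
  obtain ⟨C, hC⟩ := banach_steinhaus (g := Φ) (fun f => by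
    obtain ⟨K, hK⟩ := isCompact_Icc.exists_bound_of_continuousOn (h.weaklyContinuous f)
    exact ⟨K, fun t => hK t t.2⟩)
  refine ⟨max C 0, le_max_right _ _, fun t ht f K hf hK => ?_⟩
  have h1 := (Φ ⟨t, ht⟩).le_of_opNorm_le (hC ⟨t, ht⟩) ⟨f, hf⟩
  have hK0 : 0 ≤ K := (abs_nonneg _).trans (hK 0)
  have h2 : ‖(⟨f, hf⟩ : C(Phase, ℝ))‖ ≤ K := (ContinuousMap.norm_le _ hK0).2 hK
  refine (show |∫ u, γ t u * f u| ≤ _ from h1).trans ?_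
  exact mul_le_mul (le_max_left _ _) h2 (norm_nonneg _) (le_max_right _ _)

theorem IsC1.comp {E : Type*} [NormedAddCommGroup E] [NormedSpace ℝ E] {g : Phase → ℝ}
    (hg : IsC1 g) {φ : E → ℝ} (hφ : ContDiff ℝ 1 φ) : ContDiff ℝ 1 (fun x => g (φ x : Phase)) :=
  ContDiff.comp (g := fun s : ℝ => g (s : Phase)) hg hφ

/-- The projection onto the circle is open, so its product with the identity is again a quotient
map. -/
theorem continuous_of_lift {w : ℝ → Phase → ℝ}
    (hw : Continuous (fun p : ℝ × ℝ => w p.1 (p.2 : Phase))) : Continuous (Function.uncurry w) := by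
  refine (IsOpenQuotientMap.id.prodMap (X := ℝ) (QuotientAddGroup.isOpenQuotientMap_mk
    (N := AddSubgroup.zmultiples (2 * Real.pi)))).isQuotientMap.continuous_iff.2 ?_
  exact hw

/-! ### Partial derivatives of space-time test functions -/

section SpaceTime

variable {w : ℝ → Phase → ℝ} (hw : ContDiff ℝ 1 (fun p : ℝ × ℝ => w p.1 (p.2 : Phase)))
include hw

theorem hasDerivAt_time (t s : ℝ) : HasDerivAt (fun τ => w τ (s : Phase))
    (fderiv ℝ (fun p : ℝ × ℝ => w p.1 (p.2 : Phase)) (t, s) (1, 0)) t := by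
  have h1 := ((hw.differentiable one_ne_zero) (t, s)).hasFDerivAt
  have h2 : HasDerivAt (fun τ : ℝ => (τ, s)) (1, 0) t :=
    (hasDerivAt_id t).prodMk (hasDerivAt_const t s)
  exact h1.comp_hasDerivAt t h2

theorem hasDerivAt_phase (t s : ℝ) : HasDerivAt (fun r : ℝ => w t ((s : Phase) + (r : Phase)))
    (fderiv ℝ (fun p : ℝ × ℝ => w p.1 (p.2 : Phase)) (t, s) (0, 1)) 0 := by
  have h1 := ((hw.differentiable one_ne_zero) (t, s + 0)).hasFDerivAt
  have h2 : HasDerivAt (fun r : ℝ => (t, s + r)) (0, 1) 0 :=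
    (hasDerivAt_const 0 t).prodMk ((hasDerivAt_id (0 : ℝ)).const_add s)
  have h3 := h1.comp_hasDerivAt (0 : ℝ) h2
  rw [add_zero] at h3
  exact h3

theorem continuous_timeDeriv : Continuous (Function.uncurry (timeDeriv w)) := by
  refine continuous_of_lift ?_
  have : (fun p : ℝ × ℝ => timeDeriv w p.1 (p.2 : Phase)) = fun p =>
      fderiv ℝ (fun p : ℝ × ℝ => w p.1 (p.2 : Phase)) p (1, 0) :=
    funext fun p => (hasDerivAt_time hw p.1 p.2).deriv
  rw [this]
  exact (hw.continuous_fderiv one_ne_zero).clm_apply continuous_const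

theorem continuous_phaseDeriv : Continuous (Function.uncurry (phaseDeriv w)) := by
  refine continuous_of_lift ?_
  have : (fun p : ℝ × ℝ => phaseDeriv w p.1 (p.2 : Phase)) = fun p =>
      fderiv ℝ (fun p : ℝ × ℝ => w p.1 (p.2 : Phase)) p (0, 1) :=
    funext fun p => (hasDerivAt_phase hw p.1 p.2).deriv
  rw [this]
  exact (hw.continuous_fderiv one_ne_zero).clm_apply continuous_const

end SpaceTime

/-- The weak formulation upgraded to an identity at every time, for C¹ functions w that need not
vanish near T. -/
theorem IsLinearSolution.pairing_eq {T : ℝ} (hT : 0 < T) {V : ℝ → Phase → ℝ} {M : ℝ → ℝ}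
    {γ₀ : Phase → ℝ} {γ : ℝ → Phase → ℝ} (h : IsLinearSolution T V M γ₀ γ) {w : ℝ → Phase → ℝ}
    (hw : ContDiff ℝ 1 (fun p : ℝ × ℝ => w p.1 (p.2 : Phase))) :
    IntervalIntegrable (fun t => ∫ u, γ t u * (timeDeriv w t u + V t u * phaseDeriv w t u))
      volume 0 T ∧
    ∀ t ∈ Set.Icc 0 T, ∫ u, γ t u * w t u = (∫ u, w 0 u * γ₀ u) +
      ∫ s in 0..t, ∫ u, γ s u * (timeDeriv w s u + V s u * phaseDeriv w s u) := by
  obtain ⟨C, hC0, hC⟩ := h.exists_uniform_bound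
  have hwc : Continuous (Function.uncurry w) := continuous_of_lift hw.continuous
  have hwt := continuous_timeDeriv hw
  have hwp := continuous_phaseDeriv hw
  have hsl : ∀ {f : ℝ → Phase → ℝ}, Continuous (Function.uncurry f) → ∀ t, Continuous (f t) :=
    fun hf t => hf.comp (continuous_const.prodMk continuous_id)
  have hbd : ∀ {f : ℝ → Phase → ℝ}, Continuous (Function.uncurry f) →
      ∃ K, 0 ≤ K ∧ ∀ t ∈ Set.Icc 0 T, ∀ u, |f t u| ≤ K := by
    intro f hf
    obtain ⟨K, hK⟩ := (isCompact_Icc.prod isCompact_univ).exists_bound_of_continuousOn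
      (s := Set.Icc 0 T ×ˢ (Set.univ : Set Phase)) hf.continuousOn
    exact ⟨K, (norm_nonneg _).trans (hK (0, 0) ⟨⟨le_rfl, hT.le⟩, Set.mem_univ _⟩),
      fun t ht u => hK (t, u) ⟨ht, Set.mem_univ _⟩⟩
  obtain ⟨K₁, hK₁0, hK₁⟩ := hbd hwt
  obtain ⟨K₂, hK₂0, hK₂⟩ := hbd hwp
  have hVc : ∀ᵐ t, t ∈ Set.Ioc 0 T → Continuous (V t) := by
    filter_upwards [h.velocity.lip] with t ht hta using (ht hta).continuous
  set B : ℝ → ℝ := fun t => ∫ u, γ t u * (timeDeriv w t u + V t u * phaseDeriv w t u) with hBd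
  have hBm : StronglyMeasurable B := by
    refine StronglyMeasurable.integral_prod_right' (f := fun p : ℝ × Phase =>
      γ p.1 p.2 * (timeDeriv w p.1 p.2 + V p.1 p.2 * phaseDeriv w p.1 p.2)) ?_
    exact (h.measurable.mul (hwt.measurable.add
      (h.velocity_measurable.mul hwp.measurable))).stronglyMeasurable
  have hB : IntervalIntegrable B volume 0 T := by
    refine IntervalIntegrable.mono_fun (f := fun t => C * (K₁ + M t * K₂))
      ((intervalIntegrable_const.add (h.velocity.integrable.mul_const _)).const_mul _)
      hBm.aestronglyMeasurable ?_
    rw [Set.uIoc_of_le hT.le]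
    refine (ae_restrict_iff' measurableSet_Ioc).2 ?_
    filter_upwards [h.velocity.bound, hVc] with t ht htc hta
    have hta' := Set.Ioc_subset_Icc_self hta
    rw [Real.norm_eq_abs]
    refine (hC t hta' _ (K₁ + M t * K₂) ((hsl hwt t).add ((htc hta).mul (hsl hwp t)))
      fun u => ?_).trans (le_abs_self _)
    refine (abs_add_le _ _).trans (add_le_add (hK₁ t hta' u) ?_)
    rw [Pi.mul_apply, abs_mul]
    exact mul_le_mul (ht hta u) (hK₂ t hta' u) (abs_nonneg _) (h.velocity.nonneg t)
  refine ⟨hB, ?_⟩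
  -- The map t ↦ w t is continuous into C(𝕊), so the uniform bound allows w to be frozen at time t,
  -- and weak continuity does the rest.
  have hA : ContinuousOn (fun t => ∫ u, γ t u * w t u) (Set.Icc 0 T) := by
    intro t ht
    have hcur : Continuous (fun s => (⟨w s, hsl hwc s⟩ : C(Phase, ℝ))) :=
      (ContinuousMap.curry ⟨Function.uncurry w, hwc⟩).continuous
    rw [Metric.continuousWithinAt_iff]
    intro ε hε
    have hC1 : 0 < 2 * (C + 1) := by positivity
    obtain ⟨δ₁, hδ₁, h₁⟩ := Metric.continuous_iff.1 hcur t (ε / (2 * (C + 1))) (by positivity)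
    obtain ⟨δ₂, hδ₂, h₂⟩ := Metric.continuousWithinAt_iff.1
      (h.weaklyContinuous ⟨w t, hsl hwc t⟩ t ht) (ε / 2) (by positivity)
    refine ⟨min δ₁ δ₂, lt_min hδ₁ hδ₂, fun {s} hs hd => ?_⟩
    have e1 := h₁ s (hd.trans_le (min_le_left _ _))
    have e2 := h₂ hs (hd.trans_le (min_le_right _ _))
    rw [Real.dist_eq] at e2 ⊢
    have e3 : ∀ u, |w s u - w t u| ≤ ε / (2 * (C + 1)) := fun u =>
      ((ContinuousMap.dist_apply_le_dist (f := ⟨w s, hsl hwc s⟩) (g := ⟨w t, hsl hwc t⟩) u)).trans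
        e1.le
    have e4 := hC s hs (fun u => w s u - w t u) _ ((hsl hwc s).sub (hsl hwc t)) e3
    have e5 : ∫ u, γ s u * (w s u - w t u) = (∫ u, γ s u * w s u) - ∫ u, γ s u * w t u := by
      rw [← integral_sub (integrable_mul_continuous (h.integrable s hs) (hsl hwc s))
        (integrable_mul_continuous (h.integrable s hs) (hsl hwc t))]
      simp only [mul_sub]
    rw [e5] at e4
    have e6 : C * (ε / (2 * (C + 1))) ≤ ε / 2 := by
      rw [← mul_div_assoc, div_le_div_iff₀ (by positivity) (by positivity)]
      nlinarith
    have e7 := abs_sub_le (∫ u, γ s u * w s u) (∫ u, γ s u * w t u) (∫ u, γ t u * w t u)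
    have e8 : |(∫ u, γ s u * w t u) - ∫ u, γ t u * w t u| < ε / 2 := e2
    linarith
  -- The products θ(t)w(t,u) are admissible tests, and they express the weak equation as a weak time
  -- derivative of the pairing.
  refine eq_add_integral_of_weak_deriv hT hA hB fun θ hθ hθs => ?_
  obtain ⟨T', hT', hθT'⟩ := hθs
  have htest : IsTestFunction T (fun t u => θ t * w t u) :=
    ⟨(hθ.comp contDiff_fst).mul hw, T', hT', fun t ht u => by rw [hθT' t ht, zero_mul]⟩
  have hweak := h.weak_eq _ htest
  have htd : ∀ t u, timeDeriv (fun t u => θ t * w t u) t u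
      = deriv θ t * w t u + θ t * timeDeriv w t u := by
    intro t u
    induction u using QuotientAddGroup.induction_on with
    | H s =>
      exact ((hθ.differentiable one_ne_zero t).hasDerivAt.mul
        (hasDerivAt_time hw t s).differentiableAt.hasDerivAt).deriv
  have hpd : ∀ t u, phaseDeriv (fun t u => θ t * w t u) t u = θ t * phaseDeriv w t u := by
    intro t u
    induction u using QuotientAddGroup.induction_on with
    | H s =>
      exact ((hasDerivAt_phase hw t s).differentiableAt.hasDerivAt.const_mul (θ t)).deriv
  rw [integral_Icc_eq_integral_Ioc, ← intervalIntegral.integral_of_le hT.le] at hweak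
  have e0 : ∫ u, θ 0 * w 0 u * γ₀ u = θ 0 * ∫ u, w 0 u * γ₀ u := by
    rw [← integral_const_mul]; simp only [mul_assoc]
  rw [e0] at hweak
  refine Eq.trans ?_ hweak
  congr 1
  refine intervalIntegral.integral_congr_ae ?_
  filter_upwards [hVc] with t htc hta
  rw [Set.uIoc_of_le hT.le] at hta
  have hint := h.integrable t (Set.Ioc_subset_Icc_self hta)
  have hcont : Continuous (fun u => timeDeriv w t u + V t u * phaseDeriv w t u) :=
    (hsl hwt t).add ((htc hta).mul (hsl hwp t))
  change deriv θ t * (∫ u, γ t u * w t u) + θ t * (∫ u, _) = _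
  rw [← integral_const_mul, ← integral_const_mul, ← integral_add
    ((integrable_mul_continuous hint (hsl hwc t)).const_mul _)
    ((integrable_mul_continuous hint hcont).const_mul _)]
  refine integral_congr_ae (ae_of_all _ fun u => ?_)
  simp only [htd, hpd]
  ring

theorem IsLinearSolution.initial {T : ℝ} (hT : 0 < T) {V : ℝ → Phase → ℝ} {M : ℝ → ℝ}
    {γ₀ : Phase → ℝ} {γ : ℝ → Phase → ℝ} (h : IsLinearSolution T V M γ₀ γ) {g : Phase → ℝ}
    (hg : IsC1 g) : ∫ u, γ 0 u * g u = ∫ u, g u * γ₀ u := by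
  have := (h.pairing_eq hT (w := fun _ u => g u) (hg.comp contDiff_snd)).2 0
    ⟨le_rfl, hT.le⟩
  simpa using this

theorem IsC1.hasDerivAt {g : Phase → ℝ} (hg : IsC1 g) (s : ℝ) :
    HasDerivAt (fun s : ℝ => g (s : Phase)) (deriv (fun s : ℝ => g (s : Phase)) s) s :=
  (ContDiff.differentiable hg one_ne_zero s).hasDerivAt

theorem LipBound.abs_deriv_le {G : ℝ} {g : Phase → ℝ} (hG : 0 ≤ G) (hg : LipBound G g) (s : ℝ) :
    |deriv (fun s : ℝ => g (s : Phase)) s| ≤ G := by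
  have hL : LipschitzWith (Real.toNNReal G) (fun s : ℝ => g (s : Phase)) :=
    LipschitzWith.of_dist_le' (K := G) fun x y => by
      rw [Real.dist_eq]
      exact (hg _ _).trans (mul_le_mul_of_nonneg_left (Phase.dist_coe_le x y) hG)
  simpa [hG] using norm_deriv_le_of_lipschitz (x₀ := s) hL

/-- The function w(t,u) = g(u+(b-t)β(u)) joins the displaced g at time a to g at time b, and nearly
solves the dual equation when β is close to V. -/
theorem IsLinearSolution.exists_stepBound {T : ℝ} (hT : 0 < T) {V : ℝ → Phase → ℝ} {M : ℝ → ℝ}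
    {γ₀ : Phase → ℝ} {γ : ℝ → Phase → ℝ} (h : IsLinearSolution T V M γ₀ γ) {C : ℝ}
    (hC : ∀ t ∈ Set.Icc 0 T, ∀ (f : Phase → ℝ) (K : ℝ), Continuous f → (∀ u, |f u| ≤ K) →
      |∫ u, γ t u * f u| ≤ C * K) :
    StepBound T C V M (fun _ => 0) (fun t g => ∫ u, γ t u * g u) := by
  intro a b ha hab hb g β G B q hG hB hg hgG hβ hβB hq hVq
  set w : ℝ → Phase → ℝ := fun t => KuramotoGraphon.displace g β (b - t) with hwdef
  have hw : ContDiff ℝ 1 (fun p : ℝ × ℝ => w p.1 (p.2 : Phase)) := by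
    have : ContDiff ℝ 1 (fun p : ℝ × ℝ => p.2 + (b - p.1) * β (p.2 : Phase)) :=
      contDiff_snd.add ((contDiff_const.sub contDiff_fst).mul (hβ.comp contDiff_snd))
    simpa [hwdef, KuramotoGraphon.displace] using hg.comp this
  obtain ⟨hBi, hpair⟩ := h.pairing_eq hT hw
  have hbmem : b ∈ Set.Icc 0 T := ⟨ha.trans hab, hb⟩
  have hamem : a ∈ Set.Icc 0 T := ⟨ha, hab.trans hb⟩
  have hwb : w b = g := by funext u; simp [hwdef, KuramotoGraphon.displace]
  have e1 := hpair b hbmem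
  have e2 := hpair a hamem
  rw [hwb] at e1
  have e3 : (∫ u, γ b u * g u) - ∫ u, γ a u * w a u
      = ∫ s in a..b, ∫ u, γ s u * (timeDeriv w s u + V s u * phaseDeriv w s u) := by
    rw [e1, e2, ← intervalIntegral.integral_interval_sub_left
      (intervalIntegrable_sub hBi le_rfl hbmem.1 hb)
      (intervalIntegrable_sub hBi le_rfl ha hamem.2)]
    ring
  change |(∫ u, γ b u * g u) - ∫ u, γ a u * w a u| ≤ _
  rw [e3, ← Real.norm_eq_abs, ← intervalIntegral.integral_const_mul]
  have hMi := intervalIntegrable_sub h.velocity.integrable ha hab hb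
  refine intervalIntegral.norm_integral_le_of_norm_le hab ?_
    ((((hq.add (hMi.mul_const _)).const_mul _).add (by simp)).const_mul _)
  filter_upwards [hVq, h.velocity.bound, h.velocity.lip] with t ht1 ht2 ht3 hta
  have htT : t ∈ Set.Ioc 0 T := ⟨ha.trans_lt hta.1, hta.2.trans hb⟩
  have hwt : Continuous (timeDeriv w t) :=
    (continuous_timeDeriv hw).comp (continuous_const.prodMk continuous_id)
  have hwp : Continuous (phaseDeriv w t) :=
    (continuous_phaseDeriv hw).comp (continuous_const.prodMk continuous_id)
  have hK : ∀ u, |timeDeriv w t u + V t u * phaseDeriv w t u|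
      ≤ G * (q t + M t * ((b - a) * B)) := by
    intro u
    induction u using QuotientAddGroup.induction_on with
    | H s =>
      set D := deriv (fun s : ℝ => g (s : Phase)) (s + (b - t) * β (s : Phase)) with hD
      set β' := deriv (fun s : ℝ => β (s : Phase)) s with hβ'
      have hDG : |D| ≤ G := hgG.abs_deriv_le hG _
      have hβ'B : |β'| ≤ B := hβB.abs_deriv_le hB _
      have htd : timeDeriv w t (s : Phase) = D * (-(β (s : Phase))) := by
        have h1 : HasDerivAt (fun τ : ℝ => s + (b - τ) * β (s : Phase)) (-(β (s : Phase))) t := by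
          simpa using (((hasDerivAt_id t).const_sub b).mul_const (β (s : Phase))).const_add s
        have h2 := HasDerivAt.comp t (hg.hasDerivAt _) h1
        simpa [Function.comp_def, timeDeriv, hwdef, KuramotoGraphon.displace] using h2.deriv
      have hpd : phaseDeriv w t (s : Phase) = D * (1 + (b - t) * β') := by
        have h0 : HasDerivAt (fun r : ℝ => s + r) 1 0 := by
          simpa using (hasDerivAt_id (0 : ℝ)).const_add s
        have h1 : HasDerivAt (fun r : ℝ => (s + r) + (b - t) * β ((s + r : ℝ) : Phase))
            (1 + (b - t) * β') 0 := by
          have h3 : HasDerivAt (fun s : ℝ => β (s : Phase)) β' (s + 0) := by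
            rw [add_zero]; exact hβ.hasDerivAt s
          have h4 : HasDerivAt (fun r : ℝ => β ((s + r : ℝ) : Phase)) β' 0 := by
            simpa [Function.comp_def] using HasDerivAt.comp (0 : ℝ) h3 h0
          exact h0.add (h4.const_mul (b - t))
        have h5 : HasDerivAt (fun s : ℝ => g (s : Phase)) D
            ((s + 0) + (b - t) * β ((s + 0 : ℝ) : Phase)) := by
          rw [add_zero]; exact hg.hasDerivAt _
        have h2 := HasDerivAt.comp (0 : ℝ) h5 h1
        simpa [Function.comp_def, phaseDeriv, hwdef, KuramotoGraphon.displace] using h2.deriv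
      -- The time derivative contributes -g'β, which cancels the main part of Vg'. What remains is
      -- V-β and a term of the order of the step length.
      have e : timeDeriv w t (s : Phase) + V t (s : Phase) * phaseDeriv w t (s : Phase)
          = D * ((V t (s : Phase) - β (s : Phase)) + V t (s : Phase) * ((b - t) * β')) := by
        rw [htd, hpd]; ring
      change |timeDeriv w t (s : Phase) + V t (s : Phase) * phaseDeriv w t (s : Phase)| ≤ _
      rw [e, abs_mul]
      refine mul_le_mul hDG ((abs_add_le _ _).trans (add_le_add (ht1 hta _) ?_))
        (abs_nonneg _) hG
      rw [abs_mul, abs_mul, abs_of_nonneg (sub_nonneg.2 hta.2)]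
      refine mul_le_mul (ht2 htT _) (mul_le_mul (by linarith [hta.1]) hβ'B (abs_nonneg _)
        (by linarith)) (mul_nonneg (sub_nonneg.2 hta.2) (abs_nonneg _)) (h.velocity.nonneg t)
  have hfin := hC t (Set.Ioc_subset_Icc_self htT) _ _ (hwt.add ((ht3 htT).continuous.mul hwp)) hK
  rw [Real.norm_eq_abs]
  refine hfin.trans (le_of_eq ?_)
  ring

theorem abs_integral_le_of_abs_le {α : Type*} [MeasurableSpace α] {μ : Measure α} {f g : α → ℝ}
    (hg : Integrable g μ) (h : ∀ᵐ a ∂μ, |f a| ≤ g a) : |∫ a, f a ∂μ| ≤ ∫ a, g a ∂μ :=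
  norm_integral_le_of_norm_le (f := f) hg h

/-! ### Positivity -/

/-- Running averages keep nonnegativity and converge uniformly, so C¹ test functions suffice. -/
theorem integral_mul_nonneg_of_lipBound {f : Phase → ℝ} (hf : Integrable f)
    (h : ∀ (g : Phase → ℝ) (G : ℝ), 0 ≤ G → IsC1 g → LipBound G g → (∀ u, 0 ≤ g u) →
      0 ≤ ∫ u, f u * g u)
    {g : Phase → ℝ} {G : ℝ} (hG : 0 ≤ G) (hg : LipBound G g) (hg0 : ∀ u, 0 ≤ g u) :
    0 ≤ ∫ u, f u * g u := by
  refine le_of_forall_pos_le_add fun ε hε => ?_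
  set N := ∫ u, |f u| with hN
  have hN0 : 0 ≤ N := integral_nonneg fun u => abs_nonneg _
  set η := ε / (G * N + 1) with hη
  have hη0 : 0 < η := by positivity
  have h1 := h (steklov η g) G hG (isC1_steklov η hg.continuous) (hg.steklov hη0) (fun u =>
    mul_nonneg (inv_pos.2 hη0).le (intervalIntegral.integral_nonneg hη0.le fun s _ => hg0 _))
  have h2 : (∫ u, f u * steklov η g u) - ∫ u, f u * g u ≤ N * (G * η) := by
    rw [← integral_sub (integrable_mul_continuous hf (isC1_steklov η hg.continuous).continuous)
      (integrable_mul_continuous hf hg.continuous), hN, ← integral_mul_const]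
    refine (le_abs_self _).trans (abs_integral_le_of_abs_le (hf.abs.mul_const _)
      (ae_of_all _ fun u => ?_))
    rw [← mul_sub, abs_mul]
    exact mul_le_mul_of_nonneg_left (abs_steklov_sub_le hη0 hG hg u) (abs_nonneg _)
  have h3 : N * (G * η) ≤ ε := by
    rw [hη, ← mul_assoc, ← mul_div_assoc, div_le_iff₀ (by positivity)]
    nlinarith [mul_nonneg hG hN0]
  linarith

/-- By inner regularity it is enough that closed subsets F of {f < 0} are null. The indicator of F
is a limit of Lipschitz thickened indicators, so ∫_F f ≥ 0. -/
theorem ae_nonneg_of_integral_mul_nonneg {f : Phase → ℝ} (hfm : Measurable f) (hf : Integrable f)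
    (h : ∀ (g : Phase → ℝ) (G : ℝ), 0 ≤ G → IsC1 g → LipBound G g → (∀ u, 0 ≤ g u) →
      0 ≤ ∫ u, f u * g u) : ∀ᵐ u, 0 ≤ f u := by
  have hs : MeasurableSet {u | f u < 0} := measurableSet_lt hfm measurable_const
  have hclosed : ∀ F : Set Phase, IsClosed F → F ⊆ {u | f u < 0} → volume F = 0 := by
    intro F hF hFs
    let d : ℕ → ℝ := fun n => 1 / ((n : ℝ) + 1)
    have hd : ∀ n, 0 < d n := fun n => Nat.one_div_pos_of_nat
    let g : ℕ → Phase → ℝ := fun n u => (thickenedIndicator (hd n) F u : ℝ)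
    have hgL : ∀ n, LipBound ((d n).toNNReal⁻¹ : NNReal) (g n) := fun n u v => by
      have := (lipschitzWith_thickenedIndicator (hd n) F).dist_le_mul u v
      rwa [NNReal.dist_eq] at this
    have hnn : ∀ n, 0 ≤ ∫ u, f u * g n u := fun n =>
      integral_mul_nonneg_of_lipBound hf h (NNReal.coe_nonneg _) (hgL n) fun u => NNReal.coe_nonneg _
    have hlim : Tendsto (fun n => ∫ u, f u * g n u) atTop
        (𝓝 (∫ u, f u * F.indicator (fun _ => 1) u)) := by
      refine tendsto_integral_of_dominated_convergence (fun u => |f u|)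
        (fun n => (integrable_mul_continuous hf (hgL n).continuous).aestronglyMeasurable) hf.abs
        (fun n => ae_of_all _ fun u => ?_) (ae_of_all _ fun u => ?_)
      · rw [norm_mul, Real.norm_eq_abs]
        refine mul_le_of_le_one_right (abs_nonneg _) ?_
        rw [Real.norm_eq_abs, abs_of_nonneg (NNReal.coe_nonneg _)]
        exact_mod_cast thickenedIndicator_le_one (hd n) F u
      · have := tendsto_pi_nhds.1 (thickenedIndicator_tendsto_indicator_closure hd
          tendsto_one_div_add_atTop_nhds_zero_nat F) u
        rw [hF.closure_eq] at this
        have h2 := (NNReal.tendsto_coe.2 this).const_mul (f u)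
        convert h2 using 2
        by_cases hu : u ∈ F <;> simp [hu]
    have h0 := ge_of_tendsto' hlim hnn
    have h1 : ∫ u, f u * F.indicator (fun _ => 1) u = ∫ u in F, f u := by
      rw [← integral_indicator hF.measurableSet]
      congr 1; ext u
      by_cases hu : u ∈ F <;> simp [hu]
    rw [h1] at h0
    by_contra hne
    have hpos : 0 < ∫ u in F, -f u := by
      rw [setIntegral_pos_iff_support_of_nonneg_ae]
      · have : Function.support (fun u => -f u) ∩ F = F := by
          refine Set.inter_eq_right.2 fun u hu => ?_
          have : f u < 0 := hFs hu
          simp [this.ne]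
        rw [this]; exact pos_iff_ne_zero.2 hne
      · refine (ae_restrict_iff' hF.measurableSet).2 (ae_of_all _ fun u hu => ?_)
        have : f u < 0 := hFs hu
        simpa using this.le
      · exact hf.neg.integrableOn
    rw [integral_neg] at hpos
    linarith
  have h0 : volume {u | f u < 0} = 0 := by
    rw [hs.measure_eq_iSup_isClosed_of_ne_top (measure_ne_top _ _)]
    simp only [ENNReal.iSup_eq_zero]
    exact fun F hFs hF => hclosed F hF hFs
  rw [ae_iff]
  simpa using h0

/-- The scheme with r = 0 approximates ∫ f γ(t) by ∫ (f∘φ) γ₀, which is nonnegative for f ≥ 0. -/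
theorem IsLinearSolution.isProbabilityDensity {T : ℝ} (hT : 0 < T) {V : ℝ → Phase → ℝ}
    {M : ℝ → ℝ} {γ₀ : Phase → ℝ} {γ : ℝ → Phase → ℝ} (h : IsLinearSolution T V M γ₀ γ)
    (hreg : TimeRegular T V) (hγ0 : ∀ u, 0 ≤ γ₀ u) (hγ1 : ∫ u, γ₀ u = 1) {t : ℝ}
    (ht : t ∈ Set.Icc 0 T) : (∀ᵐ u, 0 ≤ γ t u) ∧ ∫ u, γ t u = 1 := by
  obtain ⟨C, hC0, hC⟩ := h.exists_uniform_bound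
  have hstep := h.exists_stepBound hT hC
  have happ : ∀ (f : Phase → ℝ) (G : ℝ), 0 ≤ G → IsC1 f → LipBound G f → ∀ ε > 0,
      ∃ φ : Phase → Phase, |(∫ u, γ t u * f u) - ∫ u, f (φ u) * γ₀ u| ≤ G * ε := by
    intro f G hG hf hfG ε hε
    have hL : 0 < Real.exp (∫ s in 0..t, M s) := Real.exp_pos _
    obtain ⟨g, φ, hg, -, hgφ, hgΛ⟩ := dual_scheme hC0 h.velocity hreg hstep (by simp)
      (fun _ => le_rfl) ht hG hf hfG (ε := ε / Real.exp (∫ s in 0..t, M s)) (by positivity)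
    refine ⟨φ, ?_⟩
    rw [h.initial hT hg, hgφ] at hgΛ
    refine hgΛ.trans (le_of_eq ?_)
    simp only [intervalIntegral.integral_zero, zero_add]
    field_simp
  constructor
  · refine ae_nonneg_of_integral_mul_nonneg (h.measurable.comp measurable_prodMk_left)
      (h.integrable t ht) fun g G hG hg hgG hg0 => ?_
    refine le_of_forall_pos_le_add fun ε hε => ?_
    obtain ⟨φ, hφ⟩ := happ g G hG hg hgG (ε / (G + 1)) (by positivity)
    have h0 : 0 ≤ ∫ u, g (φ u) * γ₀ u := integral_nonneg fun u => mul_nonneg (hg0 _) (hγ0 u)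
    have h1 : G * (ε / (G + 1)) ≤ ε := by
      rw [← mul_div_assoc, div_le_iff₀ (by positivity)]; nlinarith
    linarith [(abs_le.1 hφ).1]
  -- A constant function has Lipschitz constant 0, so the error bound vanishes and conservation of
  -- mass is exact.
  · obtain ⟨φ, hφ⟩ := happ (fun _ => 1) 0 le_rfl contDiff_const (fun u v => by simp) 1 one_pos
    simp only [mul_one, one_mul, hγ1, abs_nonpos_iff] at hφ
    linarith

/-! ### The velocity field of a density on `𝕊 × I` -/

/-- The velocity at phase `u` and label `x` generated by a density `h` on `𝕊 × I`. -/
def meanField (W : I → I → ℝ) (D : Phase → ℝ) (h : Phase × I → ℝ) (u : Phase) (x : I) : ℝ :=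
  ∫ p : Phase × I, W x p.2 * D (p.1 - u) * h p

section MeanField

variable {W : I → I → ℝ} (hW : IsGraphon W) {D : Phase → ℝ} (hD : IsCoupling D)
include hW hD

theorem measurable_kernel (u : Phase) (x : I) :
    Measurable (fun p : Phase × I => W x p.2 * D (p.1 - u)) :=
  ((hW.measurable.comp measurable_prodMk_left).comp measurable_snd).mul
    (hD.lipschitz.continuous.measurable.comp (measurable_fst.sub_const u))

theorem abs_kernel_le (u : Phase) (x : I) (p : Phase × I) : |W x p.2 * D (p.1 - u)| ≤ 1 := by
  rw [abs_mul]
  exact mul_le_one₀ (hW.abs_le_one _ _) (abs_nonneg _) (hD.abs_le_one _)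

theorem integrable_meanField {h : Phase × I → ℝ} (hh : Integrable h) (u : Phase) (x : I) :
    Integrable (fun p : Phase × I => W x p.2 * D (p.1 - u) * h p) :=
  hh.bdd_mul (c := 1) (measurable_kernel hW hD u x).aestronglyMeasurable
    (ae_of_all _ fun p => abs_kernel_le hW hD u x p)

theorem abs_meanField_sub_le {h k : Phase × I → ℝ} (hh : Integrable h) (hk : Integrable k)
    (u : Phase) (x : I) : |meanField W D h u x - meanField W D k u x| ≤ ∫ p, |h p - k p| := by
  unfold meanField
  rw [← integral_sub (integrable_meanField hW hD hh u x) (integrable_meanField hW hD hk u x)]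
  refine abs_integral_le_of_abs_le (hh.sub hk).abs (ae_of_all _ fun p => ?_)
  rw [← mul_sub, abs_mul]
  exact mul_le_of_le_one_left (abs_nonneg _) (abs_kernel_le hW hD u x p)

theorem abs_meanField_le {h : Phase × I → ℝ} (hh : Integrable h) (u : Phase) (x : I) :
    |meanField W D h u x| ≤ ∫ p, |h p| := by
  have := abs_meanField_sub_le hW hD hh (integrable_zero _ _ _) u x
  simpa [meanField] using this

theorem lipBound_meanField {h : Phase × I → ℝ} (hh : Integrable h) (x : I) :
    LipBound (∫ p, |h p|) (fun u => meanField W D h u x) := by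
  intro u v
  unfold meanField
  rw [← integral_sub (integrable_meanField hW hD hh u x) (integrable_meanField hW hD hh v x),
    ← integral_mul_const]
  refine abs_integral_le_of_abs_le (hh.abs.mul_const _) (ae_of_all _ fun p => ?_)
  rw [← sub_mul, ← mul_sub, abs_mul, abs_mul, mul_comm]
  refine mul_le_mul_of_nonneg_left ?_ (abs_nonneg _)
  refine (mul_le_of_le_one_left (abs_nonneg _) (hW.abs_le_one x p.2)).trans ?_
  have := (LipschitzWith.lipBound hD.lipschitz) (p.1 - u) (p.1 - v)
  rwa [one_mul, dist_sub_left] at this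

theorem velocity_eq_meanField {ρ : ℝ → Phase → I → ℝ} {t : ℝ}
    (ht : Integrable (fun p : Phase × I => ρ t p.1 p.2)) (u : Phase) (x : I) :
    velocity W D ρ t u x = meanField W D (fun p => ρ t p.1 p.2) u x := by
  unfold meanField velocity
  exact (integral_prod_symm _ (integrable_meanField hW hD ht u x)).symm

theorem measurable_velocity {ρ : ℝ → Phase → I → ℝ}
    (hρ : Measurable (fun p : ℝ × Phase × I => ρ p.1 p.2.1 p.2.2)) (x : I) :
    Measurable (fun p : ℝ × Phase => velocity W D ρ p.1 p.2 x) := by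
  unfold velocity
  have h1 : Measurable (fun q : ((ℝ × Phase) × I) × Phase =>
      W x q.1.2 * D (q.2 - q.1.1.2) * ρ q.1.1.1 q.2 q.1.2) := by
    refine Measurable.mul (Measurable.mul ?_ ?_) ?_
    · exact (hW.measurable.comp measurable_prodMk_left).comp (measurable_snd.comp measurable_fst)
    · exact hD.lipschitz.continuous.measurable.comp
        (measurable_snd.sub (measurable_snd.comp (measurable_fst.comp measurable_fst)))
    · exact hρ.comp ((measurable_fst.comp (measurable_fst.comp measurable_fst)).prodMk
        (measurable_snd.prodMk (measurable_snd.comp measurable_fst)))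
  exact (h1.stronglyMeasurable.integral_prod_right'.integral_prod_right').measurable

end MeanField

/-- The total mass of a density on `𝕊 × I` at time `t`. -/
def totalMass (ρ : ℝ → Phase → I → ℝ) (t : ℝ) : ℝ := ∫ p : Phase × I, |ρ t p.1 p.2|

section WeakSolution

variable {T : ℝ} (hT : 0 < T) {W : I → I → ℝ} (hW : IsGraphon W) {D : Phase → ℝ}
  (hD : IsCoupling D) {ρ : ℝ → Phase → I → ℝ}
  (hint : IntegrableOn (fun p : ℝ × Phase × I => ρ p.1 p.2.1 p.2.2) (Set.Icc 0 T ×ˢ Set.univ))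

include hint in
theorem integrable_restrict_prod : Integrable (fun p : ℝ × Phase × I => ρ p.1 p.2.1 p.2.2)
    ((volume.restrict (Set.Icc 0 T)).prod volume) := by
  have := hint
  rwa [IntegrableOn, Measure.volume_eq_prod, ← Measure.prod_restrict, Measure.restrict_univ] at this

include hint in
theorem ae_integrable_section : ∀ᵐ t, t ∈ Set.Ioc 0 T →
    Integrable (fun p : Phase × I => ρ t p.1 p.2) := by
  have := (ae_restrict_iff' measurableSet_Icc).1 (integrable_restrict_prod hint).prod_right_ae
  filter_upwards [this] with t ht hta using ht (Set.Ioc_subset_Icc_self hta)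

include hT hint in
theorem intervalIntegrable_totalMass : IntervalIntegrable (totalMass ρ) volume 0 T := by
  rw [intervalIntegrable_iff_integrableOn_Icc_of_le hT.le]
  exact (integrable_restrict_prod hint).integral_norm_prod_left

include hT hW hD hint in
theorem velocityBound_totalMass (hmeas : Measurable (fun p : ℝ × Phase × I => ρ p.1 p.2.1 p.2.2))
    (x : I) : VelocityBound T (fun t u => velocity W D ρ t u x) (totalMass ρ) where
  nonneg t := integral_nonneg fun p => abs_nonneg _
  integrable := intervalIntegrable_totalMass hT hint
  measurable u := (measurable_velocity hW hD hmeas x).comp measurable_prodMk_right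
  bound := by
    filter_upwards [ae_integrable_section hint] with t ht hta u
    rw [velocity_eq_meanField hW hD (ht hta)]
    exact abs_meanField_le hW hD (ht hta) u x
  lip := by
    filter_upwards [ae_integrable_section hint] with t ht hta
    simp_rw [velocity_eq_meanField hW hD (ht hta)]
    exact lipBound_meanField hW hD (ht hta) x

include hT hW hD hint in
-- Approximate ρ in L¹ by a continuous function with compact support. Its field is uniformly
-- continuous in time, and the two fields differ at time t by at most the L¹ distance of the
-- densities at that time.
theorem timeRegular_velocity (x : I) : TimeRegular T (fun t u => velocity W D ρ t u x) := by
  intro η hη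
  set c : ℝ := (volume : Measure (Phase × I)).real Set.univ with hc
  have hc0 : 0 ≤ c := measureReal_nonneg
  set F : ℝ × Phase × I → ℝ :=
    (Set.Icc 0 T ×ˢ Set.univ).indicator (fun p => ρ p.1 p.2.1 p.2.2) with hF
  have hFi : Integrable F :=
    (integrable_indicator_iff (measurableSet_Icc.prod MeasurableSet.univ)).2 hint
  obtain ⟨g, hgs, hgF, hgc, hgi⟩ := hFi.exists_hasCompactSupport_integral_sub_le hη
  have huc : UniformContinuous g := hgs.uniformContinuous_of_continuous hgc
  -- The pointwise oscillation is integrated over 𝕊 × I, of total mass c.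
  obtain ⟨δ, hδ, hgδ⟩ := Metric.uniformContinuous_iff.1 huc (η / (c + 1)) (by positivity)
  have hgt : ∀ t, Integrable (fun p : Phase × I => g (t, p)) := fun t => by
    obtain ⟨K, hK⟩ := hgs.exists_bound_of_continuous hgc
    exact Integrable.of_bound (hgc.comp (continuous_const.prodMk continuous_id)).aestronglyMeasurable
      K (ae_of_all _ fun p => hK _)
  have hdi : Integrable (fun q => F q - g q) (volume.prod volume) := hFi.sub hgi
  refine ⟨fun t u => meanField W D (fun p => g (t, p)) u x, fun t => ∫ p, |F (t, p) - g (t, p)|,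
    δ / 2, by positivity, fun t => integral_nonneg fun p => abs_nonneg _,
    hdi.integral_norm_prod_left.intervalIntegrable, ?_, ?_, fun t s u hts => ?_⟩
  · refine le_trans ?_ hgF
    rw [Measure.volume_eq_prod ℝ (Phase × I), integral_prod _ hdi.norm, intervalIntegral.integral_of_le hT.le]
    exact setIntegral_le_integral hdi.integral_norm_prod_left
      (ae_of_all _ fun t => integral_nonneg fun p => abs_nonneg _)
  · filter_upwards [ae_integrable_section hint] with t ht hta u
    rw [velocity_eq_meanField hW hD (ht hta)]
    refine (abs_meanField_sub_le hW hD (ht hta) (hgt t) u x).trans (le_of_eq ?_)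
    congr 1; ext p
    simp only [hF]
    rw [Set.indicator_of_mem (by exact ⟨Set.Ioc_subset_Icc_self hta, Set.mem_univ _⟩)]
  · refine (abs_meanField_sub_le hW hD (hgt t) (hgt s) u x).trans ?_
    have h1 : ∫ p : Phase × I, |g (t, p) - g (s, p)| ≤ ∫ p : Phase × I, η / (c + 1) := by
      refine integral_mono ((hgt t).sub (hgt s)).abs (integrable_const _) fun p => ?_
      have := hgδ (a := (t, p)) (b := (s, p)) (by
        rw [Prod.dist_eq, dist_self, max_eq_left dist_nonneg, Real.dist_eq]
        linarith)
      rw [Real.dist_eq] at this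
      exact this.le
    refine h1.trans ?_
    rw [integral_const, smul_eq_mul, ← hc, ← mul_div_assoc, div_le_iff₀ (by positivity)]
    nlinarith

end WeakSolution

/-- Properties of the slices of a weak solution that hold for almost every label. -/
structure IsSolutionSlice (T : ℝ) (W : I → I → ℝ) (D : Phase → ℝ) (ρ₀ : Phase → I → ℝ)
    (ρ : ℝ → Phase → I → ℝ) (x : I) : Prop where
  solution : IsLinearSolution T (fun t u => velocity W D ρ t u x) (fun _ => 1)
    (fun u => ρ₀ u x) (fun t u => ρ t u x)
  regular : TimeRegular T (fun t u => velocity W D ρ t u x)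
  nonneg : ∀ t ∈ Set.Icc 0 T, ∀ᵐ u, 0 ≤ ρ t u x
  integral_eq_one : ∀ t ∈ Set.Icc 0 T, ∫ u, ρ t u x = 1

theorem IsWeakSolution.ae_isLinearSolution {T : ℝ} {W : I → I → ℝ}
    (hW : IsGraphon W) {D : Phase → ℝ} (hD : IsCoupling D) {ρ₀ : Phase → I → ℝ}
    {ρ : ℝ → Phase → I → ℝ} (hρ : IsWeakSolution T W D ρ₀ ρ) {M : ℝ → ℝ}
    (hV : ∀ x, VelocityBound T (fun t u => velocity W D ρ t u x) M) :
    ∀ᵐ x : I, IsLinearSolution T (fun t u => velocity W D ρ t u x) M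
      (fun u => ρ₀ u x) (fun t u => ρ t u x) := by
  filter_upwards [hρ.integrable_section, hρ.weaklyContinuous, hρ.weak_eq] with x h1 h2 h3
  exact ⟨hV x, measurable_velocity hW hD hρ.measurable x,
    hρ.measurable.comp (measurable_fst.prodMk (measurable_snd.prodMk measurable_const)),
    h1, h2, h3⟩

/-- First half of a bootstrap: V is controlled by the total mass of ρ, so far only integrable in
time, and this suffices to run the scheme. -/
theorem IsWeakSolution.isProbabilityDensity {T : ℝ} (hT : 0 < T) {W : I → I → ℝ}
    (hW : IsGraphon W) {D : Phase → ℝ} (hD : IsCoupling D) {ρ₀ : Phase → I → ℝ}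
    (hρ₀ : IsInitialDensity ρ₀) {ρ : ℝ → Phase → I → ℝ} (hρ : IsWeakSolution T W D ρ₀ ρ) :
    ∀ᵐ x : I, ∀ t ∈ Set.Icc 0 T, Integrable (fun u => ρ t u x) ∧ (∀ᵐ u, 0 ≤ ρ t u x) ∧
      ∫ u, ρ t u x = 1 := by
  filter_upwards [hρ.ae_isLinearSolution hW hD
    (velocityBound_totalMass hT hW hD hρ.integrable hρ.measurable)] with x hx t ht
  exact ⟨hx.integrable t ht, hx.isProbabilityDensity hT
    (timeRegular_velocity hT hW hD hρ.integrable x) (fun u => hρ₀.nonneg u x)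
    (hρ₀.integral_eq_one x) ht⟩

/-- Since almost every slice has mass one, Fubini gives joint integrability at every time, not
merely almost every time. -/
theorem IsWeakSolution.integrable_time {T : ℝ} (hT : 0 < T) {W : I → I → ℝ}
    (hW : IsGraphon W) {D : Phase → ℝ} (hD : IsCoupling D) {ρ₀ : Phase → I → ℝ}
    (hρ₀ : IsInitialDensity ρ₀) {ρ : ℝ → Phase → I → ℝ} (hρ : IsWeakSolution T W D ρ₀ ρ) {t : ℝ}
    (ht : t ∈ Set.Icc 0 T) :
    Integrable (fun p : Phase × I => ρ t p.1 p.2) ∧ totalMass ρ t = 1 := by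
  have h1 := hρ.isProbabilityDensity hT hW hD hρ₀
  have hm : Measurable (fun p : Phase × I => ρ t p.1 p.2) :=
    hρ.measurable.comp measurable_prodMk_left
  have habs : ∀ᵐ x : I, ∫ u, |ρ t u x| = 1 := by
    filter_upwards [h1] with x hx
    obtain ⟨-, hx0, hx1⟩ := hx t ht
    rw [← hx1]
    refine integral_congr_ae ?_
    filter_upwards [hx0] with u hu using abs_of_nonneg hu
  have hi : Integrable (fun p : Phase × I => ρ t p.1 p.2) (volume.prod volume) := by
    rw [integrable_prod_iff' hm.aestronglyMeasurable]
    refine ⟨by filter_upwards [h1] with x hx using (hx t ht).1, ?_⟩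
    refine (integrable_const (1 : ℝ)).congr ?_
    filter_upwards [habs] with x hx using hx.symm
  refine ⟨hi, ?_⟩
  unfold totalMass
  rw [Measure.volume_eq_prod, integral_prod_symm _ hi.abs, integral_congr_ae habs]
  simp

/-- Second half of the bootstrap: the total mass is one, so the integrable bound on V and on its
Lipschitz constant may be replaced by 1. -/
theorem IsWeakSolution.ae_isSolutionSlice {T : ℝ} (hT : 0 < T) {W : I → I → ℝ}
    (hW : IsGraphon W) {D : Phase → ℝ} (hD : IsCoupling D) {ρ₀ : Phase → I → ℝ}
    (hρ₀ : IsInitialDensity ρ₀) {ρ : ℝ → Phase → I → ℝ} (hρ : IsWeakSolution T W D ρ₀ ρ) :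
    ∀ᵐ x : I, IsSolutionSlice T W D ρ₀ ρ x := by
  have hV : ∀ x, VelocityBound T (fun t u => velocity W D ρ t u x) (fun _ => 1) := fun x => by
    have h := velocityBound_totalMass hT hW hD hρ.integrable hρ.measurable x
    refine ⟨fun _ => zero_le_one, by simp, h.measurable, ?_, ?_⟩
    · filter_upwards [h.bound] with t ht hta u
      rw [← (hρ.integrable_time hT hW hD hρ₀ (Set.Ioc_subset_Icc_self hta)).2]
      exact ht hta u
    · filter_upwards [h.lip] with t ht hta
      rw [← (hρ.integrable_time hT hW hD hρ₀ (Set.Ioc_subset_Icc_self hta)).2]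
      exact ht hta
  filter_upwards [hρ.ae_isLinearSolution hW hD hV, hρ.isProbabilityDensity hT hW hD hρ₀]
    with x hx hp
  exact ⟨hx, timeRegular_velocity hT hW hD hρ.integrable x, fun t ht => (hp t ht).2.1,
    fun t ht => (hp t ht).2.2⟩

theorem IsSolutionSlice.stepBound {T : ℝ} (hT : 0 < T) {W : I → I → ℝ} {D : Phase → ℝ}
    {ρ₀ : Phase → I → ℝ} {ρ : ℝ → Phase → I → ℝ} {x : I} (h : IsSolutionSlice T W D ρ₀ ρ x) :
    StepBound T 1 (fun t u => velocity W D ρ t u x) (fun _ => 1) (fun _ => 0)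
      (fun t g => ∫ u, ρ t u x * g u) := by
  refine h.solution.exists_stepBound hT fun t ht f K hf hK => ?_
  rw [← h.integral_eq_one t ht, ← integral_mul_const]
  refine abs_integral_le_of_abs_le ((h.solution.integrable t ht).mul_const _) ?_
  filter_upwards [h.nonneg t ht] with u hu
  rw [abs_mul, abs_of_nonneg hu]
  exact mul_le_mul_of_nonneg_left (hK u) hu

/-! ### Combining step bounds -/

/-- Both functionals are tested with the same displacement β, so their errors add. -/
theorem StepBound.sub {T C₁ C₂ : ℝ} {V : ℝ → Phase → ℝ} {M r₁ r₂ : ℝ → ℝ}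
    {Λ₁ Λ₂ : ℝ → (Phase → ℝ) → ℝ} (hM : IntervalIntegrable M volume 0 T)
    (hr₁ : IntervalIntegrable r₁ volume 0 T) (hr₂ : IntervalIntegrable r₂ volume 0 T)
    (h₁ : StepBound T C₁ V M r₁ Λ₁) (h₂ : StepBound T C₂ V M r₂ Λ₂) :
    StepBound T (C₁ + C₂) V M (fun t => r₁ t + r₂ t) (fun t g => Λ₁ t g - Λ₂ t g) := by
  intro a b ha hab hb g β G B q hG hB hg hgG hβ hβB hq hVq
  have hMi := intervalIntegrable_sub hM ha hab hb
  have e1 := h₁ a b ha hab hb g β G B q hG hB hg hgG hβ hβB hq hVq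
  have e2 := h₂ a b ha hab hb g β G B q hG hB hg hgG hβ hβB hq hVq
  have hsum : ∫ t in a..b, ((C₁ + C₂) * (q t + M t * ((b - a) * B))
        + (r₁ t + r₂ t) * (1 + (b - a) * B))
      = (∫ t in a..b, (C₁ * (q t + M t * ((b - a) * B)) + r₁ t * (1 + (b - a) * B)))
        + ∫ t in a..b, (C₂ * (q t + M t * ((b - a) * B)) + r₂ t * (1 + (b - a) * B)) := by
    rw [← intervalIntegral.integral_add
      (((hq.add (hMi.mul_const _)).const_mul _).add
        ((intervalIntegrable_sub hr₁ ha hab hb).mul_const _))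
      (((hq.add (hMi.mul_const _)).const_mul _).add
        ((intervalIntegrable_sub hr₂ ha hab hb).mul_const _))]
    congr 1; ext t; ring
  rw [hsum, mul_add]
  rw [abs_le] at *
  constructor <;> linarith [e1.1, e1.2, e2.1, e2.2]

theorem StepBound.average {T C : ℝ} {V : ℝ → Phase → ℝ} {M : ℝ → ℝ} {m : ℕ} (hm : 0 < m)
    {r : Fin m → ℝ → ℝ} {Λ : Fin m → ℝ → (Phase → ℝ) → ℝ} (hM : IntervalIntegrable M volume 0 T)
    (hr : ∀ j, IntervalIntegrable (r j) volume 0 T) (h : ∀ j, StepBound T C V M (r j) (Λ j)) :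
    StepBound T C V M (fun t => (m : ℝ)⁻¹ * ∑ j, r j t)
      (fun t g => (m : ℝ)⁻¹ * ∑ j, Λ j t g) := by
  intro a b ha hab hb g β G B q hG hB hg hgG hβ hβB hq hVq
  have hm0 : (0 : ℝ) < m := by exact_mod_cast hm
  have hMi := intervalIntegrable_sub hM ha hab hb
  have hsum : ∫ t in a..b, (C * (q t + M t * ((b - a) * B))
        + ((m : ℝ)⁻¹ * ∑ j, r j t) * (1 + (b - a) * B))
      = (m : ℝ)⁻¹ * ∑ j, ∫ t in a..b,
          (C * (q t + M t * ((b - a) * B)) + r j t * (1 + (b - a) * B)) := by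
    rw [← intervalIntegral.integral_finsetSum (fun j _ =>
      (((hq.add (hMi.mul_const _)).const_mul _).add
        ((intervalIntegrable_sub (hr j) ha hab hb).mul_const _))),
      ← intervalIntegral.integral_const_mul]
    congr 1; ext t
    rw [Finset.sum_add_distrib, ← Finset.sum_mul, Finset.sum_const, Finset.card_univ,
      Fintype.card_fin, nsmul_eq_mul]
    field_simp
    rw [← Finset.mul_sum]
    ring
  rw [hsum, ← mul_sub, ← Finset.sum_sub_distrib, abs_mul, abs_of_pos (inv_pos.2 hm0),
    mul_left_comm, Finset.mul_sum]
  refine mul_le_mul_of_nonneg_left ((Finset.abs_sum_le_sum_abs _ _).trans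
    (Finset.sum_le_sum fun j _ => ?_)) (inv_pos.2 hm0).le
  exact h j a b ha hab hb g β G B q hG hB hg hgG hβ hβB hq hVq

/-- The dual interpolation g(y+(b-t)β(y)) is differentiated along the trajectory, which moves with
velocity v instead of V. -/
theorem stepBound_particle {T : ℝ} {V : ℝ → Phase → ℝ} {M : ℝ → ℝ} (hV : VelocityBound T V M)
    {y v r : ℝ → ℝ} (hy : ∀ t ∈ Set.Icc 0 T, HasDerivWithinAt y (v t) (Set.Icc 0 T) t)
    (hv : ContinuousOn v (Set.Icc 0 T)) (hr : IntervalIntegrable r volume 0 T)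
    (hvr : ∀ t ∈ Set.Icc 0 T, |v t - V t (y t)| ≤ r t) :
    StepBound T 1 V M r (fun t g => g (y t)) := by
  intro a b ha hab hb g β G B q hG hB hg hgG hβ hβB hq hVq
  have hsub : Set.Icc a b ⊆ Set.Icc 0 T := Set.Icc_subset_Icc ha hb
  have hyc : ContinuousOn y (Set.Icc a b) := fun t ht =>
    ((hy t (hsub ht)).continuousWithinAt).mono hsub
  set g' := deriv (fun s : ℝ => g (s : Phase)) with hg'
  set β' := deriv (fun s : ℝ => β (s : Phase)) with hβ'
  have hg'c : Continuous g' := (contDiff_one_iff_deriv.1 hg).2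
  have hβ'c : Continuous β' := (contDiff_one_iff_deriv.1 hβ).2
  have hβc : Continuous (fun s : ℝ => β (s : Phase)) := ContDiff.continuous hβ
  have hgc : Continuous (fun s : ℝ => g (s : Phase)) := ContDiff.continuous hg
  set z : ℝ → ℝ := fun t => y t + (b - t) * β (y t) with hz
  have hzc : ContinuousOn z (Set.Icc a b) := hyc.add
    ((continuousOn_const.sub continuousOn_id).mul (hβc.comp_continuousOn hyc))
  set ψ' : ℝ → ℝ := fun t => g' (z t) * (v t * (1 + (b - t) * β' (y t)) - β (y t)) with hψ'
  have hψ'c : ContinuousOn ψ' (Set.Icc a b) :=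
    (hg'c.comp_continuousOn hzc).mul (((hv.mono hsub).mul (continuousOn_const.add
      ((continuousOn_const.sub continuousOn_id).mul (hβ'c.comp_continuousOn hyc)))).sub
        (hβc.comp_continuousOn hyc))
  have hd : ∀ t ∈ Set.Ioo a b, HasDerivAt (fun t => g (z t : Phase)) (ψ' t) t := by
    intro t ht
    have hyt : HasDerivAt y (v t) t := (hy t (hsub (Set.Ioo_subset_Icc_self ht))).hasDerivAt
      (Icc_mem_nhds (ha.trans_lt ht.1) (ht.2.trans_le hb))
    have h1 : HasDerivAt (fun t => β (y t : Phase)) (β' (y t) * v t) t :=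
      HasDerivAt.comp t (hβ.hasDerivAt (y t)) hyt
    have h2 : HasDerivAt z (v t + (-1 * β (y t) + (b - t) * (β' (y t) * v t))) t :=
      hyt.add (((hasDerivAt_id t).const_sub b).mul h1)
    have h3 : HasDerivAt (fun t => g (z t : Phase)) _ t :=
      HasDerivAt.comp t (hg.hasDerivAt (z t)) h2
    convert h3 using 1
    simp only [hψ']
    ring
  have hftc := intervalIntegral.integral_eq_sub_of_hasDerivAt_of_le hab
    (hgc.comp_continuousOn hzc) hd (hψ'c.intervalIntegrable_of_Icc hab)
  have e : g (y b) - displace g β (b - a) (y a) = ∫ t in a..b, ψ' t := by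
    rw [hftc]
    simp [hz, KuramotoGraphon.displace]
  rw [e, ← Real.norm_eq_abs, ← intervalIntegral.integral_const_mul]
  have hMi := intervalIntegrable_sub hV.integrable ha hab hb
  refine intervalIntegral.norm_integral_le_of_norm_le hab ?_
    ((((hq.add (hMi.mul_const _)).const_mul _).add
      ((intervalIntegrable_sub hr ha hab hb).mul_const _)).const_mul _)
  filter_upwards [hVq, hV.bound] with t ht1 ht2 hta
  have htT : t ∈ Set.Ioc 0 T := ⟨ha.trans_lt hta.1, hta.2.trans hb⟩
  have hbt : 0 ≤ b - t := sub_nonneg.2 hta.2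
  rw [Real.norm_eq_abs]
  simp only [hψ', abs_mul]
  refine mul_le_mul (hgG.abs_deriv_le hG _) ?_ (abs_nonneg _) hG
  have hβ'B : |β' (y t)| ≤ B := hβB.abs_deriv_le hB _
  have hprod : |(b - t) * β' (y t)| ≤ (b - a) * B := by
    rw [abs_mul, abs_of_nonneg hbt]
    exact mul_le_mul (by linarith [hta.1]) hβ'B (abs_nonneg _) (by linarith)
  -- Consistency error, first-order remainder of the Euler step, and deviation of the particle from
  -- the field.
  have e2 : v t * (1 + (b - t) * β' (y t)) - β (y t) = (V t (y t) - β (y t))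
      + V t (y t) * ((b - t) * β' (y t)) + (v t - V t (y t)) * (1 + (b - t) * β' (y t)) := by ring
  rw [e2]
  refine (abs_add_three _ _ _).trans ?_
  have h1 := ht1 hta (y t)
  have h2 : |V t (y t) * ((b - t) * β' (y t))| ≤ M t * ((b - a) * B) := by
    rw [abs_mul]
    exact mul_le_mul (ht2 htT _) hprod (abs_nonneg _) (hV.nonneg t)
  have h3 : |(v t - V t (y t)) * (1 + (b - t) * β' (y t))| ≤ r t * (1 + (b - a) * B) := by
    rw [abs_mul]
    refine mul_le_mul (hvr t (Set.Ioc_subset_Icc_self htT)) ?_ (abs_nonneg _)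
      ((abs_nonneg _).trans (hvr t (Set.Ioc_subset_Icc_self htT)))
    refine (abs_add_le _ _).trans ?_
    rw [abs_one]
    linarith
  linarith

/-! ### Empirical measures and the distance -/

/-- The empirical measure of finitely many phases. -/
def empirical {m : ℕ} (y : Fin m → Phase) : Measure Phase :=
  (m : ℝ≥0∞)⁻¹ • ∑ j, Measure.dirac (y j)

theorem integral_empirical {m : ℕ} (y : Fin m → Phase) (f : Phase → ℝ) :
    ∫ v, f v ∂(empirical y) = (m : ℝ)⁻¹ * ∑ j, f (y j) := by
  unfold empirical
  rw [integral_smul_measure, integral_finsetSum_measure (fun j _ => by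
    exact integrable_dirac (by simp))]
  simp

theorem isProbabilityMeasure_empirical {m : ℕ} (hm : 0 < m) (y : Fin m → Phase) :
    IsProbabilityMeasure (empirical y) := by
  constructor
  have : (m : ℝ≥0∞) ≠ 0 := by exact_mod_cast hm.ne'
  simp [empirical, ENNReal.inv_mul_cancel this (ENNReal.natCast_ne_top m)]

theorem integral_densityMeasure {ρ : ℝ → Phase → I → ℝ} {t : ℝ} {x : I}
    (hm : Measurable (fun u => ρ t u x)) (h0 : ∀ᵐ u, 0 ≤ ρ t u x) (f : Phase → ℝ) :
    ∫ v, f v ∂(densityMeasure ρ t x) = ∫ u, ρ t u x * f u := by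
  unfold densityMeasure
  rw [integral_withDensity_eq_integral_toReal_smul hm.ennreal_ofReal
    (ae_of_all _ fun u => ENNReal.ofReal_lt_top)]
  refine integral_congr_ae ?_
  filter_upwards [h0] with u hu
  rw [ENNReal.toReal_ofReal hu, smul_eq_mul]

theorem isProbabilityMeasure_densityMeasure {ρ : ℝ → Phase → I → ℝ} {t : ℝ} {x : I}
    (hi : Integrable (fun u => ρ t u x)) (h0 : ∀ᵐ u, 0 ≤ ρ t u x) (h1 : ∫ u, ρ t u x = 1) :
    IsProbabilityMeasure (densityMeasure ρ t x) := by
  constructor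
  rw [densityMeasure, withDensity_apply _ MeasurableSet.univ, Measure.restrict_univ,
    ← ofReal_integral_eq_lintegral_ofReal hi h0, h1, ENNReal.ofReal_one]

theorem abs_integral_sub_le_of_dist {μ η : Measure Phase} [IsProbabilityMeasure μ]
    [IsProbabilityMeasure η] {f g : Phase → ℝ} (hf : Continuous f) (hg : Continuous g) {c : ℝ}
    (h : ∀ u, |f u - g u| ≤ c) :
    |(∫ v, f v ∂μ) - ∫ v, f v ∂η| ≤ |(∫ v, g v ∂μ) - ∫ v, g v ∂η| + 2 * c := by
  have hint : ∀ (ν : Measure Phase) [IsProbabilityMeasure ν] {f : Phase → ℝ}, Continuous f →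
      Integrable f ν := fun ν _ f hf => by
    obtain ⟨K, hK⟩ := isCompact_univ.exists_bound_of_continuousOn hf.continuousOn
    exact Integrable.of_bound hf.aestronglyMeasurable K (ae_of_all _ fun u => hK u (Set.mem_univ u))
  have key : ∀ (ν : Measure Phase) [IsProbabilityMeasure ν],
      |(∫ v, f v ∂ν) - ∫ v, g v ∂ν| ≤ c := fun ν _ => by
    rw [← integral_sub (hint ν hf) (hint ν hg)]
    simpa using abs_integral_le_of_abs_le (μ := ν) (integrable_const c) (ae_of_all _ h)
  have h1 := key μ
  have h2 := key η
  rw [abs_le] at h1 h2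
  have h3 := neg_abs_le ((∫ v, g v ∂μ) - ∫ v, g v ∂η)
  have h4 := le_abs_self ((∫ v, g v ∂μ) - ∫ v, g v ∂η)
  rw [abs_le]
  constructor <;> linarith [h1.1, h1.2, h2.1, h2.2]

/-- Subtracting the constant f(0) leaves a function bounded by π, half the circumference. -/
theorem dBL_le_two_pi (μ η : Measure Phase) [IsProbabilityMeasure μ] [IsProbabilityMeasure η] :
    dBL μ η ≤ ENNReal.ofReal (2 * Real.pi) := by
  refine iSup₂_le fun f hf => ENNReal.ofReal_le_ofReal ?_
  have := abs_integral_sub_le_of_dist (μ := μ) (η := η) (g := fun _ => f 0) hf.continuous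
    continuous_const (c := Real.pi) (fun u => by
      have := LipschitzWith.lipBound hf u 0
      rw [one_mul] at this
      exact this.trans (Phase.dist_le u 0))
  simpa using this

theorem abs_integral_sub_le_dBL {μ η : Measure Phase} (hfin : dBL μ η ≠ ⊤) {f : Phase → ℝ} {L : ℝ}
    (hL : 0 < L) (hf : LipBound L f) :
    |(∫ v, f v ∂μ) - ∫ v, f v ∂η| ≤ L * (dBL μ η).toReal := by
  have hf' : LipBound 1 (fun u => L⁻¹ * f u) := fun u v => by
    rw [← mul_sub, abs_mul, abs_of_pos (inv_pos.2 hL), one_mul]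
    calc _ ≤ L⁻¹ * (L * dist u v) := mul_le_mul_of_nonneg_left (hf u v) (inv_pos.2 hL).le
      _ = _ := by field_simp
  have h1 : ENNReal.ofReal |(∫ v, L⁻¹ * f v ∂μ) - ∫ v, L⁻¹ * f v ∂η| ≤ dBL μ η :=
    le_iSup₂_of_le (f := fun (f : Phase → ℝ) (_ : LipschitzWith 1 f) =>
      ENNReal.ofReal |(∫ v, f v ∂μ) - ∫ v, f v ∂η|) _ hf'.lipschitzWith le_rfl
  rw [ENNReal.ofReal_le_iff_le_toReal hfin, integral_const_mul, integral_const_mul, ← mul_sub,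
    abs_mul, abs_of_pos (inv_pos.2 hL)] at h1
  calc _ = L * (L⁻¹ * |(∫ v, f v ∂μ) - ∫ v, f v ∂η|) := by field_simp
    _ ≤ _ := mul_le_mul_of_nonneg_left h1 hL.le

theorem integral_exp_mul {l : ℝ} (hl : 0 < l) (s : ℝ) :
    ∫ t in 0..s, Real.exp (l * t) = (Real.exp (l * s) - 1) / l := by
  rw [intervalIntegral.integral_comp_mul_left (fun t => Real.exp t) hl.ne', integral_exp]
  simp only [mul_zero, Real.exp_zero, smul_eq_mul]
  field_simp

/-- Stability of a slice of the mean-field solution against an ensemble of perturbed particles. -/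
theorem IsSolutionSlice.dBL_le {T : ℝ} (hT : 0 < T) {W : I → I → ℝ} {D : Phase → ℝ}
    {ρ₀ : Phase → I → ℝ} {ρ : ℝ → Phase → I → ℝ} {x : I} (h : IsSolutionSlice T W D ρ₀ ρ x)
    {m : ℕ} (hm : 0 < m) {y v : Fin m → ℝ → ℝ}
    (hy : ∀ j, ∀ t ∈ Set.Icc 0 T, HasDerivWithinAt (y j) (v j t) (Set.Icc 0 T) t)
    (hv : ∀ j, ContinuousOn (v j) (Set.Icc 0 T)) {K l : ℝ} (hK : 0 ≤ K) (hl : 0 < l)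
    {E : Fin m → ℝ} (hE : ∀ j, 0 ≤ E j)
    (hvr : ∀ j, ∀ t ∈ Set.Icc 0 T,
      |v j t - velocity W D ρ t (y j t) x| ≤ K * Real.exp (l * t) + E j)
    {s : ℝ} (hs : s ∈ Set.Icc 0 T) :
    dBL (empirical fun j => (y j s : Phase)) (densityMeasure ρ s x) ≤
      ENNReal.ofReal (Real.exp T) *
        dBL (empirical fun j => (y j 0 : Phase)) (densityMeasure ρ 0 x) +
      ENNReal.ofReal (Real.exp T * (K * Real.exp (l * s) / l) +
        Real.exp T * T * ((m : ℝ)⁻¹ * ∑ j, E j)) := by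
  have hm0 : (0 : ℝ) < m := by exact_mod_cast hm
  have hρm : ∀ t, Measurable (fun u => ρ t u x) := fun t =>
    h.solution.measurable.comp measurable_prodMk_left
  have hemp : ∀ t, IsProbabilityMeasure (empirical fun j => (y j t : Phase)) := fun t =>
    isProbabilityMeasure_empirical hm _
  have hden : ∀ t ∈ Set.Icc 0 T, IsProbabilityMeasure (densityMeasure ρ t x) := fun t ht =>
    isProbabilityMeasure_densityMeasure (h.solution.integrable t ht) (h.nonneg t ht)
      (h.integral_eq_one t ht)
  have h0T : (0 : ℝ) ∈ Set.Icc 0 T := ⟨le_rfl, hT.le⟩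
  set Λ : ℝ → (Phase → ℝ) → ℝ := fun t g =>
    (m : ℝ)⁻¹ * ∑ j, g (y j t : Phase) - ∫ u, ρ t u x * g u with hΛ
  have hΛeq : ∀ t ∈ Set.Icc 0 T, ∀ g : Phase → ℝ, Λ t g =
      (∫ v, g v ∂(empirical fun j => (y j t : Phase))) - ∫ v, g v ∂(densityMeasure ρ t x) := by
    intro t ht g
    rw [integral_empirical, integral_densityMeasure (hρm t) (h.nonneg t ht)]
  set r : ℝ → ℝ := fun t => (m : ℝ)⁻¹ * ∑ j, (K * Real.exp (l * t) + E j) with hr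
  set Eb := (m : ℝ)⁻¹ * ∑ j, E j with hEb
  have hEb0 : 0 ≤ Eb := mul_nonneg (inv_pos.2 hm0).le (Finset.sum_nonneg fun j _ => hE j)
  have hr' : ∀ t, r t = K * Real.exp (l * t) + Eb := fun t => by
    simp only [hr, hEb, Finset.sum_add_distrib, Finset.sum_const, Finset.card_univ,
      Fintype.card_fin, nsmul_eq_mul]
    field_simp
  have hrc : Continuous r := by
    rw [show r = fun t => K * Real.exp (l * t) + Eb from funext hr']
    fun_prop
  have hri : ∀ j, IntervalIntegrable (fun t => K * Real.exp (l * t) + E j) volume 0 T := fun j =>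
    Continuous.intervalIntegrable (by fun_prop) _ _
  -- The particles enter as an average of Dirac masses, and the slice of ρ with error 0.
  have hstep : StepBound T (1 + 1) (fun t u => velocity W D ρ t u x) (fun _ => 1)
      (fun t => r t + 0) Λ :=
    StepBound.sub (by simp) (hrc.intervalIntegrable _ _) (by simp)
      (StepBound.average hm (by simp) hri fun j =>
        stepBound_particle h.solution.velocity (hy j) (hv j) (hri j) (hvr j)) (h.stepBound hT)
  have hfin0 : dBL (empirical fun j => (y j 0 : Phase)) (densityMeasure ρ 0 x) ≠ ⊤ := by
    have := hemp 0
    have := hden 0 h0T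
    exact ne_top_of_le_ne_top ENNReal.ofReal_ne_top (dBL_le_two_pi _ _)
  set d₀ := (dBL (empirical fun j => (y j 0 : Phase)) (densityMeasure ρ 0 x)).toReal with hd₀
  have hd₀0 : 0 ≤ d₀ := ENNReal.toReal_nonneg
  set R := Real.exp T * d₀ + (Real.exp T * (K * Real.exp (l * s) / l) + Real.exp T * T * Eb)
    with hR
  -- Integrating the exponential bound gains the factor 1/l, which later closes the Grönwall
  -- argument.
  have hrint : ∫ t in 0..s, (r t + 0) ≤ K * Real.exp (l * s) / l + T * Eb := by
    simp only [add_zero, hr']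
    rw [intervalIntegral.integral_add (Continuous.intervalIntegrable (by fun_prop) _ _)
      intervalIntegrable_const, intervalIntegral.integral_const_mul, integral_exp_mul hl]
    simp only [intervalIntegral.integral_const, smul_eq_mul, sub_zero]
    have := mul_le_mul_of_nonneg_right hs.2 hEb0
    have h2 : K * ((Real.exp (l * s) - 1) / l) ≤ K * Real.exp (l * s) / l := by
      rw [← mul_div_assoc]
      refine div_le_div_of_nonneg_right ?_ hl.le
      nlinarith
    linarith
  have hes : Real.exp s ≤ Real.exp T := Real.exp_le_exp.2 hs.2
  have hC1 : ∀ f : Phase → ℝ, IsC1 f → LipBound 1 f → |Λ s f| ≤ R := by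
    intro f hf hfL
    refine le_of_forall_pos_le_add fun ε hε => ?_
    obtain ⟨g, φ, hg, hgL, -, hgΛ⟩ := dual_scheme (by norm_num) h.solution.velocity h.regular hstep
      (by simpa using hrc.intervalIntegrable _ _) (fun t => by
        rw [add_zero, hr']; positivity) hs zero_le_one hf hfL
      (ε := ε / Real.exp T) (by positivity)
    simp only [intervalIntegral.integral_const, smul_eq_mul, mul_one, sub_zero, one_mul] at hgL hgΛ
    have h1 := abs_integral_sub_le_dBL hfin0 (Real.exp_pos s) hgL
    rw [← hΛeq 0 h0T, ← hd₀] at h1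
    have h2 : |Λ s f| ≤ |Λ s f - Λ 0 g| + |Λ 0 g| := by
      have := abs_add_le (Λ s f - Λ 0 g) (Λ 0 g)
      rwa [sub_add_cancel] at this
    have h3 : Real.exp s * d₀ ≤ Real.exp T * d₀ := mul_le_mul_of_nonneg_right hes hd₀0
    have h4 : Real.exp s * ((∫ t in 0..s, (r t + 0)) + ε / Real.exp T)
        ≤ Real.exp T * ((K * Real.exp (l * s) / l + T * Eb) + ε / Real.exp T) := by
      refine mul_le_mul hes (add_le_add hrint le_rfl) ?_ (Real.exp_pos T).le
      refine add_nonneg (intervalIntegral.integral_nonneg hs.1 fun t _ => ?_) (by positivity)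
      rw [add_zero, hr']; positivity
    have h5 : Real.exp T * (ε / Real.exp T) = ε := by field_simp
    rw [mul_add (Real.exp T), h5] at h4
    simp only [hR]
    linarith
  -- Mollifying f at scale ε/2 changes each of the two integrals by at most ε/2.
  have hall : ∀ f : Phase → ℝ, LipschitzWith 1 f → |Λ s f| ≤ R := by
    intro f hf
    refine le_of_forall_pos_le_add fun ε hε => ?_
    have hfL := LipschitzWith.lipBound hf
    have hst := isC1_steklov (ε / 2) hf.continuous
    have := hemp s
    have := hden s hs
    have h1 := abs_integral_sub_le_of_dist (μ := empirical fun j => (y j s : Phase))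
      (η := densityMeasure ρ s x) hf.continuous hst.continuous (c := 1 * (ε / 2)) (fun u => by
        rw [abs_sub_comm]
        exact abs_steklov_sub_le (by positivity) zero_le_one hfL u)
    rw [← hΛeq s hs, ← hΛeq s hs] at h1
    have h2 := hC1 _ hst (hfL.steklov (by positivity))
    linarith
  refine iSup₂_le fun f hf => ?_
  rw [← hΛeq s hs]
  refine (ENNReal.ofReal_le_ofReal (hall f hf)).trans ?_
  rw [hR, ENNReal.ofReal_add (by positivity) (by
    have := hT.le
    positivity), ENNReal.ofReal_mul (Real.exp_pos T).le, hd₀, ENNReal.ofReal_toReal hfin0]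

/-! ### Blocks -/

theorem block_eq_preimage (n : ℕ) (i : Fin n) :
    block n i = (fun x : I => (x : ℝ)) ⁻¹' Set.Ico ((i : ℝ) / n) (((i : ℝ) + 1) / n) := rfl

theorem measurableSet_block (n : ℕ) (i : Fin n) : MeasurableSet (block n i) := by
  rw [block_eq_preimage]
  exact measurable_subtype_coe measurableSet_Ico

theorem volume_block (n : ℕ) (i : Fin n) : volume (block n i) = ENNReal.ofReal (n : ℝ)⁻¹ := by
  have hn : (0 : ℝ) < n := by exact_mod_cast i.pos
  have hi : (i : ℝ) + 1 ≤ n := by exact_mod_cast i.isLt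
  rw [unitInterval.volume_apply]
  have : Subtype.val '' block n i = Set.Ico ((i : ℝ) / n) (((i : ℝ) + 1) / n) := by
    rw [block_eq_preimage]
    refine (Subtype.image_preimage_val _ _).trans (Set.inter_eq_right.2 fun y hy => ⟨?_, ?_⟩)
    · exact le_trans (by positivity) hy.1
    · exact hy.2.le.trans ((div_le_one hn).2 hi)
  rw [this, Real.volume_Ico]
  congr 1
  field_simp
  ring

theorem volume_real_block (n : ℕ) (i : Fin n) :
    (volume : Measure I).real (block n i) = (n : ℝ)⁻¹ := by
  rw [measureReal_def, volume_block, ENNReal.toReal_ofReal (by positivity)]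

theorem eq_of_mem_block {n : ℕ} {i j : Fin n} {x : I} (hi : x ∈ block n i) (hj : x ∈ block n j) :
    i = j := by
  have hn : (0 : ℝ) < n := by exact_mod_cast i.pos
  obtain ⟨h1, h2⟩ := hi
  obtain ⟨h3, h4⟩ := hj
  rw [div_le_iff₀ hn] at h1 h3
  rw [lt_div_iff₀ hn] at h2 h4
  have e1 : (i : ℝ) < j + 1 := by linarith
  have e2 : (j : ℝ) < i + 1 := by linarith
  have e1' : (i : ℕ) < j + 1 := by exact_mod_cast e1
  have e2' : (j : ℕ) < i + 1 := by exact_mod_cast e2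
  exact Fin.ext (by omega)

theorem exists_mem_block {n : ℕ} (hn : 0 < n) {x : I} (hx : (x : ℝ) < 1) :
    ∃ i, x ∈ block n i := by
  have hn0 : (0 : ℝ) < n := by exact_mod_cast hn
  have h0 : 0 ≤ (n : ℝ) * x := mul_nonneg hn0.le x.2.1
  refine ⟨⟨⌊(n : ℝ) * x⌋₊, (Nat.floor_lt h0).2 (by nlinarith)⟩, ?_, ?_⟩
  · rw [div_le_iff₀ hn0, mul_comm (x : ℝ)]
    exact Nat.floor_le h0
  · rw [lt_div_iff₀ hn0, mul_comm (x : ℝ)]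
    exact Nat.lt_floor_add_one _

theorem ae_exists_mem_block {n : ℕ} (hn : 0 < n) : ∀ᵐ x : I, ∃ i, x ∈ block n i := by
  have : ∀ᵐ x : I, x ≠ 1 := by simp [ae_iff, measure_singleton]
  filter_upwards [this] with x hx
  exact exists_mem_block hn (lt_of_le_of_ne x.2.2 fun h => hx (Subtype.ext h))

theorem block_subset (n m : ℕ) (i : Fin n) (a : Fin m) :
    block (n * m) (finProdFinEquiv (i, a)) ⊆ block n i := by
  intro x hx
  have hn : (0 : ℝ) < n := by exact_mod_cast i.pos
  have hm : (0 : ℝ) < m := by exact_mod_cast a.pos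
  have ha : (a : ℝ) + 1 ≤ m := by exact_mod_cast a.isLt
  obtain ⟨h1, h2⟩ := hx
  -- The index of the pair (i, a) is a + m·i, so the fine cells of block i are consecutive.
  simp only [finProdFinEquiv_apply_val, Nat.cast_add, Nat.cast_mul] at h1 h2
  rw [div_le_iff₀ (by positivity)] at h1
  rw [lt_div_iff₀ (by positivity)] at h2
  have ha0 : (0 : ℝ) ≤ a := by positivity
  constructor
  · rw [div_le_iff₀ hn]
    have : (m : ℝ) * i ≤ m * (x * n) := by linarith
    exact le_of_mul_le_mul_left this hm
  · rw [lt_div_iff₀ hn]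
    have : (m : ℝ) * (x * n) < m * (i + 1) := by linarith
    exact lt_of_mul_lt_mul_left this hm.le

theorem sum_indicator_block {β : Type*} [AddCommMonoid β] {n : ℕ} (F : Fin n → I → β) {x : I}
    {i : Fin n} (hx : x ∈ block n i) : ∑ j, (block n j).indicator (F j) x = F i x := by
  rw [Finset.sum_eq_single i, Set.indicator_of_mem hx]
  · exact fun j _ hj => Set.indicator_of_notMem (fun h => hj (eq_of_mem_block h hx)) _
  · simp

theorem integral_sum_indicator_block {n : ℕ} (F : Fin n → I → ℝ) (hF : ∀ i, Integrable (F i)) :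
    ∫ x, ∑ i, (block n i).indicator (F i) x = ∑ i, ∫ x in block n i, F i x := by
  rw [integral_finsetSum _ fun i _ => (hF i).indicator (measurableSet_block n i)]
  exact Finset.sum_congr rfl fun i _ => integral_indicator (measurableSet_block n i)

theorem blockEmpirical_of_mem {n m : ℕ} (u : Fin (n * m) → ℝ) {x : I} {i : Fin n}
    (hx : x ∈ block n i) :
    blockEmpirical n m u x = empirical fun j => (u (finProdFinEquiv (i, j)) : Phase) :=
  sum_indicator_block _ hx

/-! ### Stability of the particle system -/

/-- The total deviation of the weights of a node from the block averages of the graphon. -/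
def kernelError (W : I → I → ℝ) (n m : ℕ) (j : Fin (n * m)) (x : I) : ℝ :=
  ∑ i : Fin n, ∑ b : Fin m, |((n * m : ℕ) : ℝ)⁻¹ * weight W (n * m) j (finProdFinEquiv (i, b))
    - (m : ℝ)⁻¹ * ∫ y in block n i, W x y|

/-- The average of `kernelError` over the nodes in the block of `x`. -/
def blockKernelError (W : I → I → ℝ) (n m : ℕ) (x : I) : ℝ :=
  ∑ i : Fin n, (block n i).indicator
    (fun x => (m : ℝ)⁻¹ * ∑ a : Fin m, kernelError W n m (finProdFinEquiv (i, a)) x) x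

theorem kernelError_nonneg (W : I → I → ℝ) (n m : ℕ) (j : Fin (n * m)) (x : I) :
    0 ≤ kernelError W n m j x :=
  Finset.sum_nonneg fun _ _ => Finset.sum_nonneg fun _ _ => abs_nonneg _

theorem blockKernelError_nonneg (W : I → I → ℝ) (n m : ℕ) (x : I) :
    0 ≤ blockKernelError W n m x :=
  Finset.sum_nonneg fun _ _ => Set.indicator_nonneg (fun _ _ => mul_nonneg (by positivity)
    (Finset.sum_nonneg fun _ _ => kernelError_nonneg _ _ _ _ _)) _

theorem IsGraphon.integrable_right {W : I → I → ℝ} (hW : IsGraphon W) (x : I) :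
    Integrable (fun y => W x y) :=
  Integrable.of_bound (hW.measurable.comp measurable_prodMk_left).aestronglyMeasurable 1
    (ae_of_all _ fun y => hW.abs_le_one x y)

theorem IsGraphon.measurable_setIntegral {W : I → I → ℝ} (hW : IsGraphon W) (s : Set I) :
    Measurable (fun x => ∫ y in s, W x y) :=
  (StronglyMeasurable.integral_prod_right' (ν := volume.restrict s)
    hW.measurable.stronglyMeasurable).measurable

theorem integrable_kernelError {W : I → I → ℝ} (hW : IsGraphon W) (n m : ℕ) (j : Fin (n * m)) :
    Integrable (kernelError W n m j) := by
  refine integrable_finsetSum _ fun i _ => integrable_finsetSum _ fun b _ => ?_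
  refine ((integrable_const _).sub (Integrable.const_mul ?_ _)).abs
  refine Integrable.of_bound (hW.measurable_setIntegral _).aestronglyMeasurable 1
    (ae_of_all _ fun x => ?_)
  rw [Real.norm_eq_abs]
  refine (abs_integral_le_of_abs_le (integrable_const (1 : ℝ))
    (ae_of_all _ fun y => hW.abs_le_one x y)).trans ?_
  simp

theorem integrable_blockKernelError {W : I → I → ℝ} (hW : IsGraphon W) (n m : ℕ) :
    Integrable (blockKernelError W n m) :=
  integrable_finsetSum _ fun i _ => ((integrable_finsetSum _ fun _ _ =>
    integrable_kernelError hW n m _).const_mul _).indicator (measurableSet_block n i)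

section Stability

variable {T : ℝ} (hT : 0 < T) {W : I → I → ℝ} (hW : IsGraphon W) {D : Phase → ℝ}
  (hD : IsCoupling D) {ρ₀ : Phase → I → ℝ} (hρ₀ : IsInitialDensity ρ₀) {ρ : ℝ → Phase → I → ℝ}
  (hρ : IsWeakSolution T W D ρ₀ ρ)
include hT hW hD hρ₀ hρ

theorem dBar_le_two_pi {n m : ℕ} (hn : 0 < n) (hm : 0 < m) (u : Fin (n * m) → ℝ) {t : ℝ}
    (ht : t ∈ Set.Icc 0 T) :
    dBar (blockEmpirical n m u) (densityMeasure ρ t) ≤ ENNReal.ofReal (2 * Real.pi) := by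
  refine (lintegral_mono_ae (g := fun _ => ENNReal.ofReal (2 * Real.pi)) ?_).trans (by simp)
  filter_upwards [ae_exists_mem_block hn, hρ.isProbabilityDensity hT hW hD hρ₀] with x ⟨i, hi⟩ hx
  rw [blockEmpirical_of_mem u hi]
  have := isProbabilityMeasure_empirical hm fun j => (u (finProdFinEquiv (i, j)) : Phase)
  have := isProbabilityMeasure_densityMeasure (hx t ht).1 (hx t ht).2.1 (hx t ht).2.2
  exact dBL_le_two_pi _ _

/-- The translate D(· - u_j) is 1-Lipschitz, so its integrals against the two measures differ by at
most their distance. Replacing the weights by block averages of W costs `kernelError`, because |D| ≤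
1. -/
theorem abs_velocity_sub_le {n m : ℕ} (hn : 0 < n) (hm : 0 < m) (u : Fin (n * m) → ℝ) {t : ℝ}
    (ht : t ∈ Set.Icc 0 T) (j : Fin (n * m)) (x : I) :
    |((n * m : ℕ) : ℝ)⁻¹ * ∑ k, weight W (n * m) j k * D ((u k - u j : ℝ) : Phase)
      - velocity W D ρ t (u j) x| ≤
    (dBar (blockEmpirical n m u) (densityMeasure ρ t)).toReal + kernelError W n m j x := by
  have hfin : dBar (blockEmpirical n m u) (densityMeasure ρ t) ≠ ⊤ :=
    ne_top_of_le_ne_top ENNReal.ofReal_ne_top (dBar_le_two_pi hT hW hD hρ₀ hρ hn hm u ht)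
  set f : Phase → ℝ := fun v => D (v - (u j : Phase)) with hf
  have hfL : LipschitzWith 1 f := LipBound.lipschitzWith fun a b => by
    simpa [hf] using LipschitzWith.lipBound hD.lipschitz (a - (u j : Phase)) (b - (u j : Phase))
  set A : Fin n → ℝ := fun i => (m : ℝ)⁻¹ * ∑ b, f (u (finProdFinEquiv (i, b)) : Phase) with hA
  -- S(y) and R(y) are the integrals of f against the empirical measure and against ρ at label y.
  set S : I → ℝ := fun y => ∑ i, (block n i).indicator (fun _ => A i) y with hS
  set R : I → ℝ := fun y => ∫ v, ρ t v y * f v with hR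
  have hvel : velocity W D ρ t (u j) x = ∫ y, W x y * R y := by
    unfold velocity
    congr 1; ext y
    simp only [hR]
    rw [← integral_const_mul]
    congr 1; ext v
    simp only [hf]; ring
  have hWR : Integrable (fun y => W x y * R y) := by
    have h1 := (integrable_meanField hW hD (hρ.integrable_time hT hW hD hρ₀ ht).1
      (u j : Phase) x).integral_prod_right
    refine h1.congr (ae_of_all _ fun y => ?_)
    simp only [hR]
    rw [← integral_const_mul]
    congr 1; ext v
    simp only [hf]; ring
  have hWS_eq : ∀ y, W x y * S y = ∑ i, (block n i).indicator (fun y => W x y * A i) y := by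
    intro y
    simp only [hS, Finset.mul_sum]
    refine Finset.sum_congr rfl fun i _ => ?_
    by_cases hy : y ∈ block n i <;> simp [hy]
  have hWA : ∀ i, Integrable (fun y => W x y * A i) := fun i => (hW.integrable_right x).mul_const _
  have hWS : Integrable (fun y => W x y * S y) := by
    simp_rw [hWS_eq]
    exact integrable_finsetSum _ fun i _ => (hWA i).indicator (measurableSet_block n i)
  have hWSint : ∫ y, W x y * S y = ∑ i, (∫ y in block n i, W x y) * A i := by
    simp_rw [hWS_eq]
    rw [integral_sum_indicator_block _ hWA]
    simp_rw [integral_mul_const]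
  have h1 : |(∫ y, W x y * S y) - ∫ y, W x y * R y|
      ≤ (dBar (blockEmpirical n m u) (densityMeasure ρ t)).toReal := by
    rw [← ENNReal.ofReal_le_iff_le_toReal hfin, ← integral_sub hWS hWR, ← Real.enorm_eq_ofReal_abs]
    refine (enorm_integral_le_lintegral_enorm _).trans (lintegral_mono_ae ?_)
    filter_upwards [ae_exists_mem_block hn, hρ.isProbabilityDensity hT hW hD hρ₀] with y ⟨i, hi⟩ hy
    have e1 : S y = ∫ v, f v ∂(blockEmpirical n m u y) := by
      rw [blockEmpirical_of_mem u hi, integral_empirical]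
      exact sum_indicator_block _ hi
    have e2 : R y = ∫ v, f v ∂(densityMeasure ρ t y) :=
      (integral_densityMeasure (hρ.measurable.comp (measurable_const.prodMk
        (measurable_id.prodMk measurable_const))) (hy t ht).2.1 f).symm
    rw [← mul_sub, Real.enorm_eq_ofReal_abs, e1, e2]
    refine (ENNReal.ofReal_le_ofReal ?_).trans (le_iSup₂_of_le
      (f := fun (f : Phase → ℝ) (_ : LipschitzWith 1 f) => ENNReal.ofReal
        |(∫ v, f v ∂(blockEmpirical n m u y)) - ∫ v, f v ∂(densityMeasure ρ t y)|) f hfL le_rfl)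
    rw [abs_mul]
    exact mul_le_of_le_one_left (abs_nonneg _) (hW.abs_le_one x y)
  have h2 : |((n * m : ℕ) : ℝ)⁻¹ * ∑ k, weight W (n * m) j k * D ((u k - u j : ℝ) : Phase)
      - ∫ y, W x y * S y| ≤ kernelError W n m j x := by
    rw [hWSint, ← (finProdFinEquiv (m := n) (n := m)).sum_comp, Fintype.sum_prod_type,
      Finset.mul_sum, ← Finset.sum_sub_distrib]
    refine (Finset.abs_sum_le_sum_abs _ _).trans (Finset.sum_le_sum fun i _ => ?_)
    simp only [hA]
    rw [Finset.mul_sum, Finset.mul_sum, Finset.mul_sum, ← Finset.sum_sub_distrib]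
    refine (Finset.abs_sum_le_sum_abs _ _).trans (Finset.sum_le_sum fun b _ => ?_)
    have : ((n * m : ℕ) : ℝ)⁻¹ * (weight W (n * m) j (finProdFinEquiv (i, b)) *
          D ((u (finProdFinEquiv (i, b)) - u j : ℝ) : Phase))
        - (∫ y in block n i, W x y) * ((m : ℝ)⁻¹ * f (u (finProdFinEquiv (i, b)) : Phase))
        = (((n * m : ℕ) : ℝ)⁻¹ * weight W (n * m) j (finProdFinEquiv (i, b))
          - (m : ℝ)⁻¹ * ∫ y in block n i, W x y) * f (u (finProdFinEquiv (i, b)) : Phase) := by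
      simp only [hf, AddCircle.coe_sub]; ring
    rw [this, abs_mul]
    exact mul_le_of_le_one_right (abs_nonneg _) (hD.abs_le_one _)
  rw [hvel]
  refine (abs_sub_le _ (∫ y, W x y * S y) _).trans ?_
  linarith

/-- Grönwall's inequality through the supremum K of exp(-lt)φ(t). This needs only that φ is bounded,
and no regularity of φ in time. -/
theorem dBar_le {n m : ℕ} (hn : 0 < n) (hm : 0 < m) {u₀ : Fin (n * m) → Phase}
    {u : ℝ → Fin (n * m) → ℝ} (hu : IsKMSolution T W D (n * m) u₀ u) {s : ℝ}
    (hs : s ∈ Set.Icc 0 T) :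
    (dBar (blockEmpirical n m (u s)) (densityMeasure ρ s)).toReal ≤
      Real.exp (2 * Real.exp T * T) * (2 * Real.exp T *
        ((dBar (blockEmpirical n m (u 0)) (densityMeasure ρ 0)).toReal +
          T * ∫ x, blockKernelError W n m x)) := by
  set φ : ℝ → ℝ := fun t => (dBar (blockEmpirical n m (u t)) (densityMeasure ρ t)).toReal with hφ
  have hpi := Real.pi_pos
  have hfin : ∀ t ∈ Set.Icc 0 T, dBar (blockEmpirical n m (u t)) (densityMeasure ρ t) ≠ ⊤ :=
    fun t ht => ne_top_of_le_ne_top ENNReal.ofReal_ne_top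
      (dBar_le_two_pi hT hW hD hρ₀ hρ hn hm (u t) ht)
  have hφ0 : ∀ t, 0 ≤ φ t := fun t => ENNReal.toReal_nonneg
  have hφ2 : ∀ t ∈ Set.Icc 0 T, φ t ≤ 2 * Real.pi := fun t ht =>
    ENNReal.toReal_le_of_le_ofReal (by positivity)
      (dBar_le_two_pi hT hW hD hρ₀ hρ hn hm (u t) ht)
  -- With this l, exp(T)·K·exp(lt)/l = K·exp(lt)/2, so the weighted estimate contracts by one half
  -- and K is absorbed.
  set l := 2 * Real.exp T with hl
  have hl0 : 0 < l := by positivity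
  have h0T : (0 : ℝ) ∈ Set.Icc 0 T := ⟨le_rfl, hT.le⟩
  set Q : Set ℝ := (fun t => Real.exp (-(l * t)) * φ t) '' Set.Icc 0 T with hQ
  have hQne : Q.Nonempty := ⟨_, 0, h0T, rfl⟩
  have hQb : BddAbove Q := ⟨2 * Real.pi, by
    rintro _ ⟨t, ht, rfl⟩
    refine (mul_le_of_le_one_left (hφ0 t) ?_).trans (hφ2 t ht)
    rw [Real.exp_le_one_iff, neg_nonpos]
    exact mul_nonneg hl0.le ht.1⟩
  set K := sSup Q with hK
  have hKb : ∀ t ∈ Set.Icc 0 T, φ t ≤ K * Real.exp (l * t) := by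
    intro t ht
    have h1 : Real.exp (-(l * t)) * φ t ≤ K := le_csSup hQb ⟨t, ht, rfl⟩
    have h2 := mul_le_mul_of_nonneg_right h1 (Real.exp_pos (l * t)).le
    rwa [mul_right_comm, ← Real.exp_add, neg_add_cancel, Real.exp_zero, one_mul] at h2
  have hK0 : 0 ≤ K := (mul_nonneg (Real.exp_pos _).le (hφ0 0)).trans (le_csSup hQb ⟨0, h0T, rfl⟩)
  set Eb := ∫ x, blockKernelError W n m x with hEb
  have hEb0 : 0 ≤ Eb := integral_nonneg (blockKernelError_nonneg W n m)
  have hmain : ∀ t ∈ Set.Icc 0 T,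
      φ t ≤ Real.exp T * φ 0 + (K * Real.exp (l * t) / 2 + Real.exp T * T * Eb) := by
    intro t ht
    have hET : 0 ≤ Real.exp T * T := mul_nonneg (Real.exp_pos T).le hT.le
    have hcl : Real.exp T * (K * Real.exp (l * t) / l) = K * Real.exp (l * t) / 2 := by
      rw [hl]; field_simp
    have hstep : ∀ᵐ x : I, dBL (blockEmpirical n m (u t) x) (densityMeasure ρ t x) ≤
        ENNReal.ofReal (Real.exp T) * dBL (blockEmpirical n m (u 0) x) (densityMeasure ρ 0 x) +
        ENNReal.ofReal (K * Real.exp (l * t) / 2 + Real.exp T * T * blockKernelError W n m x) := by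
      filter_upwards [ae_exists_mem_block hn, hρ.ae_isSolutionSlice hT hW hD hρ₀] with x ⟨i, hi⟩ hx
      rw [blockEmpirical_of_mem _ hi, blockEmpirical_of_mem _ hi, ← hcl,
        show blockKernelError W n m x = (m : ℝ)⁻¹ * ∑ a : Fin m,
          kernelError W n m (finProdFinEquiv (i, a)) x from sum_indicator_block _ hi]
      have hcont : ∀ k, ContinuousOn (fun s => u s k) (Set.Icc 0 T) := fun k s hs =>
        (hu.deriv s hs k).continuousWithinAt
      refine hx.dBL_le hT hm (y := fun a s => u s (finProdFinEquiv (i, a)))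
        (fun a s hs => hu.deriv s hs _) (fun a => ?_) hK0 hl0
        (fun a => kernelError_nonneg _ _ _ _ _) (fun a s hs => ?_) ht
      · refine continuousOn_const.mul (continuousOn_finsetSum _ fun k _ => continuousOn_const.mul ?_)
        exact (hD.lipschitz.continuous.comp Phase.continuous_coe).comp_continuousOn
          ((hcont k).sub (hcont _))
      · refine (abs_velocity_sub_le hT hW hD hρ₀ hρ hn hm (u s) hs _ x).trans ?_
        exact add_le_add (hKb s hs) le_rfl
    have hi : Integrable (fun x => K * Real.exp (l * t) / 2 +
        Real.exp T * T * blockKernelError W n m x) :=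
      (integrable_const _).add ((integrable_blockKernelError hW n m).const_mul _)
    have h1 : dBar (blockEmpirical n m (u t)) (densityMeasure ρ t) ≤
        ENNReal.ofReal (Real.exp T) * dBar (blockEmpirical n m (u 0)) (densityMeasure ρ 0) +
        ENNReal.ofReal (K * Real.exp (l * t) / 2 + Real.exp T * T * Eb) := by
      refine (lintegral_mono_ae hstep).trans (le_of_eq ?_)
      -- Only the second summand has to be measurable in x, and the constant factor leaves the
      -- integral because it is finite. Measurability of x ↦ d(μ^x, η^x) is not needed.
      rw [lintegral_add_right' _ hi.aestronglyMeasurable.aemeasurable.ennreal_ofReal,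
        lintegral_const_mul' _ _ ENNReal.ofReal_ne_top,
        ← ofReal_integral_eq_lintegral_ofReal hi (ae_of_all _ fun x =>
          add_nonneg (by positivity) (mul_nonneg hET (blockKernelError_nonneg W n m x))),
        integral_add (integrable_const _) ((integrable_blockKernelError hW n m).const_mul _),
        integral_const_mul]
      simp [dBar, hEb]
    have h2 := ENNReal.toReal_mono (ENNReal.add_ne_top.2
      ⟨ENNReal.mul_ne_top ENNReal.ofReal_ne_top (hfin 0 h0T), ENNReal.ofReal_ne_top⟩) h1
    rwa [ENNReal.toReal_add (ENNReal.mul_ne_top ENNReal.ofReal_ne_top (hfin 0 h0T))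
      ENNReal.ofReal_ne_top, ENNReal.toReal_mul, ENNReal.toReal_ofReal (Real.exp_pos T).le,
      ENNReal.toReal_ofReal (add_nonneg (by positivity) (mul_nonneg hET hEb0))] at h2
  have hKle : K ≤ Real.exp T * φ 0 + Real.exp T * T * Eb + K / 2 := by
    refine csSup_le hQne ?_
    rintro _ ⟨t, ht, rfl⟩
    have h1 := mul_le_mul_of_nonneg_left (hmain t ht) (Real.exp_pos (-(l * t))).le
    refine h1.trans ?_
    have h2 : Real.exp (-(l * t)) ≤ 1 := by
      rw [Real.exp_le_one_iff, neg_nonpos]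
      exact mul_nonneg hl0.le ht.1
    have h3 : Real.exp (-(l * t)) * (K * Real.exp (l * t) / 2) = K / 2 := by
      have : Real.exp (-(l * t)) * Real.exp (l * t) = 1 := by
        rw [← Real.exp_add, neg_add_cancel, Real.exp_zero]
      linear_combination (K / 2) * this
    have h4 : 0 ≤ Real.exp T * φ 0 + Real.exp T * T * Eb := by
      have := hφ0 0
      have := hT.le
      positivity
    have h5 := mul_le_of_le_one_left h4 h2
    calc Real.exp (-(l * t)) * (Real.exp T * φ 0 + (K * Real.exp (l * t) / 2 + Real.exp T * T * Eb))
        = Real.exp (-(l * t)) * (Real.exp T * φ 0 + Real.exp T * T * Eb)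
          + Real.exp (-(l * t)) * (K * Real.exp (l * t) / 2) := by ring
      _ ≤ _ := by rw [h3]; linarith
  have hKfin : K ≤ 2 * Real.exp T * (φ 0 + T * Eb) := by linarith
  refine (hKb s hs).trans ?_
  rw [mul_comm]
  have hexp : Real.exp (l * s) ≤ Real.exp (l * T) :=
    Real.exp_le_exp.2 (mul_le_mul_of_nonneg_left hs.2 hl0.le)
  exact mul_le_mul hexp hKfin hK0 (Real.exp_pos _).le

end Stability

/-! ### The averaged weights approximate the graphon -/

theorem sum_setIntegral_block {n : ℕ} (hn : 0 < n) {F : I → ℝ} (hF : Integrable F) :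
    ∑ i : Fin n, ∫ x in block n i, F x = ∫ x, F x := by
  rw [← integral_sum_indicator_block (fun _ => F) fun _ => hF]
  refine integral_congr_ae ?_
  filter_upwards [ae_exists_mem_block hn] with x ⟨i, hi⟩
  exact sum_indicator_block _ hi

theorem dist_lt_of_mem_block {n : ℕ} {i : Fin n} {x y : I} (hx : x ∈ block n i)
    (hy : y ∈ block n i) : dist x y < 1 / n := by
  have hn : (0 : ℝ) < n := by exact_mod_cast i.pos
  obtain ⟨h1, h2⟩ := hx
  obtain ⟨h3, h4⟩ := hy
  have : ((i : ℝ) + 1) / n = i / n + 1 / n := by ring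
  rw [Subtype.dist_eq, Real.dist_eq, abs_lt]
  constructor <;> linarith

theorem sum_setIntegral_block_prod {n : ℕ} (hn : 0 < n) {G : I × I → ℝ} (hG : Integrable G) :
    ∑ j : Fin n, ∑ k : Fin n, ∫ p in block n j ×ˢ block n k, G p = ∫ p, G p := by
  have hG' : Integrable G (volume.prod volume) := hG
  have h1 : ∀ j k : Fin n, ∫ p in block n j ×ˢ block n k, G p
      = ∫ x in block n j, ∫ y in block n k, G (x, y) := fun j k => by
    rw [Measure.volume_eq_prod, setIntegral_prod _ hG'.integrableOn]
  have h2 : ∀ k : Fin n, Integrable (fun x => ∫ y in block n k, G (x, y)) := fun k => by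
    have : Integrable G (volume.prod (volume.restrict (block n k))) := by
      have := hG'.restrict (s := Set.univ ×ˢ block n k)
      rwa [← Measure.prod_restrict, Measure.restrict_univ] at this
    exact this.integral_prod_left
  simp_rw [h1]
  rw [Finset.sum_comm]
  simp_rw [sum_setIntegral_block hn (h2 _)]
  rw [← integral_finsetSum _ fun k _ => h2 k, Measure.volume_eq_prod, integral_prod _ hG']
  refine integral_congr_ae ?_
  filter_upwards [hG'.prod_right_ae] with x hx
  exact sum_setIntegral_block hn hx

theorem abs_weight_sub_le {W : I → I → ℝ} (hW : IsGraphon W) {G : I × I → ℝ} (hG : Integrable G)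
    {n : ℕ} {j k : Fin n} {c : ℝ} (h : ∀ x ∈ block n j, ∀ y ∈ block n k, |W x y - c| ≤ G (x, y)) :
    |(n : ℝ)⁻¹ * weight W n j k - (n : ℝ)⁻¹ * c| ≤ n * ∫ p in block n j ×ˢ block n k, G p := by
  have hn : (0 : ℝ) < n := by exact_mod_cast j.pos
  have hms : MeasurableSet (block n j ×ˢ block n k) :=
    (measurableSet_block n j).prod (measurableSet_block n k)
  have hWi : Integrable (fun p : I × I => W p.1 p.2) :=
    Integrable.of_bound hW.measurable.aestronglyMeasurable 1
      (ae_of_all _ fun p => hW.abs_le_one p.1 p.2)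
  have hvol : (volume : Measure (I × I)).real (block n j ×ˢ block n k) = (n : ℝ)⁻¹ * (n : ℝ)⁻¹ := by
    rw [Measure.volume_eq_prod, measureReal_prod_prod, volume_real_block, volume_real_block]
  have e : (n : ℝ)⁻¹ * weight W n j k - (n : ℝ)⁻¹ * c
      = n * ∫ p in block n j ×ˢ block n k, (W p.1 p.2 - c) := by
    rw [integral_sub hWi.integrableOn (integrable_const _), setIntegral_const, hvol, weight,
      smul_eq_mul]
    field_simp
  rw [e, abs_mul, abs_of_pos hn]
  refine mul_le_mul_of_nonneg_left ?_ hn.le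
  refine abs_integral_le_of_abs_le hG.integrableOn ?_
  exact (ae_restrict_iff' hms).2 (ae_of_all _ fun p hp => h p.1 hp.1 p.2 hp.2)

theorem abs_setIntegral_sub_le {W : I → I → ℝ} (hW : IsGraphon W) {G : I × I → ℝ} {x : I}
    (hG : Integrable fun y => G (x, y)) {n : ℕ} {i : Fin n} {c : ℝ}
    (h : ∀ y ∈ block n i, |W x y - c| ≤ G (x, y)) :
    |(n : ℝ)⁻¹ * c - ∫ y in block n i, W x y| ≤ ∫ y in block n i, G (x, y) := by
  have e : (n : ℝ)⁻¹ * c - ∫ y in block n i, W x y = -∫ y in block n i, (W x y - c) := by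
    rw [integral_sub (hW.integrable_right x).integrableOn (integrable_const _), setIntegral_const,
      volume_real_block, smul_eq_mul]
    ring
  rw [e, abs_neg]
  exact abs_integral_le_of_abs_le hG.integrableOn
    ((ae_restrict_iff' (measurableSet_block n i)).2 (ae_of_all _ h))

/-- Both the fine weights and the block averages of W are compared with the same step values c. Each
comparison costs ∫G, independently of m. -/
theorem integral_blockKernelError_le {W : I → I → ℝ} (hW : IsGraphon W) {G : I × I → ℝ}
    (hG : Integrable G) (hGx : ∀ x, Integrable fun y => G (x, y)) {n m : ℕ} (hn : 0 < n)
    (hm : 0 < m) {c : Fin n → Fin n → ℝ}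
    (h : ∀ i k, ∀ x ∈ block n i, ∀ y ∈ block n k, |W x y - c i k| ≤ G (x, y)) :
    ∫ x, blockKernelError W n m x ≤ 2 * ∫ p, G p := by
  have hn0 : (0 : ℝ) < n := by exact_mod_cast hn
  have hm0 : (0 : ℝ) < m := by exact_mod_cast hm
  set e := finProdFinEquiv (m := n) (n := m) with he
  -- The share of the weights does not depend on x within the block, and sums to ∫G because the fine
  -- cells tile the square.
  set C : Fin n → ℝ := fun i => (m : ℝ)⁻¹ * ∑ a : Fin m, ∑ k : Fin n, ∑ b : Fin m,
    ((n * m : ℕ) : ℝ) * ∫ p in block (n * m) (e (i, a)) ×ˢ block (n * m) (e (k, b)), G p with hC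
  have hpt : ∀ (i : Fin n), ∀ x ∈ block n i,
      blockKernelError W n m x ≤ C i + ∫ y, G (x, y) := by
    intro i x hx
    rw [show blockKernelError W n m x = (m : ℝ)⁻¹ * ∑ a : Fin m,
      kernelError W n m (e (i, a)) x from sum_indicator_block _ hx]
    -- The trivial averages over a and b give this term the same index set as the weights.
    have hsec : ∫ y, G (x, y) = (m : ℝ)⁻¹ * ∑ a : Fin m, ∑ k : Fin n, ∑ b : Fin m,
        (m : ℝ)⁻¹ * ∫ y in block n k, G (x, y) := by
      simp only [Finset.sum_const, Finset.card_univ, Fintype.card_fin, nsmul_eq_mul]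
      rw [← sum_setIntegral_block hn (hGx x)]
      simp_rw [← mul_assoc]
      rw [inv_mul_cancel₀ hm0.ne', one_mul]
      simp [hm0.ne']
    rw [hsec, hC, ← mul_add]
    refine mul_le_mul_of_nonneg_left ?_ (inv_pos.2 hm0).le
    simp_rw [← Finset.sum_add_distrib]
    refine Finset.sum_le_sum fun a _ => Finset.sum_le_sum fun k _ => Finset.sum_le_sum fun b _ => ?_
    have h1 := abs_weight_sub_le hW hG (n := n * m) (j := e (i, a)) (k := e (k, b)) (c := c i k)
      fun x hx y hy => h i k x (block_subset n m i a hx) y (block_subset n m k b hy)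
    have h2 := abs_setIntegral_sub_le hW (hGx x) (n := n) (i := k) (c := c i k)
      fun y hy => h i k x hx y hy
    have h3 := mul_le_mul_of_nonneg_left h2 (inv_pos.2 hm0).le
    rw [← abs_of_pos (inv_pos.2 hm0), ← abs_mul, abs_of_pos (inv_pos.2 hm0), mul_sub, ← mul_assoc,
      ← mul_inv, mul_comm (m : ℝ) n, ← Nat.cast_mul] at h3
    exact (abs_sub_le _ _ _).trans (add_le_add h1 h3)
  have hGl : Integrable (fun x => ∫ y, G (x, y)) :=
    Integrable.integral_prod_left (f := G) (μ := volume) (ν := volume) hG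
  have hstep : Integrable (fun x => ∑ i, (block n i).indicator (fun _ => C i) x) :=
    integrable_finsetSum _ fun i _ => (integrable_const _).indicator (measurableSet_block n i)
  calc ∫ x, blockKernelError W n m x
      ≤ ∫ x, (∑ i, (block n i).indicator (fun _ => C i) x + ∫ y, G (x, y)) := by
        refine integral_mono_ae (integrable_blockKernelError hW n m) (hstep.add hGl) ?_
        filter_upwards [ae_exists_mem_block hn] with x ⟨i, hi⟩
        rw [sum_indicator_block _ hi]
        exact hpt i x hi
    _ = ∑ i, (n : ℝ)⁻¹ * C i + ∫ p, G p := by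
        rw [integral_add hstep hGl, integral_sum_indicator_block _ fun i => integrable_const _,
          Measure.volume_eq_prod I I, integral_prod G hG]
        simp_rw [setIntegral_const, volume_real_block, smul_eq_mul]
    _ = 2 * ∫ p, G p := by
        have : ∑ i, (n : ℝ)⁻¹ * C i = ∫ p, G p := by
          rw [← sum_setIntegral_block_prod (Nat.mul_pos hn hm) hG, ← e.sum_comp,
            Fintype.sum_prod_type]
          refine Finset.sum_congr rfl fun i _ => ?_
          simp only [hC]
          rw [← mul_assoc, Finset.mul_sum]
          refine Finset.sum_congr rfl fun a _ => ?_
          rw [← e.sum_comp, Fintype.sum_prod_type, Finset.mul_sum]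
          refine Finset.sum_congr rfl fun k _ => ?_
          rw [Finset.mul_sum]
          refine Finset.sum_congr rfl fun b _ => ?_
          push_cast
          field_simp
        rw [this]; ring

/-- Continuous functions are dense in L¹, and a continuous F on the square is uniformly close to its
values at points chosen in the blocks. The bound is 2(η/4 + η/4) = η. -/
theorem exists_integral_blockKernelError_le {W : I → I → ℝ} (hW : IsGraphon W) {η : ℝ}
    (hη : 0 < η) : ∃ n₀ : ℕ, ∀ n ≥ n₀, 0 < n → ∀ m, 0 < m →
      ∫ x, blockKernelError W n m x ≤ η := by
  have hWi : Integrable (fun p : I × I => W p.1 p.2) :=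
    Integrable.of_bound hW.measurable.aestronglyMeasurable 1
      (ae_of_all _ fun p => hW.abs_le_one p.1 p.2)
  obtain ⟨F, hFs, hFW, hFc, hFi⟩ := hWi.exists_hasCompactSupport_integral_sub_le
    (show 0 < η / 4 by positivity)
  have huc : UniformContinuous F := CompactSpace.uniformContinuous_of_continuous hFc
  obtain ⟨δ, hδ, hFδ⟩ := Metric.uniformContinuous_iff.1 huc (η / 4) (by positivity)
  obtain ⟨n₀, hn₀⟩ := exists_nat_gt (1 / δ)
  refine ⟨n₀, fun n hn hn0 m hm => ?_⟩
  have hn0' : (0 : ℝ) < n := by exact_mod_cast hn0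
  have hnδ : 1 / (n : ℝ) < δ := by
    rw [div_lt_comm₀ hn0' hδ]
    exact hn₀.trans_le (by exact_mod_cast hn)
  set G : I × I → ℝ := fun p => |W p.1 p.2 - F p| + η / 4 with hG
  have hGi : Integrable G := (hWi.sub hFi).abs.add (integrable_const _)
  have hGx : ∀ x, Integrable fun y => G (x, y) := fun x => by
    have hFx : Continuous fun y => F (x, y) := hFc.comp (continuous_const.prodMk continuous_id)
    obtain ⟨K, hK⟩ := isCompact_univ.exists_bound_of_continuousOn hFx.continuousOn
    have hFxi : Integrable fun y => F (x, y) := Integrable.of_bound hFx.aestronglyMeasurable K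
      (ae_of_all _ fun y => hK y (Set.mem_univ y))
    exact ((hW.integrable_right x).sub hFxi).abs.add (integrable_const _)
  have hpt : ∀ i : Fin n, ∃ x, x ∈ block n i := fun i => by
    by_contra hne
    have h0 := volume_real_block n i
    rw [Set.eq_empty_iff_forall_notMem.2 (not_exists.1 hne), measureReal_empty] at h0
    exact (inv_pos.2 hn0').ne h0
  choose z hz using hpt
  refine (integral_blockKernelError_le hW hGi hGx hn0 hm (c := fun i k => F (z i, z k))
    fun i k x hx y hy => ?_).trans ?_
  · have h1 := hFδ (a := (x, y)) (b := (z i, z k)) (max_lt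
      ((dist_lt_of_mem_block hx (hz i)).trans hnδ) ((dist_lt_of_mem_block hy (hz k)).trans hnδ))
    rw [Real.dist_eq] at h1
    have h2 := abs_sub_le (W x y) (F (x, y)) (F (z i, z k))
    simp only [hG]
    linarith
  · have : ∫ p, G p = (∫ p : I × I, |W p.1 p.2 - F p|) + η / 4 := by
      have hWF : Integrable fun p : I × I => |W p.1 p.2 - F p| := (hWi.sub hFi).abs
      simp only [hG]
      rw [integral_add hWF (integrable_const _)]
      simp
    rw [this]
    have h3 : ∫ p : I × I, |W p.1 p.2 - F p| ≤ η / 4 := hFW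
    linarith

/-! ### Finitely many test functions -/

/-- Arzelà–Ascoli. The normalisation f(0) = 0 costs nothing, since constants cancel in differences
of probability measures. -/
theorem exists_finite_net {η : ℝ} (hη : 0 < η) : ∃ S : Finset (Phase → ℝ),
    (∀ f ∈ S, LipschitzWith 1 f ∧ ∀ u, |f u| ≤ Real.pi) ∧
    ∀ f : Phase → ℝ, LipschitzWith 1 f → f 0 = 0 → ∃ g ∈ S, ∀ u, |f u - g u| ≤ η := by
  classical
  set A : Set (BoundedContinuousFunction Phase ℝ) := {f | LipschitzWith 1 f ∧ f 0 = 0} with hA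
  have hbd : ∀ f : Phase → ℝ, LipschitzWith 1 f → f 0 = 0 → ∀ u, |f u| ≤ Real.pi := by
    intro f hf h0 u
    have := LipschitzWith.lipBound hf u 0
    rw [h0, sub_zero, one_mul] at this
    exact this.trans (Phase.dist_le u 0)
  have hcomp : IsCompact (closure A) := by
    refine BoundedContinuousFunction.arzela_ascoli (Set.Icc (-Real.pi) Real.pi) isCompact_Icc A
      (fun f u hf => abs_le.1 (hbd f hf.1 hf.2 u)) ?_
    exact (LipschitzWith.uniformEquicontinuous _ 1 fun f => f.2.1).equicontinuous
  obtain ⟨t, htA, htf, ht⟩ := Metric.finite_approx_of_totallyBounded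
    (hcomp.totallyBounded.subset subset_closure) η hη
  refine ⟨Finset.image (fun f : BoundedContinuousFunction Phase ℝ => (f : Phase → ℝ)) htf.toFinset, ?_, fun f hf h0 => ?_⟩
  · intro f hf
    obtain ⟨g, hg, rfl⟩ := Finset.mem_image.1 hf
    have hgA := htA (htf.mem_toFinset.1 hg)
    exact ⟨hgA.1, hbd g hgA.1 hgA.2⟩
  · have hmem : BoundedContinuousFunction.mkOfCompact (⟨f, hf.continuous⟩ : C(Phase, ℝ)) ∈ A :=
      ⟨hf, h0⟩
    obtain ⟨g, hg, hfg⟩ := Set.mem_iUnion₂.1 (ht hmem)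
    refine ⟨g, Finset.mem_image_of_mem _ (htf.mem_toFinset.2 hg), fun u => ?_⟩
    exact (BoundedContinuousFunction.dist_coe_le_dist (f := BoundedContinuousFunction.mkOfCompact
      (⟨f, hf.continuous⟩ : C(Phase, ℝ))) (g := g) u).trans (Metric.mem_ball.1 hfg).le

theorem dBL_le_sum_of_net {η : ℝ} {S : Finset (Phase → ℝ)} (hS : ∀ f ∈ S, LipschitzWith 1 f)
    (hnet : ∀ f : Phase → ℝ, LipschitzWith 1 f → f 0 = 0 → ∃ g ∈ S, ∀ u, |f u - g u| ≤ η)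
    (μ ν : Measure Phase) [IsProbabilityMeasure μ] [IsProbabilityMeasure ν] :
    dBL μ ν ≤ ENNReal.ofReal (2 * η + ∑ g ∈ S, |(∫ v, g v ∂μ) - ∫ v, g v ∂ν|) := by
  refine iSup₂_le fun f hf => ENNReal.ofReal_le_ofReal ?_
  have hint : ∀ (ν : Measure Phase) [IsProbabilityMeasure ν], Integrable f ν := fun ν _ => by
    obtain ⟨K, hK⟩ := isCompact_univ.exists_bound_of_continuousOn hf.continuous.continuousOn
    exact Integrable.of_bound hf.continuous.aestronglyMeasurable K
      (ae_of_all _ fun u => hK u (Set.mem_univ u))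
  have hf' : LipschitzWith 1 fun u => f u - f 0 := LipBound.lipschitzWith fun u v => by
    simpa using LipschitzWith.lipBound hf u v
  obtain ⟨g, hg, hfg⟩ := hnet _ hf' (sub_self _)
  have h1 := abs_integral_sub_le_of_dist (μ := μ) (η := ν) hf'.continuous (hS g hg).continuous hfg
  have h2 := Finset.single_le_sum (f := fun g : Phase → ℝ => |(∫ v, g v ∂μ) - ∫ v, g v ∂ν|)
    (fun g _ => abs_nonneg _) hg
  rw [integral_sub (hint μ) (integrable_const _), integral_sub (hint ν) (integrable_const _)] at h1
  simp only [integral_const, probReal_univ, one_smul, sub_sub_sub_cancel_right] at h1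
  linarith

/-! ### Riemann sums -/

theorem exists_mem_Icc_of_partition {k : ℕ} {p : Fin (k + 1) → I} (h0 : p 0 = 0)
    (h1 : p (Fin.last k) = 1) (x : I) : ∃ l : Fin k, x ∈ Set.Icc (p l.castSucc) (p l.succ) := by
  classical
  have hk : 0 < k := by
    rcases Nat.eq_zero_or_pos k with rfl | h
    · exact absurd (h0.symm.trans h1) zero_ne_one
    · exact h
  have hne : (Finset.univ.filter fun l : Fin k => p l.castSucc ≤ x).Nonempty :=
    ⟨⟨0, hk⟩, by
      simp only [Finset.mem_filter, Finset.mem_univ, true_and]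
      rw [show (⟨0, hk⟩ : Fin k).castSucc = 0 from rfl, h0]
      exact x.2.1⟩
  -- The last index whose left endpoint does not exceed x.
  obtain ⟨l, hl, hmax⟩ := Finset.exists_max_image _ (fun l : Fin k => l) hne
  simp only [Finset.mem_filter, Finset.mem_univ, true_and] at hl hmax
  refine ⟨l, hl, ?_⟩
  by_cases hlk : (l : ℕ) + 1 < k
  · by_contra hx
    have h2 := hmax ⟨l + 1, hlk⟩ (not_le.1 hx).le
    have h3 : (l : ℕ) + 1 ≤ l := h2
    omega
  · have : l.succ = Fin.last k := Fin.ext (by simp; omega)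
    rw [this, h1]
    exact x.2.2

theorem abs_node_sub_le {n m : ℕ} {i : Fin n} (a : Fin m) {x : I} (hx : x ∈ block n i) :
    |((node (n * m) (finProdFinEquiv (i, a)) : I) : ℝ) - x| ≤ 1 / n := by
  have hn : (0 : ℝ) < n := by exact_mod_cast i.pos
  have hm : (0 : ℝ) < m := by exact_mod_cast a.pos
  have ha : (a : ℝ) + 1 ≤ m := by exact_mod_cast a.isLt
  have ha0 : (0 : ℝ) ≤ a := by positivity
  obtain ⟨h1, h2⟩ := hx
  have hv : ((node (n * m) (finProdFinEquiv (i, a)) : I) : ℝ) = i / n + ((a : ℝ) + 1) / (n * m) := by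
    simp only [node, finProdFinEquiv_apply_val, Nat.cast_add, Nat.cast_mul]
    field_simp
    ring
  have h3 : ((a : ℝ) + 1) / (n * m) ≤ 1 / n := by
    rw [div_le_div_iff₀ (by positivity) hn]
    nlinarith
  have h4 : 0 ≤ ((a : ℝ) + 1) / (n * m) := by positivity
  have h5 : ((i : ℝ) + 1) / n = i / n + 1 / n := by ring
  rw [hv, abs_le]
  constructor <;> linarith

theorem volume_real_near_le (p : I) {r : ℝ} (hr : 0 ≤ r) :
    (volume : Measure I).real {x : I | |(x : ℝ) - p| ≤ r} ≤ 2 * r := by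
  refine ENNReal.toReal_le_of_le_ofReal (by positivity) ?_
  rw [unitInterval.volume_apply]
  have : Subtype.val '' {x : I | |(x : ℝ) - p| ≤ r} ⊆ Set.Icc ((p : ℝ) - r) (p + r) := by
    rintro _ ⟨x, hx, rfl⟩
    have := abs_le.1 (show |(x : ℝ) - p| ≤ r from hx)
    constructor <;> linarith [this.1, this.2]
  refine (measure_mono this).trans (le_of_eq ?_)
  rw [Real.volume_Icc]
  congr 1; ring

/-- If x and y lie in one partition interval, |g(y)-g(x)| is at most the Darboux gap there.
Otherwise a partition point is within 1/n of x, and 2B is paid on a set of measure O(1/n). All nodes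
of a block are within 1/n of x, hence the uniformity in m. -/
theorem RiemannIntegrable.exists_average_le {g : I → ℝ} (hg : RiemannIntegrable g)
    (hgm : Measurable g) {B : ℝ} (hB : 0 ≤ B) (hgB : ∀ x, |g x| ≤ B) {ε : ℝ} (hε : 0 < ε) :
    ∃ n₀ : ℕ, ∀ n ≥ n₀, 0 < n → ∀ m : ℕ, 0 < m →
      ∑ i : Fin n, ∫ x in block n i, |(m : ℝ)⁻¹ *
        ∑ a : Fin m, g (node (n * m) (finProdFinEquiv (i, a))) - g x| ≤ ε := by
  obtain ⟨k, p, lo, hi, hp, hp0, hp1, hlohi, hsum⟩ := hg (ε / 2) (by positivity)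
  -- The k+1 neighbourhoods of partition points have measure at most 2/n each and weight 2B, so
  -- together they cost 4B(k+1)/n ≤ ε/2.
  obtain ⟨n₀, hn₀⟩ := exists_nat_gt (8 * B * (k + 1) / ε)
  refine ⟨n₀, fun n hn hn0 m hm => ?_⟩
  have hn0' : (0 : ℝ) < n := by exact_mod_cast hn0
  have hm0' : (0 : ℝ) < m := by exact_mod_cast hm
  have hle : ∀ l : Fin k, lo l ≤ hi l := fun l =>
    (hlohi l _ (Set.left_mem_Icc.2 (hp l.castSucc_le_succ))).1.trans
      (hlohi l _ (Set.left_mem_Icc.2 (hp l.castSucc_le_succ))).2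
  set J : Fin k → Set I := fun l => Set.Icc (p l.castSucc) (p l.succ) with hJ
  set Z : Fin (k + 1) → Set I := fun l => {x : I | |(x : ℝ) - p l| ≤ 1 / n} with hZ
  have hZm : ∀ l, MeasurableSet (Z l) := fun l =>
    measurableSet_le (by fun_prop) measurable_const
  set F : I → ℝ := fun x => ∑ l, (J l).indicator (fun _ => hi l - lo l) x +
    ∑ l, (Z l).indicator (fun _ => 2 * B) x with hF
  have hF1 : ∀ l x, 0 ≤ (J l).indicator (fun _ => hi l - lo l) x := fun l x =>
    Set.indicator_nonneg (fun _ _ => sub_nonneg.2 (hle l)) x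
  have hF2 : ∀ l x, 0 ≤ (Z l).indicator (fun _ => 2 * B) x := fun l x =>
    Set.indicator_nonneg (fun _ _ => by positivity) x
  have hosc : ∀ x y : I, |(y : ℝ) - x| ≤ 1 / n → |g y - g x| ≤ F x := by
    intro x y hxy
    obtain ⟨l, hl⟩ := exists_mem_Icc_of_partition hp0 hp1 x
    by_cases hy : y ∈ Set.Icc (p l.castSucc) (p l.succ)
    · have h1 := hlohi l x hl
      have h2 := hlohi l y hy
      have h3 : |g y - g x| ≤ hi l - lo l := by
        rw [abs_le]; constructor <;> linarith [h1.1, h1.2, h2.1, h2.2]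
      have h4 := Finset.single_le_sum (f := fun l => (J l).indicator (fun _ => hi l - lo l) x)
        (fun l _ => hF1 l x) (Finset.mem_univ l)
      rw [Set.indicator_of_mem hl] at h4
      have h5 : 0 ≤ ∑ l, (Z l).indicator (fun _ => 2 * B) x :=
        Finset.sum_nonneg fun l _ => hF2 l x
      simp only [hF]
      linarith
    · have h3 : |g y - g x| ≤ 2 * B := by
        have := abs_sub (g y) (g x)
        linarith [hgB x, hgB y]
      have h6 : ∃ j, x ∈ Z j := by
        have e := abs_le.1 hxy
        have hl1 : ((p l.castSucc : I) : ℝ) ≤ x := hl.1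
        have hl2 : (x : ℝ) ≤ p l.succ := hl.2
        rw [Set.mem_Icc, not_and_or, not_le, not_le] at hy
        rcases hy with hy | hy
        · have hy' : (y : ℝ) < p l.castSucc := hy
          refine ⟨l.castSucc, show |(x : ℝ) - p l.castSucc| ≤ 1 / n from ?_⟩
          rw [abs_le]; constructor <;> linarith [e.1, e.2]
        · have hy' : ((p l.succ : I) : ℝ) < y := hy
          refine ⟨l.succ, show |(x : ℝ) - p l.succ| ≤ 1 / n from ?_⟩
          rw [abs_le]; constructor <;> linarith [e.1, e.2]
      obtain ⟨j, hj⟩ := h6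
      have h4 := Finset.single_le_sum (f := fun l => (Z l).indicator (fun _ => 2 * B) x)
        (fun l _ => hF2 l x) (Finset.mem_univ j)
      rw [Set.indicator_of_mem hj] at h4
      have h5 : 0 ≤ ∑ l, (J l).indicator (fun _ => hi l - lo l) x :=
        Finset.sum_nonneg fun l _ => hF1 l x
      simp only [hF]
      linarith
  have hI1 : ∀ l, Integrable ((J l).indicator fun _ => hi l - lo l) := fun l =>
    (integrable_const _).indicator measurableSet_Icc
  have hI2 : ∀ l, Integrable ((Z l).indicator fun _ => 2 * B) := fun l =>
    (integrable_const _).indicator (hZm l)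
  have hFi : Integrable F :=
    (integrable_finsetSum _ fun l _ => hI1 l).add (integrable_finsetSum _ fun l _ => hI2 l)
  have hgi : Integrable g := Integrable.of_bound hgm.aestronglyMeasurable B (ae_of_all _ hgB)
  have hFint : ∫ x, F x ≤ ε := by
    simp only [hF]
    rw [integral_add (integrable_finsetSum _ fun l _ => hI1 l)
      (integrable_finsetSum _ fun l _ => hI2 l), integral_finsetSum _ fun l _ => hI1 l,
      integral_finsetSum _ fun l _ => hI2 l]
    have e1 : ∀ l : Fin k, ∫ x, (J l).indicator (fun _ => hi l - lo l) x
        = (hi l - lo l) * ((p l.succ : ℝ) - p l.castSucc) := fun l => by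
      have hpl : ((p l.castSucc : I) : ℝ) ≤ p l.succ := hp l.castSucc_le_succ
      rw [integral_indicator measurableSet_Icc, setIntegral_const, measureReal_def,
        unitInterval.volume_Icc, ENNReal.toReal_ofReal (by linarith), smul_eq_mul, mul_comm]
    have e2 : ∀ l, ∫ x, (Z l).indicator (fun _ => 2 * B) x ≤ 4 * B / n := fun l => by
      rw [integral_indicator (hZm l), setIntegral_const, smul_eq_mul]
      have := mul_le_mul_of_nonneg_right (volume_real_near_le (p l) (r := 1 / n) (by positivity))
        (show 0 ≤ 2 * B by positivity)
      refine this.trans (le_of_eq ?_)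
      field_simp
      ring
    have e3 : ∑ l, ∫ x, (Z l).indicator (fun _ => 2 * B) x ≤ (k + 1 : ℕ) * (4 * B / n) := by
      refine (Finset.sum_le_sum fun l _ => e2 l).trans (le_of_eq ?_)
      simp
    have e4 : ((k + 1 : ℕ) : ℝ) * (4 * B / n) ≤ ε / 2 := by
      have hnn : (n₀ : ℝ) ≤ n := by exact_mod_cast hn
      have h1 := hn₀.trans_le hnn
      rw [div_lt_iff₀ hε] at h1
      rw [← mul_div_assoc, div_le_div_iff₀ hn0' (by norm_num)]
      push_cast
      linarith
    simp_rw [e1]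
    linarith
  refine le_trans ?_ hFint
  rw [← sum_setIntegral_block hn0 hFi]
  refine Finset.sum_le_sum fun i _ => ?_
  refine setIntegral_mono_on ((integrable_const _).sub hgi).abs.integrableOn hFi.integrableOn
    (measurableSet_block n i) fun x hx => ?_
  have e : (m : ℝ)⁻¹ * ∑ a : Fin m, g (node (n * m) (finProdFinEquiv (i, a))) - g x
      = (m : ℝ)⁻¹ * ∑ a : Fin m, (g (node (n * m) (finProdFinEquiv (i, a))) - g x) := by
    rw [Finset.sum_sub_distrib]
    simp only [Finset.sum_const, Finset.card_univ, Fintype.card_fin, nsmul_eq_mul]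
    field_simp
  rw [e, abs_mul, abs_of_pos (inv_pos.2 hm0')]
  have h1 : |∑ a : Fin m, (g (node (n * m) (finProdFinEquiv (i, a))) - g x)| ≤ m * F x := by
    refine (Finset.abs_sum_le_sum_abs _ _).trans ?_
    refine (Finset.sum_le_sum fun a _ => hosc x _ (abs_node_sub_le a hx)).trans (le_of_eq ?_)
    simp
  calc _ ≤ (m : ℝ)⁻¹ * (m * F x) := mul_le_mul_of_nonneg_left h1 (inv_pos.2 hm0').le
    _ = F x := by field_simp

/-! ### Concentration of the initial phases -/

section Concentration

variable {Ω : Type*} [MeasurableSpace Ω] {P : Measure Ω} [IsProbabilityMeasure P]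

/-- A sum of n absolute values is a maximum over 2^n sign patterns. For fixed signs the sum has nm
independent centred terms, and Hoeffding's inequality applies. The rate is proportional to nm rather
than m, which makes a bound uniform in n possible. -/
theorem measure_average_abs_ge_le {n m : ℕ} (hn : 0 < n) (hm : 0 < m)
    {U : Fin (n * m) → Ω → Phase} (hU : ∀ k, Measurable (U k)) (hind : iIndepFun U P)
    {f : Phase → ℝ} (hf : Measurable f) {B : ℝ} (hB : 0 < B) (hfB : ∀ u, |f u| ≤ B)
    {δ : ℝ} (hδ : 0 < δ) :
    P {ω | δ ≤ (n : ℝ)⁻¹ * ∑ i : Fin n, |(m : ℝ)⁻¹ * ∑ a : Fin m,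
        (f (U (finProdFinEquiv (i, a)) ω) - ∫ ω, f (U (finProdFinEquiv (i, a)) ω) ∂P)|} ≤
      ENNReal.ofReal (2 ^ n * Real.exp (-(δ ^ 2 / (2 * B ^ 2)) * (n * m))) := by
  have hn0 : (0 : ℝ) < n := by exact_mod_cast hn
  have hm0 : (0 : ℝ) < m := by exact_mod_cast hm
  set e := finProdFinEquiv (m := n) (n := m) with he
  let sg : Bool → ℝ := fun b => if b then 1 else -1
  have hsg : ∀ b, |sg b| = 1 := fun b => by cases b <;> simp [sg]
  let E : Fin (n * m) → ℝ := fun k => ∫ ω, f (U k ω) ∂P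
  let X : (Fin n → Bool) → Fin (n * m) → Ω → ℝ := fun s k ω =>
    sg (s (e.symm k).1) * f (U k ω) - ∫ ω, sg (s (e.symm k).1) * f (U k ω) ∂P
  have hsub : {ω | δ ≤ (n : ℝ)⁻¹ * ∑ i : Fin n, |(m : ℝ)⁻¹ * ∑ a : Fin m,
        (f (U (e (i, a)) ω) - ∫ ω, f (U (e (i, a)) ω) ∂P)|} ⊆
      ⋃ s : Fin n → Bool, {ω | n * m * δ ≤ ∑ k, X s k ω} := by
    intro ω hω
    rw [Set.mem_iUnion]
    let Y : Fin n → ℝ := fun i => ∑ a : Fin m, (f (U (e (i, a)) ω) - E (e (i, a)))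
    -- These signs turn the signed sum into the sum of absolute values.
    refine ⟨fun i => decide (0 ≤ Y i), ?_⟩
    have h1 : ∀ y : ℝ, sg (decide (0 ≤ y)) * y = |y| := fun y => by
      by_cases hy : 0 ≤ y
      · simp [sg, hy, abs_of_nonneg hy]
      · simp [sg, hy, abs_of_neg (not_le.1 hy)]
    have h2 : ∑ k, X (fun i => decide (0 ≤ Y i)) k ω = ∑ i, |Y i| := by
      rw [← e.sum_comp, Fintype.sum_prod_type]
      refine Finset.sum_congr rfl fun i _ => ?_
      rw [← h1, Finset.mul_sum]
      refine Finset.sum_congr rfl fun a _ => ?_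
      simp only [X, Equiv.symm_apply_apply, E]
      rw [integral_const_mul, mul_sub]
    rw [Set.mem_ofPred_eq, h2]
    have h3 : δ ≤ (n : ℝ)⁻¹ * ∑ i : Fin n, |(m : ℝ)⁻¹ * Y i| := hω
    simp_rw [abs_mul, abs_of_pos (inv_pos.2 hm0)] at h3
    rw [← Finset.mul_sum] at h3
    calc n * m * δ ≤ n * m * ((n : ℝ)⁻¹ * ((m : ℝ)⁻¹ * ∑ i, |Y i|)) :=
          mul_le_mul_of_nonneg_left h3 (by positivity)
      _ = _ := by field_simp
  have hprob : ∀ s : Fin n → Bool, P {ω | n * m * δ ≤ ∑ k, X s k ω} ≤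
      ENNReal.ofReal (Real.exp (-(δ ^ 2 / (2 * B ^ 2)) * (n * m))) := by
    intro s
    have hXind : iIndepFun (X s) P := hind.comp
      (fun k v => sg (s (e.symm k).1) * f v - ∫ ω, sg (s (e.symm k).1) * f (U k ω) ∂P)
      fun k => (hf.const_mul _).sub_const _
    -- The values lie in [-B, B], so the variance parameter is B².
    have hsG : ∀ k ∈ Finset.univ, HasSubgaussianMGF (X s k) ((‖B - -B‖₊ / 2) ^ 2) P := by
      intro k _
      refine hasSubgaussianMGF_of_mem_Icc ((hf.comp (hU k)).const_mul _).aemeasurable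
        (ae_of_all _ fun ω => abs_le.1 ?_)
      rw [abs_mul, hsg, one_mul]
      exact hfB _
    have h1 := HasSubgaussianMGF.measure_sum_ge_le_of_iIndepFun hXind hsG
      (ε := n * m * δ) (by positivity)
    rw [← ENNReal.ofReal_toReal (measure_ne_top P {ω | n * m * δ ≤ ∑ k, X s k ω})]
    refine ENNReal.ofReal_le_ofReal (h1.trans (le_of_eq ?_))
    congr 1
    simp only [Finset.sum_const, Finset.card_univ, Fintype.card_fin, nsmul_eq_mul, sub_neg_eq_add,
      Nat.cast_mul]
    push_cast
    rw [Real.norm_of_nonneg (by positivity)]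
    field_simp
    ring
  refine (measure_mono hsub).trans ((measure_iUnion_fintype_le _ _).trans
    ((Finset.sum_le_sum fun s _ => hprob s).trans (le_of_eq ?_)))
  rw [Finset.sum_const, Finset.card_univ, Fintype.card_fun, Fintype.card_bool, Fintype.card_fin,
    nsmul_eq_mul, ENNReal.ofReal_mul (by positivity)]
  congr 1
  rw [ENNReal.ofReal_pow (by norm_num)]
  simp

omit [IsProbabilityMeasure P] in
-- Borel–Cantelli over pairs (n,m): almost surely only finitely many bad pairs remain, so one m₁
-- serves all n.
theorem ae_eventually_notMem_of_exp_bound {A : ℕ → ℕ → Set Ω} {κ : ℝ} (hκ : 0 < κ)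
    (hA : ∀ n m, 0 < n → 0 < m → P (A n m) ≤ ENNReal.ofReal (2 ^ n * Real.exp (-κ * (n * m)))) :
    ∀ᵐ ω ∂P, ∃ m₁ : ℕ, ∀ n, 0 < n → ∀ m ≥ m₁, ω ∉ A n m := by
  -- For m ≥ m₀ the factor 2^n is at most exp(κnm/2). Half of the decay survives and is dominated by
  -- a double geometric series.
  obtain ⟨m₀, hm₀⟩ := exists_nat_gt (2 * Real.log 2 / κ)
  rw [div_lt_iff₀ hκ] at hm₀
  set q := Real.exp (-(κ / 2)) with hq
  have hq1 : ENNReal.ofReal q < 1 := by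
    rw [ENNReal.ofReal_lt_one, hq, Real.exp_lt_one_iff]
    linarith
  have hb : ∀ z : ℕ × ℕ, P (A (z.1 + 1) (z.2 + m₀ + 1)) ≤
      ENNReal.ofReal q ^ z.1 * ENNReal.ofReal q ^ z.2 := by
    rintro ⟨n, m⟩
    refine (hA _ _ n.succ_pos (Nat.succ_pos _)).trans ?_
    rw [← ENNReal.ofReal_pow (Real.exp_pos _).le, ← ENNReal.ofReal_pow (Real.exp_pos _).le,
      ← ENNReal.ofReal_mul (by positivity)]
    refine ENNReal.ofReal_le_ofReal ?_
    have h2 : (2 : ℝ) ^ (n + 1) = Real.exp ((n + 1 : ℕ) * Real.log 2) := by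
      rw [Real.exp_nat_mul, Real.exp_log (by norm_num)]
    dsimp only
    rw [h2, ← Real.exp_nat_mul, ← Real.exp_nat_mul, ← Real.exp_add, ← Real.exp_add,
      Real.exp_le_exp]
    push_cast
    have hn : (0 : ℝ) ≤ n := Nat.cast_nonneg n
    have hm : (0 : ℝ) ≤ m := Nat.cast_nonneg m
    have hm0 : (0 : ℝ) ≤ m₀ := Nat.cast_nonneg m₀
    have h3 : ((n : ℝ) + 1) * (2 * Real.log 2) ≤ (n + 1) * (m₀ * κ) :=
      mul_le_mul_of_nonneg_left hm₀.le (by positivity)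
    have h4 : 0 ≤ κ * (n * m) := by positivity
    have h5 : 0 ≤ κ * n * m₀ := by positivity
    have h6 : 0 ≤ κ * n := by positivity
    have h7 : 0 ≤ κ * m := by positivity
    have h8 : 0 ≤ κ * m₀ := by positivity
    nlinarith
  have hsum : ∑' z : ℕ × ℕ, P (A (z.1 + 1) (z.2 + m₀ + 1)) ≠ ⊤ := by
    refine ne_top_of_le_ne_top ?_ (ENNReal.tsum_le_tsum hb)
    rw [ENNReal.tsum_prod (f := fun a b => ENNReal.ofReal q ^ a * ENNReal.ofReal q ^ b)]
    simp_rw [ENNReal.tsum_mul_left, ENNReal.tsum_mul_right, ENNReal.tsum_geometric]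
    have : (1 - ENNReal.ofReal q)⁻¹ ≠ ⊤ := by
      rw [Ne, ENNReal.inv_eq_top, tsub_eq_zero_iff_le, not_le]
      exact hq1
    exact ENNReal.mul_ne_top this this
  filter_upwards [ae_finite_setOfPred_mem hsum] with ω hω
  obtain ⟨M, hM⟩ := (hω.image Prod.snd).bddAbove
  -- The events were shifted by m₀ + 1 in m, and one more makes the shifted index exceed M.
  refine ⟨M + m₀ + 2, fun n hn m hm hmem => ?_⟩
  have := hM ⟨(n - 1, m - m₀ - 1), by
    change ω ∈ A (n - 1 + 1) (m - m₀ - 1 + m₀ + 1)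
    rwa [show n - 1 + 1 = n by omega, show m - m₀ - 1 + m₀ + 1 = m by omega], rfl⟩
  simp only at this
  omega

end Concentration

/-! ### Convergence at the initial time -/

/-- The integral of `f` against the initial density at `x`. -/
def initialPairing (ρ₀ : Phase → I → ℝ) (f : Phase → ℝ) (x : I) : ℝ := ∫ u, f u * ρ₀ u x

theorem measurable_initialPairing {ρ₀ : Phase → I → ℝ} (hρ₀ : IsInitialDensity ρ₀)
    {f : Phase → ℝ} (hf : Measurable f) : Measurable (initialPairing ρ₀ f) :=
  (StronglyMeasurable.integral_prod_right' (ν := (volume : Measure Phase))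
    (f := fun p : I × Phase => f p.2 * ρ₀ p.2 p.1) ((hf.comp measurable_snd).mul
      (hρ₀.measurable.comp measurable_swap)).stronglyMeasurable).measurable

theorem abs_initialPairing_le {ρ₀ : Phase → I → ℝ} (hρ₀ : IsInitialDensity ρ₀)
    {f : Phase → ℝ} {B : ℝ} (hf : ∀ u, |f u| ≤ B) (x : I) : |initialPairing ρ₀ f x| ≤ B := by
  have h := abs_integral_le_of_abs_le (f := fun u => f u * ρ₀ u x) (g := fun u => B * ρ₀ u x)
    ((hρ₀.integrable x).const_mul B) (ae_of_all _ fun u => by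
      rw [abs_mul, abs_of_nonneg (hρ₀.nonneg u x)]
      exact mul_le_mul_of_nonneg_right (hf u) (hρ₀.nonneg u x))
  rwa [integral_const_mul, hρ₀.integral_eq_one, mul_one] at h

theorem abs_integral_mul_sub_le {f g₁ g₂ : Phase → ℝ} (hf : Integrable f)
    (hf0 : ∀ᵐ u, 0 ≤ f u) (hf1 : ∫ u, f u = 1) (hg₁ : Continuous g₁) (hg₂ : Continuous g₂) {c : ℝ}
    (h : ∀ u, |g₁ u - g₂ u| ≤ c) : |(∫ u, f u * g₁ u) - ∫ u, f u * g₂ u| ≤ c := by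
  rw [← integral_sub (integrable_mul_continuous hf hg₁) (integrable_mul_continuous hf hg₂)]
  have h := abs_integral_le_of_abs_le (f := fun u => f u * g₁ u - f u * g₂ u)
    (g := fun u => f u * c) (hf.mul_const c) (by
      filter_upwards [hf0] with u hu
      rw [← mul_sub, abs_mul, abs_of_nonneg hu]
      exact mul_le_mul_of_nonneg_left (h u) hu)
  rwa [integral_mul_const, hf1, one_mul] at h

/-- For C¹ tests this is the initial condition contained in the weak formulation. Mollification
extends it to Lipschitz tests. -/
theorem IsSolutionSlice.integral_zero_eq {T : ℝ} (hT : 0 < T) {W : I → I → ℝ} {D : Phase → ℝ}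
    {ρ₀ : Phase → I → ℝ} (hρ₀ : IsInitialDensity ρ₀) {ρ : ℝ → Phase → I → ℝ} {x : I}
    (h : IsSolutionSlice T W D ρ₀ ρ x) {f : Phase → ℝ} (hf : LipBound 1 f) :
    ∫ u, ρ 0 u x * f u = initialPairing ρ₀ f x := by
  have h0 : (0 : ℝ) ∈ Set.Icc 0 T := ⟨le_rfl, hT.le⟩
  rw [← sub_eq_zero, ← abs_nonpos_iff]
  refine le_of_forall_pos_le_add fun η hη => ?_
  have hη' : 0 < η / 2 := half_pos hη
  have hs := abs_steklov_sub_le hη' zero_le_one hf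
  have hc := hf.continuous
  have hC1 := isC1_steklov (η / 2) hc
  have e1 := abs_integral_mul_sub_le (h.solution.integrable 0 h0) (h.nonneg 0 h0)
    (h.integral_eq_one 0 h0) hC1.continuous hc hs
  have e2 := abs_integral_mul_sub_le (hρ₀.integrable x) (ae_of_all _ fun u => hρ₀.nonneg u x)
    (hρ₀.integral_eq_one x) hC1.continuous hc hs
  have e3 := h.solution.initial hT hC1
  have e4 : ∫ u, steklov (η / 2) f u * ρ₀ u x = ∫ u, ρ₀ u x * steklov (η / 2) f u := by
    simp_rw [mul_comm]
  have e5 : initialPairing ρ₀ f x = ∫ u, ρ₀ u x * f u := by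
    simp_rw [initialPairing, mul_comm]
  rw [e5]
  rw [e3, e4] at e1
  rw [abs_le] at *
  constructor <;> linarith [e1.1, e1.2, e2.1, e2.2]

section Initial

variable {T : ℝ} (hT : 0 < T) {W : I → I → ℝ} (hW : IsGraphon W) {D : Phase → ℝ}
  (hD : IsCoupling D) {ρ₀ : Phase → I → ℝ} (hρ₀ : IsInitialDensity ρ₀) {ρ : ℝ → Phase → I → ℝ}
  (hρ : IsWeakSolution T W D ρ₀ ρ)
include hT hW hD hρ₀ hρ

/-- For each f in the net the error splits into the random fluctuation of block averages about their
means and the deterministic Riemann-sum error of those means. -/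
theorem dBar_zero_le {η : ℝ} (hη : 0 ≤ η) {S : Finset (Phase → ℝ)}
    (hS : ∀ f ∈ S, LipschitzWith 1 f ∧ ∀ u, |f u| ≤ Real.pi)
    (hnet : ∀ f : Phase → ℝ, LipschitzWith 1 f → f 0 = 0 → ∃ g ∈ S, ∀ u, |f u - g u| ≤ η)
    {n m : ℕ} (hn : 0 < n) (hm : 0 < m) (y : Fin (n * m) → ℝ) :
    dBar (blockEmpirical n m y) (densityMeasure ρ 0) ≤ ENNReal.ofReal (2 * η + ∑ f ∈ S,
      ((n : ℝ)⁻¹ * ∑ i : Fin n, |(m : ℝ)⁻¹ * ∑ a : Fin m, (f (y (finProdFinEquiv (i, a)) : Phase)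
        - initialPairing ρ₀ f (node (n * m) (finProdFinEquiv (i, a))))| +
      ∑ i : Fin n, ∫ x in block n i, |(m : ℝ)⁻¹ * ∑ a : Fin m,
        initialPairing ρ₀ f (node (n * m) (finProdFinEquiv (i, a))) - initialPairing ρ₀ f x|)) := by
  have h0 : (0 : ℝ) ∈ Set.Icc 0 T := ⟨le_rfl, hT.le⟩
  set c : (Phase → ℝ) → Fin n → ℝ := fun f i => |(m : ℝ)⁻¹ * ∑ a : Fin m,
    (f (y (finProdFinEquiv (i, a)) : Phase)
      - initialPairing ρ₀ f (node (n * m) (finProdFinEquiv (i, a))))| with hc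
  set b : (Phase → ℝ) → Fin n → I → ℝ := fun f i x => |(m : ℝ)⁻¹ * ∑ a : Fin m,
    initialPairing ρ₀ f (node (n * m) (finProdFinEquiv (i, a))) - initialPairing ρ₀ f x| with hb
  have hbi : ∀ f ∈ S, ∀ i, Integrable (b f i) := fun f hf i =>
    ((integrable_const _).sub (Integrable.of_bound
      (measurable_initialPairing hρ₀ (hS f hf).1.continuous.measurable).aestronglyMeasurable
      Real.pi (ae_of_all _ (abs_initialPairing_le hρ₀ (hS f hf).2)))).abs
  set F : (Phase → ℝ) → Fin n → I → ℝ := fun f i x => c f i + b f i x with hF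
  have hFi : ∀ f ∈ S, ∀ i, Integrable (F f i) := fun f hf i =>
    (integrable_const _).add (hbi f hf i)
  set G : I → ℝ := fun x => 2 * η + ∑ f ∈ S, ∑ i, (block n i).indicator (F f i) x with hG
  have hGi' : ∀ f ∈ S, Integrable fun x => ∑ i, (block n i).indicator (F f i) x := fun f hf =>
    integrable_finsetSum _ fun i _ => (hFi f hf i).indicator (measurableSet_block n i)
  have hGi : Integrable G := (integrable_const _).add (integrable_finsetSum _ hGi')
  have hG0 : ∀ x, 0 ≤ G x := fun x => add_nonneg (by positivity) (Finset.sum_nonneg fun f _ =>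
    Finset.sum_nonneg fun i _ => Set.indicator_nonneg
      (fun _ _ => add_nonneg (abs_nonneg _) (abs_nonneg _)) x)
  have hGint : ∫ x, G x = 2 * η + ∑ f ∈ S, ((n : ℝ)⁻¹ * ∑ i, c f i +
      ∑ i, ∫ x in block n i, b f i x) := by
    simp only [hG]
    rw [integral_add (integrable_const _) (integrable_finsetSum _ hGi'),
      integral_finsetSum _ hGi']
    congr 1
    · simp
    · refine Finset.sum_congr rfl fun f hf => ?_
      rw [integral_sum_indicator_block _ (hFi f hf), Finset.mul_sum, ← Finset.sum_add_distrib]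
      refine Finset.sum_congr rfl fun i _ => ?_
      simp only [hF]
      rw [integral_add (integrable_const _).integrableOn (hbi f hf i).integrableOn,
        setIntegral_const, volume_real_block, smul_eq_mul]
  rw [← hGint, ofReal_integral_eq_lintegral_ofReal hGi (ae_of_all _ hG0)]
  refine lintegral_mono_ae ?_
  filter_upwards [ae_exists_mem_block hn, hρ.ae_isSolutionSlice hT hW hD hρ₀] with x ⟨i, hi⟩ hx
  have := isProbabilityMeasure_empirical hm fun j => (y (finProdFinEquiv (i, j)) : Phase)
  have := isProbabilityMeasure_densityMeasure (hx.solution.integrable 0 h0) (hx.nonneg 0 h0)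
    (hx.integral_eq_one 0 h0)
  rw [blockEmpirical_of_mem y hi]
  refine (dBL_le_sum_of_net (fun f hf => (hS f hf).1) hnet _ _).trans
    (ENNReal.ofReal_le_ofReal ?_)
  refine add_le_add_right (Finset.sum_le_sum fun f hf => ?_) _
  rw [sum_indicator_block _ hi, integral_empirical, integral_densityMeasure
    (hρ.measurable.comp (measurable_const.prodMk (measurable_id.prodMk measurable_const)))
    (hx.nonneg 0 h0), hx.integral_zero_eq hT hρ₀ (LipschitzWith.lipBound (hS f hf).1)]
  refine le_trans (le_of_eq ?_) (abs_add_le _ _)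
  rw [Finset.sum_sub_distrib]
  congr 1
  ring

end Initial

theorem integral_comp_of_law {Ω : Type*} [MeasurableSpace Ω] {P : Measure Ω}
    {ρ₀ : Phase → I → ℝ} (hρ₀ : IsInitialDensity ρ₀) {X : Ω → Phase} (hX : Measurable X) {x : I}
    (hlaw : P.map X = volume.withDensity fun v => ENNReal.ofReal (ρ₀ v x)) {f : Phase → ℝ}
    (hf : Continuous f) : ∫ ω, f (X ω) ∂P = initialPairing ρ₀ f x := by
  rw [← integral_map hX.aemeasurable hf.aestronglyMeasurable, hlaw]
  have h := integral_densityMeasure (ρ := fun _ => ρ₀) (t := 0) (x := x)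
    (hρ₀.measurable.comp measurable_prodMk_right) (ae_of_all _ fun u => hρ₀.nonneg u x) f
  rw [densityMeasure] at h
  rw [h, initialPairing]
  simp_rw [mul_comm]

theorem exists_eventually_dBar_le {Ω : Type*} [MeasurableSpace Ω] (P : Measure Ω)
    [IsProbabilityMeasure P] {T : ℝ} (hT : 0 < T) {W : I → I → ℝ} (hW : IsGraphon W)
    {D : Phase → ℝ} (hD : IsCoupling D) {ρ₀ : Phase → I → ℝ} (hρ₀ : IsInitialDensity ρ₀)
    {ρ : ℝ → Phase → I → ℝ} (hρ : IsWeakSolution T W D ρ₀ ρ)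
    {u₀ : (N : ℕ) → Fin N → Ω → Phase} (hu₀_meas : ∀ N i, Measurable (u₀ N i))
    (hu₀_indep : ∀ N, iIndepFun (u₀ N) P)
    (hu₀_law : ∀ N i, P.map (u₀ N i) =
      volume.withDensity (fun v => ENNReal.ofReal (ρ₀ v (node N i)))) {ε : ℝ} (hε : 0 < ε) :
    ∃ n₁ : ℕ, ∀ᵐ ω ∂P, ∃ m₁ : ℕ, ∀ n ≥ n₁, 0 < n → ∀ m ≥ m₁, 0 < m →
      ∀ y : Fin (n * m) → ℝ, (∀ k, (y k : Phase) = u₀ (n * m) k ω) →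
        (dBar (blockEmpirical n m y) (densityMeasure ρ 0)).toReal ≤ ε := by
  obtain ⟨S, hS, hnet⟩ := exists_finite_net (η := ε / 4) (by positivity)
  -- The net costs 2·ε/4 and each of its members at most 2δ, so the total is at most ε.
  set δ : ℝ := ε / (4 * (S.card + 1)) with hδ_def
  have hδ : 0 < δ := by positivity
  have hR : ∀ f : Phase → ℝ, ∃ n₀ : ℕ, f ∈ S → ∀ n ≥ n₀, 0 < n → ∀ m : ℕ, 0 < m →
      ∑ i : Fin n, ∫ x in block n i, |(m : ℝ)⁻¹ * ∑ a : Fin m,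
        initialPairing ρ₀ f (node (n * m) (finProdFinEquiv (i, a)))
          - initialPairing ρ₀ f x| ≤ δ := by
    intro f
    by_cases hf : f ∈ S
    · have hfc := (hS f hf).1.continuous
      obtain ⟨n₀, hn₀⟩ := RiemannIntegrable.exists_average_le (hρ₀.riemann ⟨f, hfc⟩)
        (measurable_initialPairing hρ₀ hfc.measurable) Real.pi_pos.le
        (abs_initialPairing_le hρ₀ (hS f hf).2) hδ
      exact ⟨n₀, fun _ => hn₀⟩
    · exact ⟨0, fun h => absurd h hf⟩
  choose n₀ hn₀ using hR
  have hC : ∀ᵐ ω ∂P, ∀ f ∈ S, ∃ m₁ : ℕ, ∀ n : ℕ, 0 < n → ∀ m ≥ m₁,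
      ω ∉ {ω | δ ≤ (n : ℝ)⁻¹ * ∑ i : Fin n, |(m : ℝ)⁻¹ * ∑ a : Fin m,
        (f (u₀ (n * m) (finProdFinEquiv (i, a)) ω)
          - initialPairing ρ₀ f (node (n * m) (finProdFinEquiv (i, a))))|} := by
    rw [Filter.eventually_all_finset]
    intro f hf
    refine ae_eventually_notMem_of_exp_bound (κ := δ ^ 2 / (2 * Real.pi ^ 2)) (A := fun n m =>
      {ω | δ ≤ (n : ℝ)⁻¹ * ∑ i : Fin n, |(m : ℝ)⁻¹ * ∑ a : Fin m,
        (f (u₀ (n * m) (finProdFinEquiv (i, a)) ω)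
          - initialPairing ρ₀ f (node (n * m) (finProdFinEquiv (i, a))))|})
      (by have := Real.pi_pos; positivity) fun n m hn hm => ?_
    have hfc := (hS f hf).1.continuous
    have h := measure_average_abs_ge_le hn hm (hu₀_meas (n * m)) (hu₀_indep (n * m))
      hfc.measurable Real.pi_pos (hS f hf).2 hδ
    -- The prescribed laws identify the expectations in the concentration bound with the pairings at
    -- the nodes.
    simp_rw [integral_comp_of_law hρ₀ (hu₀_meas _ _) (hu₀_law _ _) hfc] at h
    exact h
  refine ⟨S.sup n₀, ?_⟩
  filter_upwards [hC] with ω hω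
  have hω' : ∀ f : Phase → ℝ, ∃ m₁ : ℕ, f ∈ S → ∀ n : ℕ, 0 < n → ∀ m ≥ m₁,
      (n : ℝ)⁻¹ * ∑ i : Fin n, |(m : ℝ)⁻¹ * ∑ a : Fin m,
        (f (u₀ (n * m) (finProdFinEquiv (i, a)) ω)
          - initialPairing ρ₀ f (node (n * m) (finProdFinEquiv (i, a))))| ≤ δ := by
    intro f
    by_cases hf : f ∈ S
    · obtain ⟨m₁, hm₁⟩ := hω f hf
      exact ⟨m₁, fun _ n hn m hm => (not_le.1 (hm₁ n hn m hm)).le⟩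
    · exact ⟨0, fun h => absurd h hf⟩
  choose m₁ hm₁ using hω'
  refine ⟨S.sup m₁, fun n hn hn0 m hm hm0 y hy => ENNReal.toReal_le_of_le_ofReal hε.le
    ((dBar_zero_le hT hW hD hρ₀ hρ (by positivity) hS hnet hn0 hm0 y).trans
      (ENNReal.ofReal_le_ofReal ?_))⟩
  have h1 : ∀ f ∈ S, (n : ℝ)⁻¹ * ∑ i : Fin n, |(m : ℝ)⁻¹ * ∑ a : Fin m,
        (f (y (finProdFinEquiv (i, a)) : Phase)
        - initialPairing ρ₀ f (node (n * m) (finProdFinEquiv (i, a))))| +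
      ∑ i : Fin n, ∫ x in block n i, |(m : ℝ)⁻¹ * ∑ a : Fin m,
        initialPairing ρ₀ f (node (n * m) (finProdFinEquiv (i, a))) - initialPairing ρ₀ f x|
      ≤ 2 * δ := by
    intro f hf
    simp_rw [hy]
    have e1 := hm₁ f hf n hn0 m ((Finset.le_sup hf).trans hm)
    have e2 := hn₀ f hf n ((Finset.le_sup hf).trans hn) hn0 m hm0
    linarith
  have h2 := Finset.sum_le_sum h1
  rw [Finset.sum_const, nsmul_eq_mul] at h2
  have h3 : (S.card : ℝ) * (2 * δ) ≤ ε / 2 := by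
    rw [hδ_def]
    rw [← mul_div_assoc, ← mul_div_assoc, div_le_div_iff₀ (by positivity) (by norm_num)]
    nlinarith
  linarith

/-! ### Combining the stability estimate with the initial convergence -/

theorem exists_eventually_iSup_dBar_lt {Ω : Type*} [MeasurableSpace Ω] (P : Measure Ω)
    [IsProbabilityMeasure P] {T : ℝ} (hT : 0 < T) {W : I → I → ℝ} (hW : IsGraphon W)
    {D : Phase → ℝ} (hD : IsCoupling D) {ρ₀ : Phase → I → ℝ} (hρ₀ : IsInitialDensity ρ₀)
    {ρ : ℝ → Phase → I → ℝ} (hρ : IsWeakSolution T W D ρ₀ ρ)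
    {u₀ : (N : ℕ) → Fin N → Ω → Phase} (hu₀_meas : ∀ N i, Measurable (u₀ N i))
    (hu₀_indep : ∀ N, iIndepFun (u₀ N) P)
    (hu₀_law : ∀ N i, P.map (u₀ N i) =
      volume.withDensity (fun v => ENNReal.ofReal (ρ₀ v (node N i))))
    {u : (N : ℕ) → Ω → ℝ → Fin N → ℝ}
    (hu : ∀ N ω, IsKMSolution T W D N (fun i => u₀ N i ω) (u N ω)) {ε : ℝ} (hε : 0 < ε) :
    ∃ n₁ : ℕ, ∀ᵐ ω ∂P, ∃ m₁ : ℕ, ∀ n ≥ n₁, ∀ m ≥ m₁,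
      ⨆ t ∈ Set.Icc 0 T, dBar (fun x => blockEmpirical n m (u (n * m) ω t) x)
        (fun x => densityMeasure ρ t x) < ENNReal.ofReal ε := by
  set C : ℝ := Real.exp (2 * Real.exp T * T) * (2 * Real.exp T) with hC
  have hC0 : 0 < C := by positivity
  obtain ⟨n₁, hn₁⟩ := exists_eventually_dBar_le P hT hW hD hρ₀ hρ hu₀_meas hu₀_indep hu₀_law
    (ε := ε / (4 * C)) (by positivity)
  obtain ⟨n₂, hn₂⟩ := exists_integral_blockKernelError_le hW (η := ε / (4 * C * T)) (by positivity)
  -- The maximum with 1, here and for m, excludes n = 0 and m = 0, where there are no blocks or no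
  -- particles.
  refine ⟨max 1 (max n₁ n₂), ?_⟩
  filter_upwards [hn₁] with ω ⟨m₁, hm₁⟩
  refine ⟨max 1 m₁, fun n hn m hm => ?_⟩
  simp only [ge_iff_le, max_le_iff] at hn hm
  obtain ⟨hn0, hn1, hn2⟩ := hn
  obtain ⟨hm0, hm1⟩ := hm
  have e1 := hm₁ n hn1 hn0 m hm1 hm0 (u (n * m) ω 0) (hu (n * m) ω).init
  have e2 := hn₂ n hn2 hn0 m hm0
  -- The bound ε/2 at each time keeps the inequality strict after the supremum.
  refine lt_of_le_of_lt (iSup₂_le fun t ht => ?_)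
    ((ENNReal.ofReal_lt_ofReal_iff hε).2 (half_lt_self hε))
  have hfin := ne_top_of_le_ne_top ENNReal.ofReal_ne_top
    (dBar_le_two_pi hT hW hD hρ₀ hρ hn0 hm0 (u (n * m) ω t) ht)
  rw [← ENNReal.ofReal_toReal hfin]
  refine ENNReal.ofReal_le_ofReal
    ((dBar_le hT hW hD hρ₀ hρ hn0 hm0 (hu (n * m) ω) ht).trans ?_)
  rw [← mul_assoc, ← hC]
  calc C * (_ + T * _) ≤ C * (ε / (4 * C) + T * (ε / (4 * C * T))) :=
        mul_le_mul_of_nonneg_left (add_le_add e1 (mul_le_mul_of_nonneg_left e2 hT.le)) hC0.le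
    _ = ε / 2 := by field_simp; ring

end

end KuramotoGraphon

theorem theorem3p2 {Ω : Type*} [MeasurableSpace Ω] (P : Measure Ω) [IsProbabilityMeasure P]
    (T : ℝ) (hT : 0 < T)
    (W : I → I → ℝ) (hW : KuramotoGraphon.IsGraphon W)
    (D : KuramotoGraphon.Phase → ℝ) (hD : KuramotoGraphon.IsCoupling D)
    (ρ₀ : KuramotoGraphon.Phase → I → ℝ) (hρ₀ : KuramotoGraphon.IsInitialDensity ρ₀)
    (ρ : ℝ → KuramotoGraphon.Phase → I → ℝ)
    (hρ : KuramotoGraphon.IsWeakSolution T W D ρ₀ ρ)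
    (u₀ : (N : ℕ) → Fin N → Ω → KuramotoGraphon.Phase)
    (hu₀_meas : ∀ N i, Measurable (u₀ N i))
    (hu₀_indep : ∀ N, iIndepFun (u₀ N) P)
    (hu₀_law : ∀ N i, P.map (u₀ N i) =
      volume.withDensity (fun v => ENNReal.ofReal (ρ₀ v (KuramotoGraphon.node N i))))
    (u : (N : ℕ) → Ω → ℝ → Fin N → ℝ)
    (hu : ∀ N ω, KuramotoGraphon.IsKMSolution T W D N (fun i => u₀ N i ω) (u N ω))
    (ε : ℝ) (hε : 0 < ε) :
    ∃ n₁ : ℕ, ∀ᵐ ω ∂P, ∃ m₁ : ℕ, ∀ n ≥ n₁, ∀ m ≥ m₁,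
      ⨆ t ∈ Set.Icc 0 T,
        KuramotoGraphon.dBar
          (fun x => KuramotoGraphon.blockEmpirical n m (u (n * m) ω t) x)
          (fun x => KuramotoGraphon.densityMeasure ρ t x) < ENNReal.ofReal ε := by
  exact KuramotoGraphon.exists_eventually_iSup_dBar_lt P hT hW hD hρ₀ hρ hu₀_meas hu₀_indep
    hu₀_law hu hε
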